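/- **Setting.** Let $\mathbf T^4=[-\pi,\pi]^4/\!\sim$ with Lebesgue measure, let $\xi$ be white noise on $\mathbf T^4$ (a centred Gaussian process indexed by $L^2(\mathbf T^4)$ with $\mathbb E[\xi(f)\xi(g)]=\langle f,g\rangle$), let $G$ be the Green's function of $1-\Delta$ on $\mathbf T^4$, let $\varrho:\mathbf R^4\to\mathbf R$ be non-negative, radial, smooth, compactly supported with $\int\varrho=1$, and for $\varepsilon\in(0,1)$ let $\varrho_\varepsilon(x)=\varepsilon^{-4}\varrho(x/\varepsilon)$ and $G_\varepsilon=\varrho_\varepsilon\star G$. **Diagrams and valuation.** A Feynman diagram $\Gamma=(V,E)$ is a finite directed multigraph with a set $L\subseteq V$ of leaves; $V_\star=V\setminus L$. For $\Gamma$ connected put $$\Pi_\varepsilon\Gamma(x_L)=\int\prod_{e=(e_-,e_+)\in E}G_\varepsilon(x_{e_+}-x_{e_-})\,dx ,$$ where one integrates over all variables $x_v$, $v\in V_\star$, if $L\ne\emptyset$, and over all of them but an arbitrary one if $L=\emptyset$. For general $\Gamma$, $\Pi_\varepsilon\Gamma$ is the product over the connected components; $\Pi_\varepsilon$ is extended to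 a ring homomorphism on the polynomial ring generated by all diagrams. **Renormalised valuation.** A subdiagram $\bar\Gamma=(\bar V,\bar E)$ of $\Gamma$ is a subgraph with $\bar V\subseteq V_\star$ (regarded as a diagram without leaves); it is full if it contains each of its edges with the multiplicity that the edge has in $\Gamma$. It is divergent if it is connected (in particular non-empty), full, and $4(|\bar V|-1)-2|\bar E|<0$. A forest is a set $\mathfrak F$ of divergent subdiagrams any two of which are nested or vertex-disjoint; $\mathcal F^-_\Gamma$ is the set of all forests. Contracting a subdiagram means identifying its vertices to one vertex and deleting its edges. Let $\mathcal C_{\mathfrak F}\Gamma$ be the product of the diagram obtained from $\Gamma$ by contracting the maximal elements of $\mathfrak F$ and of the diagrams obtained from each $\gamma\in\mathfrak F$ by contracting the maximal elements of $\{\delta\in\mathfrak F:\delta\subsetneq\gamma\}$. The BPHZ renormalised valuation is given by the forest formula $$\hat\Pi_\varepsilon\Gamma=\Pi_\varepsilon\sum_{\mathfrak F\in\mathcal F^-_\Gamma}(-1)^{|\mathfrak F|}\,\mathcal C_{\mathfrak F}\Gamma .$$ **Renormalised trees.** For $n\ge1$ let $\mathcal I_n$ be the linear tree with vertices $0,\dots,n+1$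 and edges $(j,j+1)$, $0\le j\le n$; its leaves are $0$ (with variable $x$) and $n+1$ (with variable $y$), and $1,\dots,n$ are its internal vertices. A pairing $\kappa$ of a finite set is a set of disjoint two-element subsets; it is complete if these cover the set. For a pairing $\kappa$ of $\{1,\dots,n\}$ with set $V_o$ of unpaired elements let $\mathcal I^{\rm int}_{n,\kappa}$ be the Feynman diagram obtained from $\mathcal I_n$ by identifying paired vertices, with set of leaves $\{0,n+1\}\cup V_o$. The BPHZ renormalised tree is the random variable $$\mathfrak R_\varepsilon\mathcal I_n(x,y)=\sum_{\kappa}\int_{(\mathbf T^4)^{V_o}}\hat\Pi_\varepsilon\mathcal I^{\rm int}_{n,\kappa}(x,y,x_{V_o})\prod_{v\in V_o}\xi(x_v)\,dx_{V_o},$$ where $\kappa$ runs over all pairings of $\{1,\dots,n\}$ and the integrals are multiple Wiener–Itô integrals. **Proposition.** Let $k\in\mathbf N$, $\tau_i=\mathcal I_{n_i}$ with $n_i\ge1$ for $i=1,\dots,k$, $\varepsilon\in(0,1)$ and $x_i,y_i\in\mathbf T^4$. Let $\mathcal K(\tau_1,\dots,\tau_k)$ be the set of complete pairings of the disjoint union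 of the sets of internal vertices of $\tau_1,\dots,\tau_k$, and for such a $\kappa$ let $(\tau_1,\dots,\tau_k)_\kappa$ be the Feynman diagram obtained from the disjoint union of the trees by identifying paired vertices, whose leaves are the $2k$ leaves of the trees, with variables $x_i,y_i$. Then $\prod_{i}\mathfrak R_\varepsilon\tau_i(x_i,y_i)$ is integrable and $$\mathbb E\big[\mathfrak R_\varepsilon\tau_1(x_1,y_1)\cdots\mathfrak R_\varepsilon\tau_k(x_k,y_k)\big]=\sum_{\kappa\in\mathcal K(\tau_1,\dots,\tau_k)}\hat\Pi_\varepsilon(\tau_1,\dots,\tau_k)_\kappa(x_{1:k},y_{1:k}).$$ -/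

import Mathlib

noncomputable section

open MeasureTheory ProbabilityTheory Set

namespace AndersonBPHZ

/-! ### The torus and the mollified Green's function -/

instance fact_two_pi_pos : Fact (0 < 2 * Real.pi) := ⟨Real.two_pi_pos⟩

/-- The torus `[-π, π]⁴ / ∼`; its `volume` is Lebesgue measure, of total mass `(2π)⁴`. -/
abbrev T4 : Type := Fin 4 → AddCircle (2 * Real.pi)

/-- The canonical projection `ℝ⁴ → T⁴`. -/
def toTorus (y : EuclideanSpace ℝ (Fin 4)) : T4 := fun i => (y i : AddCircle (2 * Real.pi))

/-- The representative in `[-π, π)` of a point of the circle. -/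
def circleRep (a : AddCircle (2 * Real.pi)) : ℝ :=
  (AddCircle.equivIco (2 * Real.pi) (-Real.pi) a : ℝ)

/-- The heat kernel of `∂ₜ - Δ` on `T⁴`: the periodisation of
`(4πt)⁻² exp (-|x|² / (4t))`. -/
def heatKernel (t : ℝ) (x : T4) : ℝ :=
  ∑' m : Fin 4 → ℤ, ((4 * Real.pi * t) ^ 2)⁻¹ *
    Real.exp (-(∑ i, (circleRep (x i) + 2 * Real.pi * (m i : ℝ)) ^ 2) / (4 * t))

/-- The Green's function of `1 - Δ` on `T⁴`, i.e. the kernel of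
`(1 - Δ)⁻¹ = ∫₀^∞ e⁻ᵗ e^{tΔ} dt`. -/
def greenFunction (x : T4) : ℝ :=
  ∫ t in Ioi (0 : ℝ), Real.exp (-t) * heatKernel t x

/-- Mollifiers: non-negative, radial, smooth, compactly supported, of integral one. -/
structure IsMollifier (ρ : EuclideanSpace ℝ (Fin 4) → ℝ) : Prop where
  nonneg : ∀ y, 0 ≤ ρ y
  radial : ∀ y z, ‖y‖ = ‖z‖ → ρ y = ρ z
  smooth : ContDiff ℝ (⊤ : ℕ∞) ρ
  compact : HasCompactSupport ρ
  integral_eq_one : ∫ y, ρ y = 1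

/-- `G_ε = ρ_ε ⋆ G` with `ρ_ε(y) = ε⁻⁴ ρ(y / ε)`. -/
def mollifiedGreen (ρ : EuclideanSpace ℝ (Fin 4) → ℝ) (ε : ℝ) (x : T4) : ℝ :=
  ∫ y : EuclideanSpace ℝ (Fin 4), (ε ^ 4)⁻¹ * ρ (ε⁻¹ • y) * greenFunction (x - toTorus y)

/-! ### White noise and multiple Wiener-Itô integrals -/

/-- White noise on `T⁴`: a centred Gaussian process indexed by `L²(T⁴)` whose covariance is the
`L²` inner product. The noise is allowed to be defined only up to null sets. -/
structure WhiteNoise {Ω : Type*} [MeasurableSpace Ω] (P : Measure Ω) where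
  toFun : Lp ℝ 2 (volume : Measure T4) → Ω → ℝ
  gaussian : IsGaussianProcess toFun P
  centred : ∀ f, ∫ ω, toFun f ω ∂P = 0
  covariance : ∀ f g, ∫ ω, toFun f ω * toFun g ω ∂P = inner ℝ f g

section Wiener

variable {Ω : Type*} [MeasurableSpace Ω] {P : Measure Ω}

/-- The noise `ξ(A)` of a measurable set `A`. -/
def WhiteNoise.ofSet (ξ : WhiteNoise P) {A : Set T4} (hA : MeasurableSet A) : Ω → ℝ :=
  ξ.toFun (indicatorConstLp 2 hA (measure_ne_top volume A) (1 : ℝ))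

theorem WhiteNoise.memLp_prod_ofSet (ξ : WhiteNoise P) {ι : Type*} [Fintype ι]
    (A : ι → Set T4) (hA : ∀ i, MeasurableSet (A i)) :
    MemLp (fun ω => ∏ i, ξ.ofSet (hA i) ω) 2 P := by
  have : IsProbabilityMeasure P := ξ.gaussian.isProbabilityMeasure
  have h : ∀ i ∈ (Finset.univ : Finset ι),
      MemLp (ξ.ofSet (hA i)) (2 * (Fintype.card ι : ENNReal)) P := fun i _ =>
    (ξ.gaussian.hasGaussianLaw_eval _).memLp
      (ENNReal.mul_ne_top (by simp) (by simp))
  have h2 := MemLp.prod' h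
  refine h2.mono_exponent ?_
  rcases Nat.eq_zero_or_pos (Fintype.card ι) with h0 | hpos
  · simp [h0]
  · have hc : (Fintype.card ι : ENNReal) ≠ 0 := by exact_mod_cast hpos.ne'
    simp only [Finset.sum_const, Finset.card_univ, nsmul_eq_mul]
    rw [ENNReal.mul_inv (a := 2) (Or.inl (by simp)) (Or.inl (by simp)),
      mul_comm (2⁻¹ : ENNReal), ← mul_assoc, ENNReal.mul_inv_cancel hc (by simp), one_mul, inv_inv]

/-- Families `(A_i)_{i ∈ ι}` of pairwise disjoint measurable subsets of the torus. -/
abbrev DisjointFamily (ι : Type) : Type :=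
  {A : ι → Set T4 // (∀ i, MeasurableSet (A i)) ∧ Pairwise fun i j => Disjoint (A i) (A j)}

variable (ι : Type) [Fintype ι]

/-- The elementary function `∑ c_A 𝟙_{∏ A_i}` attached to a formal combination of families of
pairwise disjoint sets. -/
def elementaryFun : (DisjointFamily ι →₀ ℝ) →ₗ[ℝ] Lp ℝ 2 (volume : Measure (ι → T4)) :=
  Finsupp.linearCombination ℝ fun A : DisjointFamily ι =>
    indicatorConstLp 2 (MeasurableSet.univ_pi A.2.1)
      (measure_ne_top volume (Set.univ.pi A.1)) (1 : ℝ)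

/-- The integral `∑ c_A ∏ ξ(A_i)` of an elementary function. -/
def elementaryIntegral (ξ : WhiteNoise P) : (DisjointFamily ι →₀ ℝ) →ₗ[ℝ] Lp ℝ 2 P :=
  Finsupp.linearCombination ℝ fun A : DisjointFamily ι =>
    (ξ.memLp_prod_ofSet A.1 A.2.1).toLp _

/-- The multiple Wiener-Itô integral, with variables indexed by the finite set `ι`, on
`L²((T⁴)^ι)`: the continuous extension of the integral of elementary functions. -/
def wienerIntegralLp (ξ : WhiteNoise P) :
    Lp ℝ 2 (volume : Measure (ι → T4)) →L[ℝ] Lp ℝ 2 P :=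
  (elementaryIntegral ι ξ).extendOfNorm (elementaryFun ι)

variable {ι}

open Classical in
/-- The multiple Wiener-Itô integral `∫ f(z) ∏_{i ∈ ι} ξ(z_i) dz` of a square integrable
function. -/
def wienerIntegral (ξ : WhiteNoise P) (f : (ι → T4) → ℝ) : Ω → ℝ :=
  if h : MemLp f 2 (volume : Measure (ι → T4)) then wienerIntegralLp ι ξ (h.toLp f) else 0

end Wiener

/-! ### Feynman diagrams and their valuation -/

/-- A Feynman diagram: a finite directed multigraph, with individually named edges, and a set of
leaves. The leaves are the vertices `v` with `label v ≠ none`; they carry labels in `Λ`, which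
name the variables on which the valuation depends. Diagrams without leaves are allowed. -/
structure FeynmanDiagram (Λ : Type) where
  V : Type
  E : Type
  [fintypeV : Fintype V]
  [fintypeE : Fintype E]
  src : E → V
  tgt : E → V
  label : V → Option Λ

attribute [instance] FeynmanDiagram.fintypeV FeynmanDiagram.fintypeE

namespace FeynmanDiagram

variable {Λ : Type} (Γ : FeynmanDiagram Λ)

/-- There is an edge from `v` to `w`. -/
def Adj (v w : Γ.V) : Prop := ∃ e, Γ.src e = v ∧ Γ.tgt e = w

/-- Connectedness of the underlying undirected graph; the empty graph is not connected. -/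
def Connected : Prop := Nonempty Γ.V ∧ ∀ v w, Relation.EqvGen Γ.Adj v w

/-- The connected components of the underlying undirected graph. -/
abbrev Component : Type := Quot Γ.Adj

instance : Fintype Γ.Component := Fintype.ofFinite _

open Classical in
/-- A connected component, as a diagram. -/
def component (c : Γ.Component) : FeynmanDiagram Λ where
  V := {v : Γ.V // Quot.mk Γ.Adj v = c}
  E := {e : Γ.E // Quot.mk Γ.Adj (Γ.src e) = c}
  src e := ⟨Γ.src e.1, e.2⟩
  tgt e := ⟨Γ.tgt e.1, (Quot.sound ⟨e.1, rfl, rfl⟩ : Quot.mk Γ.Adj (Γ.src e.1) = _).symm.trans e.2⟩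
  label v := Γ.label v.1

/-- `∏_e G(x_{e₊} - x_{e₋})` for an assignment of points to all vertices. -/
def kernel (G : T4 → ℝ) (x : Γ.V → T4) : ℝ :=
  ∏ e : Γ.E, G (x (Γ.tgt e) - x (Γ.src e))

/-- The internal vertices. -/
abbrev Internal : Type := {v : Γ.V // Γ.label v = none}

instance : Fintype Γ.Internal := Fintype.ofFinite _

/-- The assignment of points given by `x` on the leaves and by `z` on the internal vertices. -/
def assign (x : Λ → T4) (z : Γ.Internal → T4) (v : Γ.V) : T4 :=
  match h : Γ.label v with
  | some l => x l
  | none => z ⟨v, h⟩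

open Classical in
/-- Valuation of a connected diagram. If there are leaves, all internal variables are integrated;
otherwise all variables but that of the vertex `v₀`, which is put at the origin (by
translation invariance neither the choice of `v₀` nor that of the point matters). -/
def connectedValuation (G : T4 → ℝ) (v₀ : Γ.V) (x : Λ → T4) : ℝ :=
  if ∃ v, Γ.label v ≠ none then
    ∫ z : Γ.Internal → T4, Γ.kernel G (Γ.assign x z)
  else
    ∫ z : {v : Γ.V // v ≠ v₀} → T4,
      Γ.kernel G fun v => if h : v = v₀ then 0 else z ⟨v, h⟩

/-- The valuation `Π Γ`: the product of the valuations of the connected components. -/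
def valuation (G : T4 → ℝ) (x : Λ → T4) : ℝ :=
  ∏ c : Γ.Component, (Γ.component c).connectedValuation G ⟨Quot.out c, Quot.out_eq c⟩ x

/-! ### Subdiagrams, contractions, forests -/

/-- Subdiagrams: subgraphs made of internal vertices (hence of internal edges). -/
@[ext]
structure Subdiagram where
  verts : Set Γ.V
  edges : Set Γ.E
  internal : ∀ v ∈ verts, Γ.label v = none
  src_mem : ∀ e ∈ edges, Γ.src e ∈ verts
  tgt_mem : ∀ e ∈ edges, Γ.tgt e ∈ verts

variable {Γ}

theorem Subdiagram.toPair_injective :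
    Function.Injective fun γ : Γ.Subdiagram => (γ.verts, γ.edges) := fun _ _ h =>
  Subdiagram.ext (congrArg Prod.fst h) (congrArg Prod.snd h)

/-- Inclusion of subdiagrams. -/
instance : PartialOrder Γ.Subdiagram := PartialOrder.lift _ Subdiagram.toPair_injective

instance : Finite Γ.Subdiagram := Finite.of_injective _ Subdiagram.toPair_injective

instance : Fintype Γ.Subdiagram := Fintype.ofFinite _

namespace Subdiagram

variable (γ : Γ.Subdiagram)

open Classical in
/-- A subdiagram is itself a diagram, without leaves. -/
def toDiagram : FeynmanDiagram Λ where
  V := {v : Γ.V // v ∈ γ.verts}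
  E := {e : Γ.E // e ∈ γ.edges}
  src e := ⟨Γ.src e.1, γ.src_mem e.1 e.2⟩
  tgt e := ⟨Γ.tgt e.1, γ.tgt_mem e.1 e.2⟩
  label _ := none

/-- A subdiagram is full if with an edge it contains all edges with the same source and target,
that is, if it contains each of its edges with full multiplicity. -/
def Full : Prop :=
  ∀ e ∈ γ.edges, ∀ e', Γ.src e' = Γ.src e → Γ.tgt e' = Γ.tgt e → e' ∈ γ.edges

/-- The degree of a connected subdiagram. -/
def deg : ℤ := 4 * ((γ.verts.ncard : ℤ) - 1) - 2 * (γ.edges.ncard : ℤ)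

/-- The divergent subdiagrams: connected, full, and of strictly negative degree. -/
def Divergent : Prop := γ.toDiagram.Connected ∧ γ.Full ∧ γ.deg < 0

/-- The subdiagram `δ`, seen as a subdiagram of `γ` (used for `δ ≤ γ`). -/
def restrict (δ : Γ.Subdiagram) : γ.toDiagram.Subdiagram where
  verts := {v | v.1 ∈ δ.verts}
  edges := {e | e.1 ∈ δ.edges}
  internal _ _ := rfl
  src_mem e he := δ.src_mem e.1 he
  tgt_mem e he := δ.tgt_mem e.1 he

end Subdiagram

open Classical in
/-- The diagram `Γ / S` in which each of the (pairwise vertex disjoint) subdiagrams in `S` is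
contracted to a vertex: its vertices are identified and its edges are removed. -/
def contract (Γ : FeynmanDiagram Λ) (S : Set Γ.Subdiagram) : FeynmanDiagram Λ where
  V := Quot fun v w : Γ.V => ∃ γ ∈ S, v ∈ γ.verts ∧ w ∈ γ.verts
  E := {e : Γ.E // ∀ γ ∈ S, e ∉ γ.edges}
  fintypeV := Fintype.ofFinite _
  src e := Quot.mk _ (Γ.src e.1)
  tgt e := Quot.mk _ (Γ.tgt e.1)
  label := Quot.lift Γ.label (by
    rintro v w ⟨γ, -, hv, hw⟩
    rw [γ.internal v hv, γ.internal w hw])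

/-- Forests: sets of divergent subdiagrams any two of which are nested or vertex disjoint. -/
def IsForest (F : Finset Γ.Subdiagram) : Prop :=
  (∀ γ ∈ F, γ.Divergent) ∧
    ∀ γ₁ ∈ F, ∀ γ₂ ∈ F, γ₁ ≤ γ₂ ∨ γ₂ ≤ γ₁ ∨ Disjoint γ₁.verts γ₂.verts

/-- The roots of a forest: its maximal elements. -/
def roots (F : Finset Γ.Subdiagram) : Set Γ.Subdiagram := {γ | Maximal (· ∈ F) γ}

/-- The children of `γ` in a forest: the maximal elements strictly below `γ`. -/
def children (F : Finset Γ.Subdiagram) (γ : Γ.Subdiagram) : Set Γ.Subdiagram :=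
  {δ | Maximal (fun δ' => δ' ∈ F ∧ δ' < γ) δ}

/-- The extraction `C_F Γ`, in the polynomial ring generated by all diagrams. Every element of the
forest is extracted, smaller elements being extracted from larger ones; this leaves, for each
`γ ∈ F`, the diagram `γ` with its children contracted, and `Γ` with the roots contracted. -/
def extract (F : Finset Γ.Subdiagram) : MvPolynomial (FeynmanDiagram Λ) ℝ :=
  (∏ γ ∈ F, MvPolynomial.X (γ.toDiagram.contract (γ.restrict '' children F γ))) *
    MvPolynomial.X (Γ.contract (roots F))

variable (Γ)

open Classical in
/-- BPHZ renormalisation of a diagram, by Zimmermann's forest formula. -/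
def renormalise : MvPolynomial (FeynmanDiagram Λ) ℝ :=
  ∑ F : Finset Γ.Subdiagram with IsForest F, (-1) ^ F.card * extract F

/-- The renormalised valuation: the valuation, extended to a ring homomorphism on the polynomial
ring generated by all diagrams, of the renormalised diagram. -/
def renormalisedValuation (G : T4 → ℝ) (x : Λ → T4) : ℝ :=
  MvPolynomial.eval (fun Γ' : FeynmanDiagram Λ => Γ'.valuation G x) Γ.renormalise

end FeynmanDiagram

/-! ### Trees, pairings, and paired diagrams

The linear tree with `n` internal vertices has vertices `0, …, n + 1`, of which `0` (bottom) and
`n + 1` (top) are leaves, and edges `(j, j + 1)`. Its `j`-th internal vertex, `j : Fin n`, is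
`j + 1`. -/

/-- The two leaves of a tree. -/
inductive Leaf : Type
  | bottom
  | top

/-- The points attached to the two leaves. -/
def Leaf.point (x y : T4) : Leaf → T4
  | bottom => x
  | top => y

/-- The vertex of the tree that corresponds to the `j`-th noise. -/
def innerVertex {n : ℕ} (j : Fin n) : Fin (n + 2) := j.succ.castSucc

/-- Case distinction on the vertices of a tree: bottom, top, or internal. -/
def vertexCases {α : Type} {n : ℕ} (bottom top : α) (inner : Fin n → α) (v : Fin (n + 2)) : α :=
  Fin.lastCases top (fun w => Fin.cases bottom inner w) v

@[simp]
theorem vertexCases_innerVertex {α : Type} {n : ℕ} (b t : α) (f : Fin n → α) (j : Fin n) :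
    vertexCases b t f (innerVertex j) = f j := by
  simp only [vertexCases, innerVertex, Fin.lastCases_castSucc, Fin.cases_succ]

/-- Pairings of a set `S`, not necessarily complete: involutions of `S`; the elements `s` and `κ s`
are paired if they differ, and `s` is unpaired if `κ s = s`. -/
abbrev Pairing (S : Type) : Type := {κ : S → S // Function.Involutive κ}

/-- Complete pairings: involutions without fixed points. -/
abbrev CompletePairing (S : Type) : Type :=
  {κ : S → S // Function.Involutive κ ∧ ∀ s, κ s ≠ s}

instance {S : Type} [Finite S] : Fintype (Pairing S) := Fintype.ofFinite _

instance {S : Type} [Finite S] : Fintype (CompletePairing S) := Fintype.ofFinite _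

/-- The unpaired elements. -/
abbrev Pairing.Unpaired {S : Type} (κ : Pairing S) : Type := {s : S // κ.1 s = s}

instance {S : Type} [Finite S] (κ : Pairing S) : Fintype κ.Unpaired := Fintype.ofFinite _

open Classical in
/-- The tree with `n` internal vertices, with internal vertices identified according to the
internal pairing `κ`, in which the unpaired internal vertices (those carrying a noise) are
considered as leaves as well. -/
def internalDiagram (n : ℕ) (κ : Pairing (Fin n)) : FeynmanDiagram (Leaf ⊕ κ.Unpaired) where
  V := Quot fun v w : Fin (n + 2) => ∃ j, v = innerVertex j ∧ w = innerVertex (κ.1 j)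
  E := Fin (n + 1)
  fintypeV := Fintype.ofFinite _
  src e := Quot.mk _ e.castSucc
  tgt e := Quot.mk _ e.succ
  label := Quot.lift
    (vertexCases (some (Sum.inl Leaf.bottom)) (some (Sum.inl Leaf.top)) fun j =>
      if h : κ.1 j = j then some (Sum.inr ⟨j, h⟩) else none)
    (by
      rintro v w ⟨j, rfl, rfl⟩
      by_cases h : κ.1 j = j
      · rw [h]
      · have h' : κ.1 (κ.1 j) ≠ κ.1 j := fun h' => h (κ.2.injective h')
        simp [h, h'])

/-- The Feynman diagram `(τ_1, …, τ_k)_κ`, where `τ_i` is the tree with `n i` internal vertices: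
the disjoint union of the trees, with internal vertices identified according to the complete
pairing `κ`. -/
def pairedDiagram {k : ℕ} (n : Fin k → ℕ) (κ : CompletePairing (Σ i, Fin (n i))) :
    FeynmanDiagram (Fin k × Leaf) where
  V := Quot fun v w : Σ i, Fin (n i + 2) =>
    ∃ p : Σ i, Fin (n i), v = ⟨p.1, innerVertex p.2⟩ ∧ w = ⟨(κ.1 p).1, innerVertex (κ.1 p).2⟩
  E := Σ i, Fin (n i + 1)
  fintypeV := Fintype.ofFinite _
  src e := Quot.mk _ ⟨e.1, e.2.castSucc⟩
  tgt e := Quot.mk _ ⟨e.1, e.2.succ⟩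
  label := Quot.lift
    (fun v => vertexCases (some (v.1, Leaf.bottom)) (some (v.1, Leaf.top)) (fun _ => none) v.2)
    (by
      rintro v w ⟨p, rfl, rfl⟩
      simp)

/-! ### Renormalised trees -/

section RenormalisedTrees

variable {Ω : Type*} [MeasurableSpace Ω] {P : Measure Ω}

/-- The renormalisation of the component of the tree that belongs to the internal pairing `κ`:
the renormalised valuation of the paired tree, integrated against the noises at the unpaired
vertices. -/
def renormalisedPairedTree (ξ : WhiteNoise P) (G : T4 → ℝ) (n : ℕ) (κ : Pairing (Fin n))
    (x y : T4) : Ω → ℝ :=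
  wienerIntegral ξ fun z : κ.Unpaired → T4 =>
    (internalDiagram n κ).renormalisedValuation G (Sum.elim (Leaf.point x y) z)

/-- The BPHZ renormalised tree with `n` internal vertices. -/
def renormalisedTree (ξ : WhiteNoise P) (G : T4 → ℝ) (n : ℕ) (x y : T4) (ω : Ω) : ℝ :=
  ∑ κ : Pairing (Fin n), renormalisedPairedTree ξ G n κ x y ω

end RenormalisedTrees

end AndersonBPHZ

end

/-! Expand every renormalised tree over its internal pairings. The expectation of a product of
multiple Wiener-Itô integrals is a sum over pairings of the noise variables that never pair two
variables of the same integral; each term is the integral of the product of the kernels with paired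
variables identified (`integral_prod_wienerIntegral`). Internal pairings of all trees together with
such an external pairing amount to one complete pairing of all internal vertices (`join_bijective`).
What remains is one identity per complete pairing: renormalising the paired diagram is the same as
renormalising each tree with its internal pairing and then integrating over the externally paired
vertices (`renormalisedValuation_join`).

That identity rests on a power count (`fst_eq_of_divergent`). In a subdiagram with V vertices, each
vertex carries at most two noises and every edge is determined by the noise at its source, while the
last noise met in each tree is the source of no edge. If two trees are met, there are at most 2V - 2
edges and the degree is at least 4(V - 1) - 2(2V - 2) = 0. A divergent subdiagram therefore stays in
one tree and avoids every externally paired vertex. Hence the forests of the paired diagram are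
tuples of forests of the pieces, extraction acts piece by piece, and Fubini factorises the
valuations (`Gluing.renormalisedValuation_eq`).

The moment formula for Wiener-Itô integrals is the Isserlis theorem
(`integral_prod_of_hasGaussianLaw`) for elementary kernels. Both sides are multilinear, and applied
to 2m equal factors the formula itself bounds the L^{2m} norm of an elementary integral by that of
its kernel; density and continuity in L^{2m} then cover all bounded kernels. The kernels are bounded
because G_ε is: G is integrable, and the mollifier is bounded with compact support
(`exists_abs_mollifiedGreen_le`). -/

namespace AndersonBPHZ

open MeasureTheory ProbabilityTheory Set

/-! ### Moments of Gaussian vectors -/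

section Gaussian

/-- Repeated Hölder: each extra factor doubles the moment required, which is harmless since all
moments are finite. -/
theorem memLp_prod_of_forall_memLp {Ω S : Type*} [MeasurableSpace Ω] {P : Measure Ω}
    [IsFiniteMeasure P] {X : S → Ω → ℝ} (hX : ∀ s, ∀ m : ℕ, MemLp (X s) m P) (t : Finset S)
    (m : ℕ) : MemLp (fun ω => ∏ s ∈ t, X s ω) m P := by
  classical
  induction t using Finset.induction_on generalizing m with
  | empty => simpa using memLp_const 1
  | insert a t ha ih =>
    simp_rw [Finset.prod_insert ha]
    have h1 : MemLp (X a) (2 * m : ENNReal) P := by exact_mod_cast hX a (2 * m)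
    have h2 : MemLp (fun ω => ∏ s ∈ t, X s ω) (2 * m : ENNReal) P := by
      exact_mod_cast ih (2 * m)
    have : ENNReal.HolderTriple (2 * m : ENNReal) (2 * m) m := by
      constructor
      rw [ENNReal.mul_inv (Or.inl (by simp)) (Or.inl (by simp)), ← add_mul,
        ENNReal.inv_two_add_inv_two, one_mul]
    exact h2.mul (p := (2 * m : ENNReal)) h1

theorem integrable_eval_gaussianReal (v : NNReal) (f : Polynomial ℝ) :
    Integrable (fun x => f.eval x) (gaussianReal 0 v) := by
  simp_rw [Polynomial.eval_eq_sum_range]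
  refine integrable_finsetSum _ fun i _ => Integrable.const_mul ?_ _
  have h := (memLp_id_gaussianReal (μ := 0) (v := v) (i : NNReal)).integrable_norm_pow' 
  refine h.mono (by fun_prop) ?_
  simp

/-- Stein's identity: the density satisfies `φ' = -(x / v) φ`, and integration by parts trades the
factor `x` for a derivative. For `v = 0` the law is a Dirac mass at the origin and both sides
vanish. -/
theorem integral_mul_eval_gaussianReal (v : NNReal) (f : Polynomial ℝ) :
    ∫ x, x * f.eval x ∂(gaussianReal 0 v) =
      v * ∫ x, f.derivative.eval x ∂(gaussianReal 0 v) := by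
  rcases eq_or_ne v 0 with rfl | hv
  · simp
  have hinteg : ∀ g : Polynomial ℝ, Integrable (fun x => g.eval x * gaussianPDFReal 0 v x) := by
    intro g
    have h := integrable_eval_gaussianReal v g
    rw [gaussianReal_of_var_ne_zero 0 hv, integrable_withDensity_iff (by fun_prop)
      (by simp [gaussianPDF])] at h
    simpa using h
  have hd : ∀ x, HasDerivAt (gaussianPDFReal 0 v) (-(x / v) * gaussianPDFReal 0 v x) x := by
    intro x
    have h1 : HasDerivAt (fun x : ℝ => -(x - 0) ^ 2 / (2 * v)) (-(x / v)) x := by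
      have hv' : (v : ℝ) ≠ 0 := by exact_mod_cast hv
      exact ((((hasDerivAt_id x).sub_const 0).pow 2).neg.div_const (2 * (v : ℝ))).congr_deriv
        (by simp only [id]; push_cast; field_simp; ring)
    rw [gaussianPDFReal_def]
    exact ((h1.exp).const_mul ((√(2 * Real.pi * v))⁻¹)).congr_deriv (by ring)
  have hv' : (v : ℝ) ≠ 0 := by exact_mod_cast hv
  have key := integral_mul_deriv_eq_deriv_mul_of_integrable
    (u := fun x => f.eval x) (v := gaussianPDFReal 0 v) (u' := fun x => f.derivative.eval x)
    (v' := fun x => -(x / v) * gaussianPDFReal 0 v x)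
    (fun x _ => f.hasDerivAt x) (fun x _ => hd x) ?_ (hinteg _) (hinteg f)
  · rw [integral_gaussianReal_eq_integral_smul hv, integral_gaussianReal_eq_integral_smul hv]
    simp only [smul_eq_mul]
    have e1 : ∀ x, gaussianPDFReal 0 v x * (x * f.eval x) =
        (-v) * (f.eval x * (-(x / v) * gaussianPDFReal 0 v x)) := fun x => by field_simp
    simp_rw [e1]
    rw [integral_const_mul, key]
    simp only [mul_comm (gaussianPDFReal 0 v _)]
    ring
  · have := (hinteg (Polynomial.X * f)).const_mul (-(v : ℝ)⁻¹)
    refine this.congr (Filter.Eventually.of_forall fun x => ?_)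
    simp [div_eq_inv_mul]
    ring


/-- Gaussian integration by parts for products of a centred Gaussian vector. -/
theorem integral_mul_prod_of_hasGaussianLaw {Ω S : Type*} [Fintype S] [DecidableEq S]
    [MeasurableSpace Ω] {P : Measure Ω} {Z : Ω → ℝ} {X : S → Ω → ℝ}
    (h : HasGaussianLaw (fun ω => (Z ω, fun s => X s ω)) P)
    (hZ0 : ∫ ω, Z ω ∂P = 0) :
    ∫ ω, Z ω * ∏ s, X s ω ∂P =
      ∑ s, (∫ ω, Z ω * X s ω ∂P) * ∫ ω, ∏ s' ∈ Finset.univ.erase s, X s' ω ∂P := by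
  have := h.isProbabilityMeasure
  have hZ : HasGaussianLaw Z P := h.fst
  have hX : ∀ s, HasGaussianLaw (X s) P := fun s => h.snd.eval s
  have hZ2 : MemLp Z 2 P := hZ.memLp_two
  have hX2 : ∀ s, MemLp (X s) 2 P := fun s => (hX s).memLp_two
  set v : ℝ := ∫ ω, Z ω * Z ω ∂P with hv
  have hv0 : 0 ≤ v := integral_nonneg fun ω => mul_self_nonneg _
  -- Regression coefficients of `X s` on `Z`. If `v = 0`, division by zero gives `0`, and `hav`
  -- survives because `Z` vanishes almost surely.
  set a : S → ℝ := fun s => (∫ ω, Z ω * X s ω ∂P) / v with ha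
  have hav : ∀ s, ∫ ω, Z ω * X s ω ∂P = a s * v := by
    intro s
    by_cases hv1 : v = 0
    · have hz : Z =ᵐ[P] 0 := by
        have := (integral_eq_zero_iff_of_nonneg (fun ω => mul_self_nonneg (Z ω))
          (hZ2.integrable_mul hZ2)).1 (hv.symm.trans hv1)
        filter_upwards [this] with ω hω
        simpa using hω
      rw [hv1, mul_zero]
      refine integral_eq_zero_of_ae ?_
      filter_upwards [hz] with ω hω
      simp [hω]
    · simp only [ha]; field_simp
  -- The residual is uncorrelated with `Z`, hence independent of it by joint Gaussianity. With `Y`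
  -- frozen, the product is a polynomial in `Z` and Stein's identity applies.
  set Y : S → Ω → ℝ := fun s ω => X s ω - a s * Z ω with hY
  have hXY : ∀ s ω, X s ω = a s * Z ω + Y s ω := fun s ω => by simp [hY]
  have hY2 : ∀ s, MemLp (Y s) 2 P := fun s => (hX2 s).sub (hZ2.const_mul (a s))
  have hZY : HasGaussianLaw (fun ω => (fun _ : Unit => Z ω, fun s => Y s ω)) P := by
    let L : (ℝ × (S → ℝ)) →L[ℝ] ((Unit → ℝ) × (S → ℝ)) :=
      (ContinuousLinearMap.pi fun _ => ContinuousLinearMap.fst ℝ ℝ (S → ℝ)).prod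
        (ContinuousLinearMap.snd ℝ ℝ (S → ℝ) -
          ContinuousLinearMap.pi fun s => a s • ContinuousLinearMap.fst ℝ ℝ (S → ℝ))
    exact h.map L
  have hind : IndepFun Z (fun ω s => Y s ω) P := by
    have h1 := HasGaussianLaw.indepFun_of_covariance_eval (X := fun _ : Unit => Z) (Y := Y) hZY ?_
    · exact h1.comp (φ := fun f : Unit → ℝ => f ()) (ψ := id) (by fun_prop) measurable_id
    · intro _ s
      rw [covariance_eq_sub hZ2 (hY2 s), hZ0, zero_mul, sub_zero]
      have : ∀ ω, (Z * Y s) ω = Z ω * X s ω - a s * (Z ω * Z ω) := fun ω => by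
        simp only [hY, Pi.mul_apply]; ring
      simp_rw [this]
      have i1 : Integrable (fun ω => Z ω * X s ω) P := hZ2.integrable_mul (hX2 s)
      have i2 : Integrable (fun ω => Z ω * Z ω) P := hZ2.integrable_mul hZ2
      rw [integral_sub i1 (i2.const_mul _), integral_const_mul, hav s, ← hv, sub_self]
  have hYm : AEMeasurable (fun ω s => Y s ω) P := hZY.snd.aemeasurable
  set μ : Measure (S → ℝ) := P.map (fun ω s => Y s ω) with hμ
  have hμP : IsProbabilityMeasure μ := Measure.isProbabilityMeasure_map hYm
  have hlawZ : P.map Z = gaussianReal 0 v.toNNReal := by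
    rw [hZ.map_eq_gaussianReal, hZ0, variance_eq_sub hZ2, hZ0]
    simp [hv, pow_two]
  have hlaw : P.map (fun ω => (Z ω, fun s => Y s ω)) = (gaussianReal 0 v.toNNReal).prod μ := by
    rw [(indepFun_iff_map_prod_eq_prod_map_map hZ.aemeasurable hYm).1 hind, hlawZ]
  have hZYm : AEMeasurable (fun ω => (Z ω, fun s => Y s ω)) P := hZ.aemeasurable.prodMk hYm
  have hmom : ∀ (s : S) (m : ℕ), MemLp (X s) m P := fun s m => (hX s).memLp (by simp)
  -- expectation of a function of the decomposed vector
  have hE : ∀ F : ℝ × (S → ℝ) → ℝ, Measurable F → Integrable (fun ω => F (Z ω, fun s => Y s ω)) P →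
      ∫ ω, F (Z ω, fun s => Y s ω) ∂P = ∫ y, ∫ z, F (z, y) ∂(gaussianReal 0 v.toNNReal) ∂μ ∧
      Integrable (fun y => ∫ z, F (z, y) ∂(gaussianReal 0 v.toNNReal)) μ := by
    intro F hF hi
    have hi' : Integrable F ((gaussianReal 0 v.toNNReal).prod μ) := by
      rw [← hlaw, integrable_map_measure hF.aestronglyMeasurable hZYm]
      exact hi
    refine ⟨?_, hi'.integral_prod_right⟩
    rw [← integral_prod_symm _ hi', ← hlaw, integral_map hZYm hF.aestronglyMeasurable]
  have hErase : ∀ s, Integrable (fun ω => ∏ s' ∈ Finset.univ.erase s, X s' ω) P := fun s =>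
    memLp_one_iff_integrable.1 (by exact_mod_cast memLp_prod_of_forall_memLp hmom _ 1)
  have hfull : Integrable (fun ω => Z ω * ∏ s, X s ω) P := by
    refine MemLp.integrable_mul (p := 2) (q := 2) hZ2 ?_
    exact_mod_cast memLp_prod_of_forall_memLp hmom Finset.univ 2
  have e1 := hE (fun p => p.1 * ∏ s, (a s * p.1 + p.2 s)) (by fun_prop)
    (by simpa only [← hXY] using hfull)
  have e2 := fun s => hE (fun p => ∏ s' ∈ Finset.univ.erase s, (a s' * p.1 + p.2 s'))
    (by fun_prop) (by simpa only [← hXY] using hErase s)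
  simp only [← hXY] at e1 e2
  rw [e1.1]
  simp_rw [(e2 _).1, hav]
  rw [Finset.sum_congr rfl fun s _ => (integral_const_mul (a s * v) _).symm,
    ← integral_finsetSum _ fun s _ => (e2 s).2.const_mul _]
  refine integral_congr_ae (Filter.Eventually.of_forall fun y => ?_)
  -- Differentiating the product of linear factors removes one factor `s` and leaves its slope `a
  -- s`; times `v`, this is the covariance of `Z` and `X s`.
  have key := integral_mul_eval_gaussianReal v.toNNReal
    (∏ s, (Polynomial.C (a s) * Polynomial.X + Polynomial.C (y s)))
  simp only [Polynomial.eval_prod, Polynomial.eval_add, Polynomial.eval_mul, Polynomial.eval_C,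
    Polynomial.eval_X, Polynomial.derivative_prod_finset, Polynomial.eval_finsetSum,
    Polynomial.derivative_add, Polynomial.derivative_mul, Polynomial.derivative_C,
    Polynomial.derivative_X, zero_mul, mul_one, zero_add,
    add_zero] at key
  simp only
  rw [key, integral_finsetSum, Finset.mul_sum]
  · refine Finset.sum_congr rfl fun s _ => ?_
    rw [integral_mul_const, Real.coe_toNNReal _ hv0]
    ring
  · intro s _
    have := integrable_eval_gaussianReal v.toNNReal
      ((∏ s' ∈ Finset.univ.erase s, (Polynomial.C (a s') * Polynomial.X + Polynomial.C (y s'))) *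
        Polynomial.C (a s))
    simpa [Polynomial.eval_prod] using this

end Gaussian

/-! ### Complete pairings -/

section Pairings

/-- The set of pairs of a complete pairing. -/
abbrev CompletePairing.Pairs {S : Type} (κ : CompletePairing S) : Type :=
  Quot fun p q : S => q = κ.1 p

noncomputable instance {S : Type} [Finite S] (κ : CompletePairing S) : Fintype κ.Pairs := Fintype.ofFinite _

theorem CompletePairing.mk_eq_mk_iff {S : Type} (κ : CompletePairing S) (p q : S) :
    (Quot.mk _ p : κ.Pairs) = Quot.mk _ q ↔ q = p ∨ q = κ.1 p := by
  constructor
  · intro h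
    -- The orbit `{p, κ p}` is constant on classes and separates them.
    let f : κ.Pairs → Set S := Quot.lift (fun p => {p, κ.1 p}) (by
      rintro a b rfl
      simp only [κ.2.1 a]
      exact Set.pair_comm _ _)
    have h1 : ({p, κ.1 p} : Set S) = {q, κ.1 q} := congrArg f h
    have h2 : q ∈ ({p, κ.1 p} : Set S) := h1 ▸ (by simp)
    simpa using h2
  · rintro (rfl | rfl)
    · rfl
    · exact Quot.sound rfl

theorem CompletePairing.out_mk {S : Type} (κ : CompletePairing S) (p : S) :
    (Quot.mk _ p : κ.Pairs).out = p ∨ (Quot.mk _ p : κ.Pairs).out = κ.1 p :=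
  (κ.mk_eq_mk_iff _ _).1 (Quot.out_eq _).symm

/-- Products over pairs are taken through the representative `out`; symmetry of `c` makes that
choice immaterial. -/
theorem CompletePairing.apply_out_mk {S α : Type} (κ : CompletePairing S) (c : S → S → α)
    (hc : ∀ p q, c p q = c q p) (p : S) :
    c (Quot.mk _ p : κ.Pairs).out (κ.1 (Quot.mk _ p : κ.Pairs).out) = c p (κ.1 p) := by
  rcases κ.out_mk p with h | h <;> rw [h]
  rw [κ.2.1 p, hc]

/-- The product of `c` over the pairs of a complete pairing. -/
noncomputable def CompletePairing.weight {S : Type} [Finite S] (κ : CompletePairing S) (c : S → S → ℝ) : ℝ :=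
  ∏ o : κ.Pairs, c o.out (κ.1 o.out)

variable {S : Type} [DecidableEq S]

/-- The pairing of `S` in which `s` is paired with `t` and the other elements according to `κ`. -/
def CompletePairing.extend (s : S) (t : {t : S // t ≠ s})
    (κ : CompletePairing {p : S // p ≠ s ∧ p ≠ t.1}) : CompletePairing S where
  val p := if h₁ : p = s then t.1 else if h₂ : p = t.1 then s else (κ.1 ⟨p, h₁, h₂⟩).1
  property := by
    obtain ⟨t, ht⟩ := t
    constructor
    · intro p
      by_cases h₁ : p = s
      · subst h₁; simp [ht]
      · by_cases h₂ : p = t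
        · subst h₂; simp [h₁]
        · have h := (κ.1 ⟨p, h₁, h₂⟩).2
          simp only [h₁, h₂, dite_false, h.1, h.2, Subtype.coe_eta, κ.2.1 ⟨p, h₁, h₂⟩]
    · intro p
      by_cases h₁ : p = s
      · subst h₁; simp [ht]
      · by_cases h₂ : p = t
        · subst h₂; simp [h₁, Ne.symm h₁]
        · simp only [h₁, h₂, dite_false]
          intro h
          exact κ.2.2 ⟨p, h₁, h₂⟩ (Subtype.ext h)

theorem CompletePairing.extend_self (s : S) (t : {t : S // t ≠ s})
    (κ : CompletePairing {p : S // p ≠ s ∧ p ≠ t.1}) : (extend s t κ).1 s = t.1 := by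
  simp [extend]

theorem CompletePairing.extend_of_ne (s : S) (t : {t : S // t ≠ s})
    (κ : CompletePairing {p : S // p ≠ s ∧ p ≠ t.1}) (p : {p : S // p ≠ s ∧ p ≠ t.1}) :
    (extend s t κ).1 p.1 = (κ.1 p).1 := by
  simp [extend, p.2.1, p.2.2]

/-- The recursion behind the Isserlis theorem: a complete pairing amounts to the partner of a fixed
`s` and a complete pairing of the rest. -/
theorem CompletePairing.extend_bijective (s : S) :
    Function.Bijective fun a : (Σ t : {t : S // t ≠ s},
      CompletePairing {p : S // p ≠ s ∧ p ≠ t.1}) => extend s a.1 a.2 := by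
  constructor
  · rintro ⟨t, κ⟩ ⟨t', κ'⟩ h
    simp only at h
    have h1 : t = t' := by
      apply Subtype.ext
      rw [← extend_self s t κ, h, extend_self]
    subst h1
    have h2 : κ = κ' := by
      apply Subtype.ext
      funext p
      apply Subtype.ext
      rw [← extend_of_ne, h, extend_of_ne]
    rw [h2]
  · intro κ
    have hs : κ.1 s ≠ s := κ.2.2 s
    refine ⟨⟨⟨κ.1 s, hs⟩, fun p => ⟨κ.1 p.1, ?_, ?_⟩, ?_, ?_⟩, ?_⟩
    · intro h
      apply p.2.2
      exact (κ.2.1 p.1).symm.trans (congrArg κ.1 h)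
    · intro h
      exact p.2.1 (κ.2.1.injective h)
    · intro p
      exact Subtype.ext (κ.2.1 _)
    · intro p h
      exact κ.2.2 _ (congrArg Subtype.val h)
    · apply Subtype.ext
      funext p
      simp only [extend]
      split_ifs with h₁ h₂
      · rw [h₁]
      · rw [h₂, κ.2.1]
      · rfl

theorem CompletePairing.weight_extend [Finite S] (c : S → S → ℝ) (hc : ∀ p q, c p q = c q p)
    (s : S) (t : {t : S // t ≠ s}) (κ : CompletePairing {p : S // p ≠ s ∧ p ≠ t.1}) :
    (extend s t κ).weight c = c s t.1 * κ.weight fun p q => c p.1 q.1 := by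
  classical
  set κ' := extend s t κ with hκ'
  unfold weight
  rw [Fintype.prod_eq_mul_prod_subtype_ne _ (Quot.mk _ s : κ'.Pairs), κ'.apply_out_mk c hc,
    hκ', extend_self, ← hκ']
  congr 1
  have hne : ∀ p : {p : S // p ≠ s ∧ p ≠ t.1}, (Quot.mk _ p.1 : κ'.Pairs) ≠ Quot.mk _ s := by
    intro p h
    rw [eq_comm, κ'.mk_eq_mk_iff, hκ', extend_self] at h
    exact h.elim p.2.1 p.2.2
  let f : κ.Pairs → {o : κ'.Pairs // o ≠ Quot.mk _ s} := Quot.lift (fun p => ⟨Quot.mk _ p.1, hne p⟩)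
    (by
      rintro a b rfl
      apply Subtype.ext
      exact Quot.sound (extend_of_ne s t κ a).symm)
  have hf : Function.Bijective f := by
    constructor
    · rintro ⟨p⟩ ⟨q⟩ h
      have h := congrArg Subtype.val h
      change (Quot.mk _ p.1 : κ'.Pairs) = Quot.mk _ q.1 at h
      rw [κ'.mk_eq_mk_iff, hκ', extend_of_ne] at h
      change (Quot.mk _ p : κ.Pairs) = Quot.mk _ q
      rw [κ.mk_eq_mk_iff]
      exact h.imp Subtype.ext Subtype.ext
    · rintro ⟨⟨p⟩, hp⟩
      have h1 : p ≠ s := by rintro rfl; exact hp rfl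
      have h2 : p ≠ t.1 := by
        rintro rfl
        apply hp
        change (Quot.mk _ t.1 : κ'.Pairs) = Quot.mk _ s
        rw [eq_comm, κ'.mk_eq_mk_iff, hκ', extend_self]
        exact Or.inr rfl
      exact ⟨Quot.mk _ ⟨p, h1, h2⟩, rfl⟩
  refine (Fintype.prod_bijective f hf _ _ ?_).symm
  rintro ⟨p⟩
  change c _ _ = c (Quot.mk _ p.1 : κ'.Pairs).out (κ'.1 (Quot.mk _ p.1 : κ'.Pairs).out)
  rw [κ'.apply_out_mk c hc, hκ', extend_of_ne]
  exact κ.apply_out_mk (fun p q => c p.1 q.1) (fun p q => hc _ _) p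

end Pairings

/-- The Isserlis theorem. -/
theorem integral_prod_of_hasGaussianLaw {Ω : Type*} [MeasurableSpace Ω] {P : Measure Ω} {S : Type}
    [Fintype S] {X : S → Ω → ℝ} (h : HasGaussianLaw (fun ω s => X s ω) P)
    (h0 : ∀ s, ∫ ω, X s ω ∂P = 0) :
    ∫ ω, ∏ s, X s ω ∂P =
      ∑ κ : CompletePairing S, κ.weight fun p q => ∫ ω, X p ω * X q ω ∂P := by
  classical
  have := h.isProbabilityMeasure
  generalize hN : Fintype.card S = N
  induction N using Nat.strong_induction_on generalizing S with
  | _ N ih =>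
  rcases isEmpty_or_nonempty S with hS | ⟨⟨s⟩⟩
  · let κ₀ : CompletePairing S := ⟨id, fun _ => rfl, fun s => (hS.false s).elim⟩
    rw [Fintype.sum_eq_single κ₀ fun κ hκ => (hκ (Subtype.ext (Subsingleton.elim _ _))).elim]
    have : IsEmpty κ₀.Pairs := ⟨fun o => hS.false o.out⟩
    simp [CompletePairing.weight]
  set c : S → S → ℝ := fun p q => ∫ ω, X p ω * X q ω ∂P with hc
  have hcs : ∀ p q, c p q = c q p := fun p q => by simp only [hc, mul_comm]
  have hst : HasGaussianLaw (fun ω => (X s ω, fun t : {t : S // t ≠ s} => X t.1 ω)) P :=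
    h.map ((ContinuousLinearMap.proj (R := ℝ) (φ := fun _ : S => ℝ) s).prod
      (ContinuousLinearMap.pi fun t : {t : S // t ≠ s} =>
        ContinuousLinearMap.proj (R := ℝ) (φ := fun _ : S => ℝ) t.1))
  simp_rw [fun ω => Fintype.prod_eq_mul_prod_subtype_ne (fun s => X s ω) s]
  -- Integrate by parts in the factor `X s`: the variable it is contracted with becomes the partner
  -- of `s`.
  rw [integral_mul_prod_of_hasGaussianLaw hst (h0 s),
    ← Fintype.sum_bijective _ (CompletePairing.extend_bijective s) _ _ fun _ => rfl,
    Fintype.sum_sigma]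
  refine Finset.sum_congr rfl fun t _ => ?_
  simp_rw [CompletePairing.weight_extend c hcs, ← Finset.mul_sum]
  congr 1
  have h3 : HasGaussianLaw (fun ω (p : {p : S // p ≠ s ∧ p ≠ t.1}) => X p.1 ω) P :=
    h.map (ContinuousLinearMap.pi fun t : {p : S // p ≠ s ∧ p ≠ t.1} =>
        ContinuousLinearMap.proj (R := ℝ) (φ := fun _ : S => ℝ) t.1)
  rw [← ih _ ?_ h3 (fun p => h0 p.1) rfl]
  · congr 1
    funext ω
    refine Finset.prod_bij' (fun p hp => ⟨p.1, p.2, fun h => ?_⟩) (fun p _ => ⟨p.1, p.2.1⟩)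
      ?_ ?_ ?_ ?_ ?_
    · exact (Finset.ne_of_mem_erase hp) (Subtype.ext h)
    · simp
    · intro p _
      simp only [Finset.mem_erase, Finset.mem_univ, and_true]
      exact fun h => p.2.2 (congrArg Subtype.val h)
    · simp
    · simp
    · simp
  · rw [← hN]
    exact Fintype.card_subtype_lt (x := s) (by simp)

/-! ### Density of elementary functions -/

section Density

theorem measurable_circleRep : Measurable circleRep :=
  measurable_subtype_coe.comp (AddCircle.measurableEquivIco (2 * Real.pi) (-Real.pi)).measurable

theorem circleRep_injective : Function.Injective circleRep :=
  Subtype.val_injective.comp (AddCircle.equivIco (2 * Real.pi) (-Real.pi)).injective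

theorem circleRep_mem (a : AddCircle (2 * Real.pi)) : circleRep a ∈ Ico (-Real.pi) Real.pi := by
  have h := (AddCircle.equivIco (2 * Real.pi) (-Real.pi) a).2
  refine ⟨h.1, h.2.trans_le ?_⟩
  linarith

theorem volume_circle_singleton (a : AddCircle (2 * Real.pi)) :
    volume ({a} : Set (AddCircle (2 * Real.pi))) = 0 := by
  refine le_antisymm (ENNReal.le_of_forall_pos_le_add fun ε hε _ => ?_) zero_le
  calc volume ({a} : Set (AddCircle (2 * Real.pi)))
      ≤ volume (Metric.closedBall a ((ε : ℝ) / 2)) :=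
        measure_mono (by simp; positivity)
    _ ≤ 0 + ε := by
        rw [AddCircle.volume_closedBall]
        refine (ENNReal.ofReal_le_ofReal (min_le_right _ _)).trans ?_
        rw [mul_div_cancel₀ _ two_ne_zero, ENNReal.ofReal_coe_nnreal, zero_add]

instance : NullSingletonClass (volume : Measure (AddCircle (2 * Real.pi))) :=
  ⟨fun a => volume_circle_singleton a⟩

variable {ι : Type} [Fintype ι]

/-- Freeze the `j`-th point: the `i`-th must then lie on a coordinate hyperplane, which is null
since the circle has no atoms. One coordinate is enough to separate points. -/
theorem ae_apply_zero_ne {i j : ι} (hij : i ≠ j) :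
    ∀ᵐ z : ι → T4, z i 0 ≠ z j 0 := by
  classical
  have hmp := volume_preserving_piEquivPiSubtypeProd (fun _ : ι => T4) (fun l => l = j)
  have hj : j = j := rfl
  have hm : MeasurableSet {w : ({l : ι // l = j} → T4) × ({l : ι // ¬ l = j} → T4) |
      w.2 ⟨i, hij⟩ 0 = w.1 ⟨j, hj⟩ 0} :=
    measurableSet_eq_fun (by fun_prop) (by fun_prop)
  have key : ∀ᵐ w : ({l : ι // l = j} → T4) × ({l : ι // ¬ l = j} → T4),
      w.2 ⟨i, hij⟩ 0 ≠ w.1 ⟨j, hj⟩ 0 := by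
    refine measure_mono_null (t := {w | w.2 ⟨i, hij⟩ 0 = w.1 ⟨j, hj⟩ 0}) (fun w hw => ?_) ?_
    · simpa using hw
    · refine (Measure.measure_prod_null hm).2 (Filter.Eventually.of_forall fun a => ?_)
      have h1 : volume {t : T4 | t 0 = a ⟨j, hj⟩ 0} = 0 := Measure.pi_hyperplane _ 0 _
      exact (Measure.quasiMeasurePreserving_eval (fun _ : {l : ι // ¬ l = j} => (volume : Measure T4))
        ⟨i, hij⟩).preimage_null h1
  exact hmp.quasiMeasurePreserving.ae
    (p := fun w => w.2 ⟨i, hij⟩ 0 ≠ w.1 ⟨j, hj⟩ 0) (by convert key)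

/-- The linear map from formal combinations of families of disjoint sets to `L^p`. -/
noncomputable def boxFun (p : ENNReal) (ι : Type) [Fintype ι] :
    (DisjointFamily ι →₀ ℝ) →ₗ[ℝ] Lp ℝ p (volume : Measure (ι → T4)) :=
  Finsupp.linearCombination ℝ fun A : DisjointFamily ι =>
    indicatorConstLp p (MeasurableSet.univ_pi A.2.1)
      (measure_ne_top volume (Set.univ.pi A.1)) (1 : ℝ)

variable {p : ENNReal}

theorem indicatorConstLp_finset_biUnion {α β : Type*} [MeasurableSpace α] {μ : Measure α}
    [IsFiniteMeasure μ] (t : Finset β) {s : β → Set α} (hs : ∀ b, MeasurableSet (s b))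
    (hd : (t : Set β).PairwiseDisjoint s) :
    indicatorConstLp p (t.measurableSet_biUnion fun b _ => hs b)
      (measure_ne_top μ (⋃ b ∈ t, s b)) (1 : ℝ) =
      ∑ b ∈ t, indicatorConstLp p (hs b) (measure_ne_top μ _) (1 : ℝ) := by
  classical
  induction t using Finset.induction_on with
  | empty => simp [indicatorConstLp_empty]
  | insert a t ha ih =>
    rw [Finset.sum_insert ha, ← ih (hd.subset (by simp)),
      ← indicatorConstLp_disjoint_union]
    · congr 1
      exact Finset.set_biUnion_insert a t s
    · rw [Set.disjoint_iUnion₂_right]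
      intro b hb
      exact hd (by simp) (by simp [hb]) (by rintro rfl; exact ha hb)

/-- The cell of `x` in a partition of the torus into strips of width `1 / N`. -/
noncomputable def cell (N : ℕ) (x : T4) : ℤ := ⌊N * circleRep (x 0)⌋

theorem measurable_cell (N : ℕ) : Measurable (cell N) := by
  have : Measurable fun x : T4 => (N : ℝ) * circleRep (x 0) :=
    (measurable_circleRep.comp (measurable_pi_apply 0)).const_mul _
  exact Int.measurable_floor.comp this

/-- The bound comes from `π < 4`; it only serves to make the number of strips finite. -/
theorem cell_mem (N : ℕ) (x : T4) : cell N x ∈ Finset.Icc (-(4 * N : ℤ)) (4 * N) := by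
  have h := circleRep_mem (x 0)
  have hpi := Real.pi_lt_four
  have hN : (0 : ℝ) ≤ N := Nat.cast_nonneg N
  rw [Finset.mem_Icc, cell]
  constructor
  · rw [Int.le_floor]
    push_cast
    nlinarith [h.1]
  · have : (N : ℝ) * circleRep (x 0) ≤ ((4 * N : ℤ) : ℝ) := by
      push_cast
      nlinarith [h.2]
    exact_mod_cast (Int.floor_le _).trans this

theorem eventually_cell_ne {x y : T4} (h : x 0 ≠ y 0) :
    ∀ᶠ N in Filter.atTop, cell N x ≠ cell N y := by
  have h1 : 0 < |circleRep (x 0) - circleRep (y 0)| :=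
    abs_pos.2 (sub_ne_zero.2 (circleRep_injective.ne h))
  obtain ⟨N₀, hN₀⟩ := exists_nat_gt (1 / |circleRep (x 0) - circleRep (y 0)|)
  filter_upwards [Filter.eventually_ge_atTop N₀] with N hN heq
  have h2 := Int.abs_sub_lt_one_of_floor_eq_floor heq
  rw [← mul_sub, abs_mul, Nat.abs_cast] at h2
  rw [div_lt_iff₀ h1] at hN₀
  have : (N₀ : ℝ) ≤ N := by exact_mod_cast hN
  nlinarith

/-- Cut each side of the box along the strips. Every injective assignment `φ` of strips to variables
gives a box with pairwise disjoint sides, and there are finitely many such `φ`. -/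
theorem indicatorConstLp_box_inter_mem_range {A : ι → Set T4} (hA : ∀ i, MeasurableSet (A i))
    (N : ℕ) (hm : MeasurableSet (univ.pi A ∩ {z | Function.Injective fun i => cell N (z i)})) :
    indicatorConstLp p hm (measure_ne_top volume _) (1 : ℝ) ∈ LinearMap.range (boxFun p ι) := by
  classical
  let t : Finset (ι → ℤ) :=
    (Fintype.piFinset fun _ => Finset.Icc (-(4 * N : ℤ)) (4 * N)).filter Function.Injective
  let B : (ι → ℤ) → ι → Set T4 := fun φ i => A i ∩ cell N ⁻¹' {φ i}
  have hB : ∀ φ i, MeasurableSet (B φ i) := fun φ i =>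
    (hA i).inter (measurable_cell N (measurableSet_singleton _))
  have hU : univ.pi A ∩ {z | Function.Injective fun i => cell N (z i)} =
      ⋃ φ ∈ t, univ.pi (B φ) := by
    ext z
    simp only [mem_inter_iff, mem_univ_pi, mem_ofPred_eq, mem_iUnion, t, Finset.mem_filter,
      Fintype.mem_piFinset, B, mem_preimage, mem_singleton_iff, exists_prop]
    constructor
    · rintro ⟨h1, h2⟩
      exact ⟨fun i => cell N (z i), ⟨fun i => cell_mem N _, h2⟩, fun i => ⟨h1 i, rfl⟩⟩
    · rintro ⟨φ, ⟨-, h2⟩, h3⟩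
      refine ⟨fun i => (h3 i).1, ?_⟩
      simpa only [(h3 _).2] using h2
  have hd : (t : Set (ι → ℤ)).PairwiseDisjoint fun φ => univ.pi (B φ) := by
    intro φ _ ψ _ hne
    refine Set.disjoint_left.2 fun z hz hz' => hne ?_
    funext i
    exact (hz i trivial).2.symm.trans (hz' i trivial).2
  have hsum := indicatorConstLp_finset_biUnion (p := p) (μ := volume) t
    (fun φ => MeasurableSet.univ_pi (hB φ)) hd
  have : indicatorConstLp p hm (measure_ne_top volume _) (1 : ℝ) =
      ∑ φ ∈ t, indicatorConstLp p (MeasurableSet.univ_pi (hB φ))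
        (measure_ne_top volume _) (1 : ℝ) := by
    rw [← hsum]
    congr 1
  rw [this]
  refine Submodule.sum_mem _ fun φ hφ => ?_
  refine ⟨Finsupp.single ⟨B φ, hB φ, fun i j hij => ?_⟩ 1, ?_⟩
  · refine Set.disjoint_left.2 fun x hx hx' => hij ?_
    exact (Finset.mem_filter.1 hφ).2 (hx.2.symm.trans hx'.2)
  · simp [boxFun]

theorem measurableSet_injective_cell (N : ℕ) :
    MeasurableSet {z : ι → T4 | Function.Injective fun i => cell N (z i)} := by
  have : {z : ι → T4 | Function.Injective fun i => cell N (z i)} =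
      ⋂ i, ⋂ j, {z | cell N (z i) = cell N (z j) → i = j} := by
    ext z; simp [Function.Injective]
  rw [this]
  refine MeasurableSet.iInter fun i => MeasurableSet.iInter fun j => ?_
  by_cases hij : i = j
  · simp [hij]
  · simp only [hij, imp_false]
    exact (measurableSet_eq_fun ((measurable_cell N).comp (measurable_pi_apply i))
      ((measurable_cell N).comp (measurable_pi_apply j))).compl

/-- As the strips get thinner, almost every point of the box eventually has its variables in
distinct strips, so the part lost near the diagonals tends to zero in measure. -/
theorem indicatorConstLp_box_mem_closure [Fact (1 ≤ p)] (hp : p ≠ ⊤) {A : ι → Set T4}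
    (hA : ∀ i, MeasurableSet (A i)) :
    indicatorConstLp p (MeasurableSet.univ_pi hA) (measure_ne_top volume _) (1 : ℝ) ∈
      (LinearMap.range (boxFun p ι)).topologicalClosure := by
  have hm := fun N => (MeasurableSet.univ_pi hA).inter (measurableSet_injective_cell (ι := ι) N)
  have hlim := tendsto_indicatorConstLp_set (p := p) (μ := (volume : Measure (ι → T4))) (c := (1 : ℝ))
    (hs := MeasurableSet.univ_pi hA) (hμs := measure_ne_top volume _) (ht := hm)
    (hμt := fun N => measure_ne_top volume _) (l := Filter.atTop) hp ?_
  · exact mem_closure_of_tendsto hlim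
      (Filter.Eventually.of_forall fun N => indicatorConstLp_box_inter_mem_range hA N (hm N))
  · rw [← measure_empty (μ := (volume : Measure (ι → T4)))]
    refine tendsto_measure_of_ae_tendsto_indicator_of_isFiniteMeasure _ MeasurableSet.empty
      (fun N => (hm N).symmDiff (MeasurableSet.univ_pi hA)) ?_
    have h1 : ∀ᵐ z : ι → T4, ∀ i j, i ≠ j → z i 0 ≠ z j 0 := by
      simp_rw [ae_all_iff]
      exact fun i j hij => ae_apply_zero_ne hij
    filter_upwards [h1] with z hz
    have h2 : ∀ᶠ N in Filter.atTop, ∀ i j, i ≠ j → cell N (z i) ≠ cell N (z j) := by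
      simp_rw [Filter.eventually_all]
      exact fun i j hij => eventually_cell_ne (hz i j hij)
    filter_upwards [h2] with N hN
    have : Function.Injective fun i => cell N (z i) := fun i j h => by
      by_contra hij
      exact hN i j hij h
    simp [Set.mem_symmDiff, this]

/-- Boxes form a π-system generating the product σ-algebra, and the sets whose indicator lies in the
closure are stable under complements and countable disjoint unions. Indicators in turn generate
`L^p` for finite `p`. -/
theorem denseRange_boxFun [Fact (1 ≤ p)] (hp : p ≠ ⊤) (ι : Type) [Fintype ι] :
    DenseRange (boxFun p ι) := by
  set W := (LinearMap.range (boxFun p ι)).topologicalClosure with hW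
  have hWc : IsClosed (W : Set (Lp ℝ p (volume : Measure (ι → T4)))) :=
    Submodule.isClosed_topologicalClosure _
  have hset : ∀ (s : Set (ι → T4)) (hs : MeasurableSet s),
      indicatorConstLp p hs (measure_ne_top volume _) (1 : ℝ) ∈ W := by
    refine MeasurableSpace.induction_on_inter generateFrom_pi.symm isPiSystem_pi ?_ ?_ ?_ ?_
    · rw [indicatorConstLp_empty]
      exact W.zero_mem
    · rintro _ ⟨A, hA, rfl⟩
      exact indicatorConstLp_box_mem_closure hp fun i => hA i trivial
    · intro s hs h
      have h1 := indicatorConstLp_box_mem_closure (p := p) (ι := ι) hp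
        (A := fun _ => univ) (fun _ => MeasurableSet.univ)
      have h2 := indicatorConstLp_disjoint_union (p := p) (μ := (volume : Measure (ι → T4)))
        hs hs.compl (measure_ne_top _ _) (measure_ne_top _ _) disjoint_compl_right (1 : ℝ)
      have h3 : indicatorConstLp p hs.compl (measure_ne_top volume _) (1 : ℝ) =
          indicatorConstLp p (MeasurableSet.univ_pi fun _ : ι => MeasurableSet.univ)
            (measure_ne_top volume _) (1 : ℝ) -
          indicatorConstLp p hs (measure_ne_top volume _) (1 : ℝ) := by
        rw [eq_sub_iff_add_eq', ← h2]
        congr 1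
        simp
      rw [h3]
      exact W.sub_mem h1 h
    · intro f hd hf hmem
      have hm : ∀ n : ℕ, MeasurableSet (⋃ i ∈ Finset.range n, f i) := fun n =>
        (Finset.range n).measurableSet_biUnion fun i _ => hf i
      refine hWc.mem_of_tendsto (tendsto_indicatorConstLp_set (p := p)
        (μ := (volume : Measure (ι → T4))) (c := (1 : ℝ)) (ht := hm)
        (hμt := fun N => measure_ne_top volume _) (l := Filter.atTop) hp ?_)
        (Filter.Eventually.of_forall fun n => ?_)
      · rw [← measure_empty (μ := (volume : Measure (ι → T4)))]
        refine tendsto_measure_of_ae_tendsto_indicator_of_isFiniteMeasure _ MeasurableSet.empty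
          (fun N => (hm N).symmDiff (MeasurableSet.iUnion hf))
          (Filter.Eventually.of_forall fun z => ?_)
        by_cases hz : ∃ i, z ∈ f i
        · obtain ⟨i, hi⟩ := hz
          filter_upwards [Filter.eventually_gt_atTop i] with n hn
          have h1 : z ∈ ⋃ i ∈ Finset.range n, f i := by
            simp only [mem_iUnion, Finset.mem_range]
            exact ⟨i, hn, hi⟩
          have h2 : z ∈ ⋃ i, f i := mem_iUnion.2 ⟨i, hi⟩
          simp only [Set.mem_symmDiff, h1, h2, not_true, and_false, or_self, mem_empty_iff_false]
        · refine Filter.Eventually.of_forall fun n => ?_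
          push Not at hz
          simp [Set.mem_symmDiff, hz]
      · rw [indicatorConstLp_finset_biUnion (p := p) (Finset.range n) hf (hd.set_pairwise _)]
        exact W.sum_mem fun i _ => hmem i
  have hall : ∀ f : Lp ℝ p (volume : Measure (ι → T4)), f ∈ W := by
    refine Lp.induction hp _ ?_ ?_ hWc
    · intro c s hs hμs
      have : (Lp.simpleFunc.indicatorConst p hs hμs.ne c : Lp ℝ p (volume : Measure (ι → T4))) =
          c • indicatorConstLp p hs (measure_ne_top volume _) (1 : ℝ) := by
        rw [Lp.simpleFunc.coe_indicatorConst]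
        ext1
        filter_upwards [indicatorConstLp_coeFn (p := p) (hs := hs) (hμs := hμs.ne) (c := c),
          indicatorConstLp_coeFn (p := p) (hs := hs) (hμs := hμs.ne) (c := (1 : ℝ)),
          Lp.coeFn_smul c (indicatorConstLp p hs hμs.ne (1 : ℝ))] with z h1 h2 h3
        rw [h1, h3, Pi.smul_apply, h2]
        by_cases hz : z ∈ s <;> simp [hz]
      rw [this]
      exact W.smul_mem _ (hset s hs)
    · intro f g hf hg _ h1 h2
      exact W.add_mem h1 h2
  intro f
  exact hall f

end Density

/-! ### Products in `L^p` -/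

section ProdIntegral

variable {α K : Type*} [MeasurableSpace α] {μ : Measure α} [Fintype K] {q : ENNReal}

/-- Generalised Hölder with weight `1 / q` on each factor. The weight `1 - |K| / q` left over goes
to the constant function `1`, indexed by `none`, whence the power of the total mass. -/
theorem lintegral_prod_enorm_le (hq : q ≠ ⊤) (hK : (Fintype.card K : ENNReal) ≤ q)
    (hq0 : q ≠ 0) {X : K → α → ℝ} (hX : ∀ i, AEStronglyMeasurable (X i) μ) :
    ∫⁻ a, ‖∏ i, X i a‖ₑ ∂μ ≤
      μ univ ^ (1 - (Fintype.card K : ℝ) / q.toReal) * ∏ i, eLpNorm (X i) q μ := by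
  have hqp : 0 < q.toReal := ENNReal.toReal_pos hq0 hq
  have hKq : (Fintype.card K : ℝ) ≤ q.toReal := by
    have := ENNReal.toReal_mono hq hK
    simpa using this
  have h := ENNReal.lintegral_prod_norm_pow_le (μ := μ) (Finset.univ : Finset (Option K))
    (f := fun o a => o.elim 1 fun i => ‖X i a‖ₑ ^ q.toReal)
    (p := fun o => o.elim (1 - (Fintype.card K : ℝ) / q.toReal) fun _ => 1 / q.toReal) ?_ ?_ ?_
  · simp only [Fintype.prod_option, Option.elim_none, Option.elim_some, ENNReal.one_rpow, one_mul,
      lintegral_const] at h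
    refine le_trans (le_of_eq ?_) (h.trans (le_of_eq ?_))
    · refine lintegral_congr fun a => ?_
      rw [enorm_eq_nnnorm, nnnorm_prod, ENNReal.ofNNReal_finsetProd]
      simp only [← enorm_eq_nnnorm]
      refine Finset.prod_congr rfl fun i _ => ?_
      rw [← ENNReal.rpow_mul, mul_one_div_cancel hqp.ne', ENNReal.rpow_one]
    · congr 1
      refine Finset.prod_congr rfl fun i _ => ?_
      rw [eLpNorm_eq_lintegral_rpow_enorm_toReal hq0 hq]
  · rintro (_ | i) _
    · exact aemeasurable_const
    · exact ((hX i).enorm).pow_const _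
  · rw [Fintype.sum_option]
    simp
    field_simp
    ring
  · rintro (_ | i) _
    · simp only [Option.elim_none, sub_nonneg]
      exact div_le_one_of_le₀ hKq hqp.le
    · simp only [Option.elim_some]
      positivity

theorem integrable_prod_of_memLp [IsFiniteMeasure μ] (hq : q ≠ ⊤)
    (hK : (Fintype.card K : ENNReal) ≤ q) (hq0 : q ≠ 0) {X : K → α → ℝ}
    (hX : ∀ i, MemLp (X i) q μ) : Integrable (fun a => ∏ i, X i a) μ := by
  refine ⟨Finset.aestronglyMeasurable_fun_prod _ fun i _ => (hX i).1, ?_⟩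
  refine (lintegral_prod_enorm_le hq hK hq0 fun i => (hX i).1).trans_lt ?_
  refine ENNReal.mul_lt_top (ENNReal.rpow_lt_top_of_nonneg ?_ (measure_ne_top _ _))
    (ENNReal.prod_lt_top fun i _ => (hX i).2)
  rw [sub_nonneg]
  refine div_le_one_of_le₀ ?_ ENNReal.toReal_nonneg
  simpa using ENNReal.toReal_mono hq hK

variable [IsFiniteMeasure μ] [Fact (1 ≤ q)]

/-- The multilinear map `(X_i) ↦ ∫ ∏ X_i` on `L^q`, where `q` is at least the number of
factors. -/
noncomputable def prodIntegral (μ : Measure α) [IsFiniteMeasure μ] (hq : q ≠ ⊤)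
    (hK : (Fintype.card K : ENNReal) ≤ q) :
    ContinuousMultilinearMap ℝ (fun _ : K => Lp ℝ q μ) ℝ :=
  have hq0 : q ≠ 0 := (one_pos.trans_le (Fact.out : 1 ≤ q)).ne'
  MultilinearMap.mkContinuous
    { toFun := fun X => ∫ a, ∏ i, X i a ∂μ
      map_update_add' := by
        intro _ X i x y
        rw [← integral_add (integrable_prod_of_memLp hq hK hq0 fun i => Lp.memLp _)
          (integrable_prod_of_memLp hq hK hq0 fun i => Lp.memLp _)]
        refine integral_congr_ae ?_
        filter_upwards [Lp.coeFn_add x y] with a ha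
        rw [Fintype.prod_eq_mul_prod_compl i, Fintype.prod_eq_mul_prod_compl i,
          Fintype.prod_eq_mul_prod_compl i]
        simp only [Function.update_self, ha, Pi.add_apply, add_mul]
        congr 2 <;>
        · refine Finset.prod_congr rfl fun j hj => ?_
          have : j ≠ i := by simpa using hj
          simp [this]
      map_update_smul' := by
        intro _ X i c x
        rw [smul_eq_mul, ← integral_const_mul]
        refine integral_congr_ae ?_
        filter_upwards [Lp.coeFn_smul c x] with a ha
        rw [Fintype.prod_eq_mul_prod_compl i, Fintype.prod_eq_mul_prod_compl i]
        simp only [Function.update_self, ha, Pi.smul_apply, smul_eq_mul, mul_assoc]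
        congr 2
        refine Finset.prod_congr rfl fun j hj => ?_
        have : j ≠ i := by simpa using hj
        simp [this] }
    ((μ univ ^ (1 - (Fintype.card K : ℝ) / q.toReal)).toReal)
    (by
      intro X
      have h := lintegral_prod_enorm_le (μ := μ) hq hK hq0 (X := fun i => X i)
        fun i => (Lp.memLp (X i)).1
      have hfin : μ univ ^ (1 - (Fintype.card K : ℝ) / q.toReal) *
          ∏ i, eLpNorm (X i) q μ ≠ ⊤ := by
        refine (ENNReal.mul_lt_top (ENNReal.rpow_lt_top_of_nonneg ?_ (measure_ne_top _ _))
          (ENNReal.prod_lt_top fun i _ => (Lp.memLp (X i)).2)).ne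
        rw [sub_nonneg]
        refine div_le_one_of_le₀ ?_ ENNReal.toReal_nonneg
        simpa using ENNReal.toReal_mono hq hK
      have h2 := ENNReal.toReal_mono hfin ((enorm_integral_le_lintegral_enorm _).trans h)
      rw [ENNReal.toReal_mul, ENNReal.toReal_prod, toReal_enorm] at h2
      exact h2)

theorem prodIntegral_apply (hq : q ≠ ⊤) (hK : (Fintype.card K : ENNReal) ≤ q)
    (X : K → Lp ℝ q μ) : prodIntegral μ hq hK X = ∫ a, ∏ i, X i a ∂μ := rfl

/-- The inclusion of `L^q` into `L^p` for `p ≤ q` and a finite measure. -/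
noncomputable def lpInclusion (μ : Measure α) [IsFiniteMeasure μ] {p q : ENNReal} [Fact (1 ≤ p)]
    [Fact (1 ≤ q)] (hpq : p ≤ q) : Lp ℝ q μ →L[ℝ] Lp ℝ p μ :=
  LinearMap.mkContinuous
    { toFun := fun f => ⟨f.1, Lp.antitone hpq f.2⟩
      map_add' := fun _ _ => rfl
      map_smul' := fun _ _ => rfl }
    ((μ univ ^ (1 / p.toReal - 1 / q.toReal)).toReal)
    (by
      intro f
      have h := eLpNorm_le_eLpNorm_mul_rpow_measure_univ hpq (Lp.memLp f).1
      rw [mul_comm] at h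
      have h2 := ENNReal.toReal_mono ?_ h
      · rw [ENNReal.toReal_mul] at h2
        exact h2
      · refine (ENNReal.mul_lt_top ?_ (Lp.memLp f).2).ne
        by_cases h0 : μ univ = 0
        · have : μ = 0 := Measure.measure_univ_eq_zero.1 h0
          rcases eq_or_ne q ⊤ with rfl | hq
          · refine ENNReal.rpow_lt_top_of_nonneg ?_ (measure_ne_top _ _)
            simp
          · refine ENNReal.rpow_lt_top_of_nonneg ?_ (measure_ne_top _ _)
            have hp0 : p ≠ 0 := (one_pos.trans_le (Fact.out : 1 ≤ p)).ne'
            have : p ≠ ⊤ := ne_top_of_le_ne_top hq hpq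
            have h3 := ENNReal.toReal_mono hq hpq
            have h4 := ENNReal.toReal_pos hp0 this
            rw [sub_nonneg]
            exact one_div_le_one_div_of_le h4 h3
        · exact (ENNReal.rpow_ne_top_of_ne_zero h0 (measure_ne_top _ _)).lt_top)

theorem coeFn_lpInclusion {p : ENNReal} [Fact (1 ≤ p)] (hpq : p ≤ q) (f : Lp ℝ q μ) :
    (lpInclusion μ hpq f : α → ℝ) = f := rfl

end ProdIntegral

/-! ### Pullback of functions along an injection of variables -/

section Pullback

variable {O ι : Type} [Fintype O] [Fintype ι] {q : ENNReal}

/-- The coordinates outside the range of `e` are integrated out; `C` is the total mass they carry.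
-/
theorem exists_map_comp_eq_smul_volume {e : ι → O} (he : Function.Injective e) :
    ∃ C : NNReal, Measure.map (fun (z : O → T4) i => z (e i)) volume =
      C • (volume : Measure (ι → T4)) := by
  classical
  have h1 := volume_preserving_piEquivPiSubtypeProd (fun _ : O => T4) (fun o => o ∈ range e)
  have h2 := (volume_measurePreserving_piCongrLeft (fun _ : range e => T4)
    (Equiv.ofInjective e he)).symm
  let ν : Measure ({o : O // ¬ o ∈ range e} → T4) := volume
  refine ⟨(ν univ).toNNReal, ?_⟩
  have h3 : (fun (z : O → T4) i => z (e i)) =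
      (MeasurableEquiv.piCongrLeft (fun _ : range e => T4) (Equiv.ofInjective e he)).symm ∘
        Prod.fst ∘ MeasurableEquiv.piEquivPiSubtypeProd (fun _ : O => T4) (fun o => o ∈ range e) :=
    rfl
  rw [h3, ← Measure.map_map h2.measurable (measurable_fst.comp h1.measurable),
    ← Measure.map_map measurable_fst h1.measurable, h1.map_eq]
  rw [Measure.volume_eq_prod, Measure.map_fst_prod, Measure.map_smul,
    ← ENNReal.coe_toNNReal (measure_ne_top ν univ)]
  congr 1
  convert h2.map_eq

theorem memLp_comp_pullback {e : ι → O} (he : Function.Injective e)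
    {f : (ι → T4) → ℝ} (hf : MemLp f q volume) :
    MemLp (fun z : O → T4 => f fun i => z (e i)) q volume := by
  obtain ⟨C, hC⟩ := exists_map_comp_eq_smul_volume he
  have hm : Measurable (fun (z : O → T4) i => z (e i)) := by fun_prop
  have : MemLp f q (Measure.map (fun (z : O → T4) i => z (e i)) volume) := by
    rw [hC]
    exact hf.smul_measure (c := (C : ENNReal)) (by simp)
  exact this.comp_of_map hm.aemeasurable

theorem quasiMeasurePreserving_pullback {e : ι → O} (he : Function.Injective e) :
    Measure.QuasiMeasurePreserving (fun (z : O → T4) i => z (e i)) volume volume := by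
  refine ⟨by fun_prop, ?_⟩
  obtain ⟨C, hC⟩ := exists_map_comp_eq_smul_volume he
  rw [hC]
  exact Measure.smul_absolutelyContinuous (c := (C : ENNReal))

variable [Fact (1 ≤ q)]

/-- Pullback of functions of the variables `ι` to functions of the variables `O`. -/
noncomputable def pullback (hq : q ≠ ⊤) {e : ι → O} (he : Function.Injective e) :
    Lp ℝ q (volume : Measure (ι → T4)) →L[ℝ] Lp ℝ q (volume : Measure (O → T4)) :=
  LinearMap.mkContinuousOfExistsBound
    { toFun := fun f => (memLp_comp_pullback he (Lp.memLp f)).toLp _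
      map_add' := by
        intro f g
        rw [← MemLp.toLp_add]
        refine MemLp.toLp_congr _ _ ?_
        exact (quasiMeasurePreserving_pullback he).ae_eq_comp (Lp.coeFn_add f g)
      map_smul' := by
        intro c f
        rw [RingHom.id_apply, ← MemLp.toLp_const_smul]
        refine MemLp.toLp_congr _ _ ?_
        exact (quasiMeasurePreserving_pullback he).ae_eq_comp (Lp.coeFn_smul c f) }
    (by
      obtain ⟨C, hC⟩ := exists_map_comp_eq_smul_volume he
      refine ⟨((C : ENNReal) ^ (1 / q).toReal).toReal, fun f => ?_⟩
      have hm : Measurable (fun (z : O → T4) i => z (e i)) := by fun_prop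
      have h1 : eLpNorm (fun z : O → T4 => f fun i => z (e i)) q volume =
          (C : ENNReal) ^ (1 / q).toReal * eLpNorm f q volume := by
        have h2 : AEStronglyMeasurable f (Measure.map (fun (z : O → T4) i => z (e i)) volume) := by
          rw [hC]
          exact (Lp.memLp f).1.mono_ac (Measure.smul_absolutelyContinuous (c := (C : ENNReal)))
        have h3 := eLpNorm_map_measure (p := q) h2 hm.aemeasurable
        rw [hC] at h3
        rw [← Function.comp_def f, ← h3]
        exact eLpNorm_smul_measure_of_ne_top hq f (C : ENNReal)
      rw [Lp.norm_def f, ← ENNReal.toReal_mul, ← h1]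
      exact (Lp.norm_toLp _ (memLp_comp_pullback he (Lp.memLp f))).le)

theorem coeFn_pullback (hq : q ≠ ⊤) {e : ι → O} (he : Function.Injective e)
    (f : Lp ℝ q (volume : Measure (ι → T4))) :
    pullback hq he f =ᵐ[volume] fun z => f fun i => z (e i) :=
  MemLp.coeFn_toLp (memLp_comp_pullback he (Lp.memLp f))

end Pullback

/-! ### Moments of multiple Wiener-Itô integrals -/

section WienerMoments

variable {Ω : Type*} [MeasurableSpace Ω] {P : Measure Ω}

/-- Complete pairings of a disjoint union without pairs inside one of the summands. -/
abbrev ExternalPairing {K : Type} (ι : K → Type) : Type :=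
  {σ : CompletePairing (Σ i, ι i) // ∀ p, (σ.1 p).1 ≠ p.1}

noncomputable instance {K : Type} [Finite K] (ι : K → Type) [∀ i, Finite (ι i)] :
    Fintype (ExternalPairing ι) := Fintype.ofFinite _

/-- The pair of an element of the `i`-th summand. -/
def ExternalPairing.slot {K : Type} {ι : K → Type} (σ : ExternalPairing ι) (i : K) (j : ι i) :
    σ.1.Pairs :=
  Quot.mk _ ⟨i, j⟩

/-- Two variables of one integral could share a slot only by being paired with each other, which an
external pairing forbids. Injectivity is what makes `pullback` along a slot map bounded on `L^q`. -/
theorem ExternalPairing.slot_injective {K : Type} {ι : K → Type} (σ : ExternalPairing ι) (i : K) :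
    Function.Injective (σ.slot i) := by
  intro j j' h
  rcases (σ.1.mk_eq_mk_iff _ _).1 h with h | h
  · simpa using h.symm
  · exact (σ.2 ⟨i, j⟩ (congrArg Sigma.fst h).symm).elim

theorem WhiteNoise.hasGaussianLaw (ξ : WhiteNoise P) {S : Type} [Finite S]
    (g : S → Lp ℝ 2 (volume : Measure T4)) :
    HasGaussianLaw (fun ω s => ξ.toFun (g s) ω) P := by
  cases nonempty_fintype S
  have h := (ξ.gaussian.comp_right g).hasGaussianLaw Finset.univ
  exact h.map (ContinuousLinearMap.pi fun s : S => ContinuousLinearMap.proj (R := ℝ)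
    (φ := fun _ : (Finset.univ : Finset S) => ℝ) ⟨s, Finset.mem_univ s⟩)

theorem WhiteNoise.integral_ofSet_mul_ofSet (ξ : WhiteNoise P) {A B : Set T4}
    (hA : MeasurableSet A) (hB : MeasurableSet B) :
    ∫ ω, ξ.ofSet hA ω * ξ.ofSet hB ω ∂P = volume.real (A ∩ B) := by
  rw [WhiteNoise.ofSet, WhiteNoise.ofSet, ξ.covariance,
    L2.inner_indicatorConstLp_indicatorConstLp]
  simp [Measure.real]

/-- Each pair has a variable of its own, so the integrand factorises over pairs, and the two ends of
a pair confine its variable to an intersection. -/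
theorem integral_prod_indicator_pairs {S : Type} [Fintype S] (κ : CompletePairing S)
    {B : S → Set T4} (hB : ∀ p, MeasurableSet (B p)) :
    ∫ z : κ.Pairs → T4, ∏ p, (B p).indicator (1 : T4 → ℝ) (z (Quot.mk _ p)) =
      κ.weight fun p q => volume.real (B p ∩ B q) := by
  classical
  have h1 : ∀ z : κ.Pairs → T4, ∏ p, (B p).indicator (1 : T4 → ℝ) (z (Quot.mk _ p)) =
      ∏ o, (fun o t => (B o.out ∩ B (κ.1 o.out)).indicator (1 : T4 → ℝ) t) o (z o) := by
    intro z
    rw [← Finset.prod_fiberwise Finset.univ (fun p => (Quot.mk _ p : κ.Pairs))]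
    refine Finset.prod_congr rfl fun o _ => ?_
    have h2 : (Finset.univ.filter fun p : S => (Quot.mk _ p : κ.Pairs) = o) =
        {o.out, κ.1 o.out} := by
      ext p
      simp only [Finset.mem_filter, Finset.mem_univ, true_and, Finset.mem_insert,
        Finset.mem_singleton]
      rw [← κ.mk_eq_mk_iff, Quot.out_eq, eq_comm]
    have h3 : (Quot.mk _ (κ.1 o.out) : κ.Pairs) = o := by
      rw [← Quot.out_eq o, eq_comm]
      exact Quot.sound (by rw [Quot.out_eq])
    rw [h2, Finset.prod_pair (κ.2.2 _).symm, h3, Quot.out_eq]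
    simp only [Set.inter_indicator_one]
    rfl
  simp_rw [h1]
  rw [integral_fintype_prod_volume_eq_prod]
  refine Finset.prod_congr rfl fun o _ => ?_
  exact integral_indicator_one ((hB _).inter (hB _))

variable {K : Type} [Fintype K] {ι : K → Type} [∀ i, Fintype (ι i)]

/-- The Isserlis theorem for the noises of all the sets. A pair inside one family contributes the
measure of the intersection of two disjoint sets, so only external pairings survive. -/
theorem WhiteNoise.integral_prod_ofSet (ξ : WhiteNoise P) (A : ∀ i, DisjointFamily (ι i)) :
    ∫ ω, ∏ i, ∏ j, ξ.ofSet ((A i).2.1 j) ω ∂P =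
      ∑ σ : ExternalPairing ι, ∫ z : σ.1.Pairs → T4,
        ∏ i, (univ.pi (A i).1).indicator (1 : (ι i → T4) → ℝ) fun j => z (σ.slot i j) := by
  classical
  let B : (Σ i, ι i) → Set T4 := fun p => (A p.1).1 p.2
  have hB : ∀ p, MeasurableSet (B p) := fun p => (A p.1).2.1 p.2
  have h1 := integral_prod_of_hasGaussianLaw (P := P) (X := fun p : (Σ i, ι i) => ξ.ofSet (hB p))
    (ξ.hasGaussianLaw _) fun p => ξ.centred _
  simp only [Fintype.prod_sigma] at h1
  simp only [ξ.integral_ofSet_mul_ofSet] at h1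
  have h2 : ∀ κ : CompletePairing (Σ i, ι i), ¬ (∀ p, (κ.1 p).1 ≠ p.1) →
      (κ.weight fun p q => volume.real (B p ∩ B q)) = 0 := by
    intro κ hκ
    push Not at hκ
    obtain ⟨p, hp⟩ := hκ
    refine Finset.prod_eq_zero (i := (Quot.mk _ p : κ.Pairs)) (Finset.mem_univ _) ?_
    refine (κ.apply_out_mk (fun p q => volume.real (B p ∩ B q))
      (fun p q => by rw [inter_comm]) p).trans ?_
    have h3 : Disjoint (B p) (B (κ.1 p)) := by
      have h4 := κ.2.2 p
      generalize κ.1 p = q at hp h4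
      obtain ⟨i, j⟩ := p
      obtain ⟨i', j'⟩ := q
      obtain rfl : i' = i := hp
      exact (A i').2.2 fun h : j = j' => h4 (by rw [h])
    simp [h3.inter_eq]
  calc _ = ∑ κ : CompletePairing (Σ i, ι i), κ.weight fun p q => volume.real (B p ∩ B q) := h1
    _ = ∑ κ : CompletePairing (Σ i, ι i) with (∀ p, (κ.1 p).1 ≠ p.1),
          κ.weight fun p q => volume.real (B p ∩ B q) := by
        rw [Finset.sum_filter]
        refine Finset.sum_congr rfl fun κ _ => ?_
        split_ifs with h
        · rfl
        · exact h2 κ h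
    _ = ∑ σ : ExternalPairing ι, σ.1.weight fun p q => volume.real (B p ∩ B q) :=
        Finset.sum_subtype _ (by simp) _
    _ = _ := by
        refine Finset.sum_congr rfl fun σ _ => ?_
        rw [← integral_prod_indicator_pairs σ.1 hB]
        congr 1
        funext z
        rw [Fintype.prod_sigma]
        refine Finset.prod_congr rfl fun i _ => ?_
        simp only [Set.indicator_apply, mem_univ_pi, Pi.one_apply, Finset.prod_ite_zero, B]
        simp only [ExternalPairing.slot, Finset.mem_univ, forall_const, Finset.prod_const_one]
        congr

theorem WhiteNoise.memLp_prod_ofSet' (ξ : WhiteNoise P) {ι : Type} [Fintype ι]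
    (A : DisjointFamily ι) {q : ENNReal} (hq : q ≠ ⊤) :
    MemLp (fun ω => ∏ i, ξ.ofSet (A.2.1 i) ω) q P := by
  have : IsProbabilityMeasure P := ξ.gaussian.isProbabilityMeasure
  obtain ⟨m, hm⟩ := ENNReal.exists_nat_gt hq
  refine MemLp.mono_exponent ?_ hm.le
  exact memLp_prod_of_forall_memLp (X := fun i => ξ.ofSet (A.2.1 i))
    (fun i m => (ξ.gaussian.hasGaussianLaw_eval _).memLp (by simp)) Finset.univ m

/-- The integral of elementary functions, as an element of `L^q`. -/
noncomputable def boxIntegral (ξ : WhiteNoise P) {q : ENNReal} (hq : q ≠ ⊤) (ι : Type)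
    [Fintype ι] : (DisjointFamily ι →₀ ℝ) →ₗ[ℝ] Lp ℝ q P :=
  Finsupp.linearCombination ℝ fun A : DisjointFamily ι => (ξ.memLp_prod_ofSet' A hq).toLp _

variable {q : ENNReal} [Fact (1 ≤ q)]

/-- Both sides are multilinear in the coefficients, so it is enough to treat single families of
sets. -/
theorem prodIntegral_boxIntegral [IsProbabilityMeasure P] (ξ : WhiteNoise P) (hq : q ≠ ⊤)
    (hK : (Fintype.card K : ENNReal) ≤ q) (c : ∀ i, DisjointFamily (ι i) →₀ ℝ) :
    prodIntegral P hq hK (fun i => boxIntegral ξ hq (ι i) (c i)) =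
      ∑ σ : ExternalPairing ι, prodIntegral volume hq hK fun i =>
        pullback hq (σ.slot_injective i) (boxFun q (ι i) (c i)) := by
  let L : MultilinearMap ℝ (fun i => DisjointFamily (ι i) →₀ ℝ) ℝ :=
    (prodIntegral P hq hK).toMultilinearMap.compLinearMap fun i => boxIntegral ξ hq (ι i)
  let R : MultilinearMap ℝ (fun i => DisjointFamily (ι i) →₀ ℝ) ℝ :=
    ∑ σ : ExternalPairing ι, (prodIntegral volume hq hK).toMultilinearMap.compLinearMap fun i =>
        (pullback hq (σ.slot_injective i)).toLinearMap ∘ₗ (boxFun q (ι i))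
  have hLR : L = R := by
    refine Module.Basis.ext_multilinear (fun i => Finsupp.basisSingleOne) fun A => ?_
    have hL : (L fun i => Finsupp.basisSingleOne (A i)) =
        ∫ ω, ∏ i, ∏ j, ξ.ofSet ((A i).2.1 j) ω ∂P := by
      change ∫ ω, ∏ i, boxIntegral ξ hq (ι i) (Finsupp.basisSingleOne (A i)) ω ∂P = _
      refine integral_congr_ae ?_
      have : ∀ᵐ ω ∂P, ∀ i, (ξ.memLp_prod_ofSet' (A i) hq).toLp _ ω =
          ∏ j, ξ.ofSet ((A i).2.1 j) ω := by
        rw [ae_all_iff]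
        exact fun i => MemLp.coeFn_toLp _
      filter_upwards [this] with ω hω
      refine Finset.prod_congr rfl fun i _ => ?_
      simp only [boxIntegral, Finsupp.coe_basisSingleOne, Finsupp.linearCombination_single,
        one_smul]
      exact hω i
    have hR : (R fun i => Finsupp.basisSingleOne (A i)) =
        ∑ σ : ExternalPairing ι, ∫ z : σ.1.Pairs → T4,
        ∏ i, (univ.pi (A i).1).indicator (1 : (ι i → T4) → ℝ) fun j => z (σ.slot i j) := by
      simp only [R, sum_apply]
      refine Finset.sum_congr rfl fun σ _ => ?_
      change ∫ z, ∏ i, pullback hq (σ.slot_injective i)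
        (boxFun q (ι i) (Finsupp.basisSingleOne (A i))) z = _
      refine integral_congr_ae ?_
      have : ∀ᵐ z : σ.1.Pairs → T4, ∀ i, pullback hq (σ.slot_injective i)
          (boxFun q (ι i) (Finsupp.basisSingleOne (A i))) z =
          (univ.pi (A i).1).indicator (1 : (ι i → T4) → ℝ) fun j => z (σ.slot i j) := by
        rw [ae_all_iff]
        intro i
        refine (coeFn_pullback hq (σ.slot_injective i) _).trans ?_
        refine (quasiMeasurePreserving_pullback (σ.slot_injective i)).ae_eq_comp
          (g := boxFun q (ι i) (Finsupp.basisSingleOne (A i)))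
          (g' := (univ.pi (A i).1).indicator (1 : (ι i → T4) → ℝ)) ?_
        simp only [boxFun, Finsupp.coe_basisSingleOne, Finsupp.linearCombination_single,
          one_smul]
        exact indicatorConstLp_coeFn
      filter_upwards [this] with z hz
      exact Finset.prod_congr rfl fun i _ => hz i
    rw [hL, hR, ξ.integral_prod_ofSet]
  have := congrArg (fun M : MultilinearMap ℝ (fun i => DisjointFamily (ι i) →₀ ℝ) ℝ => M c) hLR
  simp only [R, sum_apply] at this
  exact this

theorem norm_multilinear_comp_le {E F K : Type*} [Fintype K] [NormedAddCommGroup E]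
    [NormedSpace ℝ E] [NormedAddCommGroup F] [NormedSpace ℝ F]
    (M : ContinuousMultilinearMap ℝ (fun _ : K => F) ℝ) (T : K → E →L[ℝ] F) (f : E) :
    ‖M fun i => T i f‖ ≤ ‖M‖ * (∏ i, ‖T i‖) * ‖f‖ ^ Fintype.card K := by
  refine (M.le_opNorm _).trans ?_
  rw [mul_assoc]
  refine mul_le_mul_of_nonneg_left ?_ (norm_nonneg _)
  calc ∏ i, ‖T i f‖ ≤ ∏ i, (‖T i‖ * ‖f‖) :=
        Finset.prod_le_prod (fun i _ => norm_nonneg _) fun i _ => (T i).le_opNorm f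
    _ = _ := by rw [Finset.prod_mul_distrib, Finset.prod_const, Finset.card_univ]

/-- No hypercontractivity is needed: the moment formula with `2m` copies of one function writes the
`2m`-th power of the left norm as a sum of integrals, each of which Hölder bounds by the right norm.
-/
theorem exists_norm_boxIntegral_le [IsProbabilityMeasure P] (ξ : WhiteNoise P) {m : ℕ}
    (hm : m ≠ 0) (hq : q = (2 * m : ℕ)) (hq' : q ≠ ⊤) (ι : Type) [Fintype ι] :
    ∃ C : ℝ, ∀ c, ‖boxIntegral ξ hq' ι c‖ ≤ C * ‖boxFun q ι c‖ := by
  have hK : (Fintype.card (Fin (2 * m)) : ENNReal) ≤ q := by simp [hq]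
  set C : ℝ := ∑ σ : ExternalPairing (fun _ : Fin (2 * m) => ι),
    ‖prodIntegral (K := Fin (2 * m)) (volume : Measure (σ.1.Pairs → T4)) hq' hK‖ *
      ∏ i : Fin (2 * m), ‖pullback hq' (q := q) (σ.slot_injective i)‖ with hC
  have hC0 : 0 ≤ C := Finset.sum_nonneg fun σ _ => by positivity
  have h2m : 2 * m ≠ 0 := by positivity
  -- Taking `max 1 C` avoids extracting a root: a number that is at least `1` is at most its `2m`-th
  -- power.
  refine ⟨max 1 C, fun c => ?_⟩
  have h1 : ‖boxIntegral ξ hq' ι c‖ ^ (2 * m) =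
      prodIntegral (K := Fin (2 * m)) P hq' hK fun _ => boxIntegral ξ hq' ι c := by
    rw [prodIntegral_apply, Lp.norm_def,
      (Lp.memLp (boxIntegral ξ hq' ι c)).eLpNorm_eq_integral_rpow_norm (by simp [hq, hm]) hq',
      ENNReal.toReal_ofReal (by positivity), ← Real.rpow_natCast, ← Real.rpow_mul (by positivity)]
    have : q.toReal = ((2 * m : ℕ) : ℝ) := by rw [hq, ENNReal.toReal_natCast]
    rw [this, inv_mul_cancel₀ (by exact_mod_cast h2m), Real.rpow_one]
    congr 1
    funext ω
    rw [Real.rpow_natCast, Finset.prod_const, Finset.card_univ, Fintype.card_fin, Real.norm_eq_abs,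
      pow_mul, pow_mul, sq_abs]
  have h2 : ‖boxIntegral ξ hq' ι c‖ ^ (2 * m) ≤ C * ‖boxFun q ι c‖ ^ (2 * m) := by
    have h3 := prodIntegral_boxIntegral (K := Fin (2 * m)) (ι := fun _ => ι) ξ hq' hK fun _ => c
    rw [h1, h3, hC, Finset.sum_mul]
    refine Finset.sum_le_sum fun σ _ => (Real.le_norm_self _).trans ?_
    refine (norm_multilinear_comp_le _ (fun i => pullback hq' (σ.slot_injective i)) _).trans ?_
    rw [Fintype.card_fin]
  refine le_of_pow_le_pow_left₀ h2m (by positivity) (h2.trans ?_)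
  rw [mul_pow]
  refine mul_le_mul_of_nonneg_right ?_ (by positivity)
  exact (le_max_right 1 C).trans (le_self_pow₀ (le_max_left 1 C) h2m)

/-- The multiple Wiener-Itô integral as a map from `L^q` to `L^q`. -/
noncomputable def wienerIntegralLq (ξ : WhiteNoise P) (hq : q ≠ ⊤) (ι : Type) [Fintype ι] :
    Lp ℝ q (volume : Measure (ι → T4)) →L[ℝ] Lp ℝ q P :=
  (boxIntegral ξ hq ι).extendOfNorm (boxFun q ι)

/-- Two continuous maps that agree on the dense elementary functions. This links the `L^q`
extension, on which products can be integrated, with the `L²` integral that defines the trees. -/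
theorem lpInclusion_wienerIntegralLq [IsProbabilityMeasure P] (ξ : WhiteNoise P) {m : ℕ}
    (hm : m ≠ 0) (hq : q = (2 * m : ℕ)) (hq' : q ≠ ⊤) (h2 : 2 ≤ q) (ι : Type) [Fintype ι]
    (f : Lp ℝ q (volume : Measure (ι → T4))) :
    lpInclusion P h2 (wienerIntegralLq ξ hq' ι f) =
      wienerIntegralLp ι ξ (lpInclusion volume h2 f) := by
  have h2' : (2 : ENNReal) ≠ ⊤ := by simp
  have e1 : ∀ c, lpInclusion P h2 (boxIntegral ξ hq' ι c) = boxIntegral ξ h2' ι c := by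
    intro c
    have : (lpInclusion P h2).toLinearMap ∘ₗ boxIntegral ξ hq' ι = boxIntegral ξ h2' ι := by
      refine Finsupp.lhom_ext' fun A => LinearMap.ext_ring ?_
      simp only [boxIntegral, LinearMap.comp_apply, Finsupp.lsingle_apply,
        Finsupp.linearCombination_single, one_smul]
      rfl
    exact LinearMap.congr_fun this c
  have e2 : ∀ c, lpInclusion volume h2 (boxFun q ι c) = boxFun 2 ι c := by
    intro c
    have : (lpInclusion volume h2).toLinearMap ∘ₗ boxFun q ι = boxFun 2 ι := by
      refine Finsupp.lhom_ext' fun A => LinearMap.ext_ring ?_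
      simp only [boxFun, LinearMap.comp_apply, Finsupp.lsingle_apply,
        Finsupp.linearCombination_single, one_smul]
      rfl
    exact LinearMap.congr_fun this c
  refine congrFun (DenseRange.equalizer (denseRange_boxFun hq' ι)
    (g := fun f => lpInclusion P h2 (wienerIntegralLq ξ hq' ι f))
    (h := fun f => wienerIntegralLp ι ξ (lpInclusion volume h2 f)) (by fun_prop) (by fun_prop)
    (funext fun c => ?_)) f
  simp only [Function.comp_apply]
  rw [wienerIntegralLq, LinearMap.extendOfNorm_eq (denseRange_boxFun hq' ι)
    (exists_norm_boxIntegral_le ξ hm hq hq' ι), e1, e2]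
  -- The norm bound with `m = 1` is what makes the `L²` extension agree with the elementary
  -- integral.
  exact (LinearMap.extendOfNorm_eq (denseRange_boxFun h2' ι)
    (exists_norm_boxIntegral_le ξ one_ne_zero (by simp) h2' ι) c).symm

theorem prodIntegral_wienerIntegralLq [IsProbabilityMeasure P] (ξ : WhiteNoise P) {m : ℕ}
    (hm : m ≠ 0) (hq : q = (2 * m : ℕ)) (hq' : q ≠ ⊤) (hK : (Fintype.card K : ENNReal) ≤ q)
    (f : ∀ i, Lp ℝ q (volume : Measure (ι i → T4))) :
    prodIntegral P hq' hK (fun i => wienerIntegralLq ξ hq' (ι i) (f i)) =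
      ∑ σ : ExternalPairing ι, prodIntegral volume hq' hK fun i =>
        pullback hq' (σ.slot_injective i) (f i) := by
  have hd : DenseRange fun (c : ∀ i, DisjointFamily (ι i) →₀ ℝ) i => boxFun q (ι i) (c i) :=
    DenseRange.piMap fun i => denseRange_boxFun hq' (ι i)
  refine congrFun (hd.equalizer
    (g := fun f : (∀ i, Lp ℝ q (volume : Measure (ι i → T4))) =>
      prodIntegral P hq' hK (fun i => wienerIntegralLq ξ hq' (ι i) (f i)))
    (h := fun f => ∑ σ : ExternalPairing ι, prodIntegral volume hq' hK fun i =>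
        pullback hq' (σ.slot_injective i) (f i)) ?_ ?_
    (funext fun c => ?_)) f
  · exact (prodIntegral P hq' hK).cont.comp (by fun_prop)
  · exact continuous_finsetSum _ fun σ _ => (prodIntegral volume hq' hK).cont.comp (by fun_prop)
  · simp only [Function.comp_apply]
    rw [← prodIntegral_boxIntegral ξ hq' hK c]
    congr 1
    funext i
    exact LinearMap.extendOfNorm_eq (denseRange_boxFun hq' (ι i))
      (exists_norm_boxIntegral_le ξ hm hq hq' (ι i)) (c i)

/-- The expectation of a product of multiple Wiener-Itô integrals. -/
theorem integral_prod_wienerIntegral [IsProbabilityMeasure P] (ξ : WhiteNoise P)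
    {f : ∀ i, (ι i → T4) → ℝ} (hf : ∀ i, MemLp (f i) ⊤ volume) :
    Integrable (fun ω => ∏ i, wienerIntegral ξ (f i) ω) P ∧
      ∫ ω, ∏ i, wienerIntegral ξ (f i) ω ∂P =
        ∑ σ : ExternalPairing ι, ∫ z : σ.1.Pairs → T4, ∏ i, f i fun j => z (σ.slot i j) := by
  -- Then `q = 2m` is even, at least `2` and at least the number of factors; the `+ 1` covers the
  -- empty product.
  set m := Fintype.card K + 1 with hm
  obtain ⟨q, hq⟩ : ∃ q : ENNReal, q = (2 * m : ℕ) := ⟨_, rfl⟩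
  have hq' : q ≠ ⊤ := by rw [hq]; exact ENNReal.natCast_ne_top _
  have h2 : 2 ≤ q := by
    rw [hq]
    have : 2 ≤ 2 * m := by omega
    exact_mod_cast this
  have : Fact (1 ≤ q) := ⟨le_trans (by norm_num) h2⟩
  have hK : (Fintype.card K : ENNReal) ≤ q := by
    rw [hq]
    have : Fintype.card K ≤ 2 * m := by omega
    exact_mod_cast this
  have hfq : ∀ i, MemLp (f i) q volume := fun i => (hf i).mono_exponent le_top
  have hf2 : ∀ i, MemLp (f i) 2 volume := fun i => (hf i).mono_exponent le_top
  let F : ∀ i, Lp ℝ q (volume : Measure (ι i → T4)) := fun i => (hfq i).toLp (f i)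
  -- An equality of functions, not merely almost everywhere: `lpInclusion` keeps the underlying
  -- class, hence its chosen representative.
  have hW : ∀ i, wienerIntegral ξ (f i) = (wienerIntegralLq ξ hq' (ι i) (F i) : Ω → ℝ) := by
    intro i
    rw [wienerIntegral, dif_pos (hf2 i),
      ← coeFn_lpInclusion (μ := P) h2 (wienerIntegralLq ξ hq' (ι i) (F i)),
      lpInclusion_wienerIntegralLq ξ (Nat.succ_ne_zero _) hq hq' h2]
    rfl
  simp_rw [hW]
  refine ⟨integrable_prod_of_memLp hq' hK (by rw [hq]; simp [hm]) fun i => Lp.memLp _, ?_⟩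
  rw [← prodIntegral_apply hq' hK, prodIntegral_wienerIntegralLq ξ (Nat.succ_ne_zero _) hq hq' hK]
  refine Finset.sum_congr rfl fun σ _ => ?_
  rw [prodIntegral_apply]
  refine integral_congr_ae ?_
  have : ∀ᵐ z : σ.1.Pairs → T4, ∀ i, pullback hq' (σ.slot_injective i) (F i) z =
      f i fun j => z (σ.slot i j) := by
    rw [ae_all_iff]
    intro i
    refine (coeFn_pullback hq' (σ.slot_injective i) _).trans ?_
    exact (quasiMeasurePreserving_pullback (σ.slot_injective i)).ae_eq_comp
      (MemLp.coeFn_toLp (hfq i))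
  filter_upwards [this] with z hz
  exact Finset.prod_congr rfl fun i _ => hz i

end WienerMoments

/-! ### Valuations as integrals over all internal variables -/

section Glue

variable {I O W : Type} {J : I → Type} [Fintype I] [Fintype O] [Fintype W] [∀ i, Fintype (J i)]

/-- The assignment on `W ≃ O ⊕ Σ i, J i` given by assignments on `O` and on the `J i`. -/
def glueAssign (e : O ⊕ (Σ i, J i) ≃ W) (p : (O → T4) × (∀ i, J i → T4)) (w : W) : T4 :=
  Sum.elim p.1 (fun s => p.2 s.1 s.2) (e.symm w)

theorem measurePreserving_glueAssign (e : O ⊕ (Σ i, J i) ≃ W) :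
    MeasurePreserving (glueAssign e) volume volume := by
  have hm : Measurable (glueAssign e) := by
    refine measurable_pi_lambda _ fun w => ?_
    unfold glueAssign
    rcases e.symm w with o | s
    · exact (measurable_pi_apply o).comp measurable_fst
    · exact (measurable_pi_apply s.2).comp ((measurable_pi_apply s.1).comp measurable_snd)
  refine ⟨hm, ?_⟩
  symm
  refine Measure.pi_eq fun s hs => ?_
  rw [Measure.map_apply hm (MeasurableSet.univ_pi hs)]
  have : glueAssign e ⁻¹' univ.pi s = (univ.pi fun o => s (e (Sum.inl o))) ×ˢ
      (univ.pi fun i => univ.pi fun j => s (e (Sum.inr ⟨i, j⟩))) := by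
    ext p
    simp only [mem_preimage, mem_univ_pi, mem_prod, glueAssign]
    constructor
    · intro h
      exact ⟨fun o => by simpa using h (e (Sum.inl o)),
        fun i j => by simpa using h (e (Sum.inr ⟨i, j⟩))⟩
    · rintro ⟨h1, h2⟩ w
      obtain ⟨o | ⟨i, j⟩, rfl⟩ := e.surjective w
      · simpa using h1 o
      · simpa using h2 i j
  rw [this, Measure.volume_eq_prod, Measure.prod_prod, volume_pi_pi, volume_pi_pi,
    ← e.prod_comp, Fintype.prod_sum_type, Fintype.prod_sigma]
  simp_rw [volume_pi_pi]

/-- Fubini for factors that share the variables in `O` and own the variables in `J i`. It is applied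
with `O` a point, with `O` empty, and with `O` the set of glued vertices. -/
theorem integral_glue (e : O ⊕ (Σ i, J i) ≃ W) (F : ∀ i, (O → T4) → (J i → T4) → ℝ)
    (hF : ∀ i, Measurable fun p : (O → T4) × (J i → T4) => F i p.1 p.2)
    (hb : ∀ i, ∃ C, ∀ z w, |F i z w| ≤ C) :
    ∫ w : W → T4, ∏ i, F i (fun o => w (e (Sum.inl o))) (fun j => w (e (Sum.inr ⟨i, j⟩))) =
      ∫ z : O → T4, ∏ i, ∫ w : J i → T4, F i z w := by
  have h := measurePreserving_glueAssign e
  have hm : Measurable fun w : W → T4 =>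
      ∏ i, F i (fun o => w (e (Sum.inl o))) (fun j => w (e (Sum.inr ⟨i, j⟩))) := by
    refine Finset.measurable_prod _ fun i _ => ?_
    exact (hF i).comp (Measurable.prodMk (by fun_prop) (by fun_prop))
  rw [← h.map_eq, integral_map h.measurable.aemeasurable hm.aestronglyMeasurable]
  have h2 : ∀ p : (O → T4) × (∀ i, J i → T4),
      (∏ i, F i (fun o => glueAssign e p (e (Sum.inl o)))
        (fun j => glueAssign e p (e (Sum.inr ⟨i, j⟩)))) = ∏ i, F i p.1 (p.2 i) := by
    intro p
    simp [glueAssign]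
  simp_rw [h2]
  rw [Measure.volume_eq_prod, integral_prod]
  · refine integral_congr_ae (Filter.Eventually.of_forall fun z => ?_)
    exact integral_fintype_prod_volume_eq_prod fun i => F i z
  · choose C hC using hb
    refine Integrable.of_bound (C := ∏ i, C i) ?_ (Filter.Eventually.of_forall fun p => ?_)
    · refine (Finset.measurable_prod _ fun i _ => ?_).aestronglyMeasurable
      exact (hF i).comp (Measurable.prodMk (by fun_prop) (by fun_prop))
    · rw [Real.norm_eq_abs, Finset.abs_prod]
      exact Finset.prod_le_prod (fun i _ => abs_nonneg _) fun i _ => hC i _ _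

end Glue

/-- The volume of the torus. -/
noncomputable def torusVolume : ℝ := volume.real (univ : Set T4)

theorem torusVolume_ne_zero : torusVolume ≠ 0 := by
  have : (volume : Measure T4) univ ≠ 0 := by
    rw [volume_pi, Measure.pi_univ]
    simp [AddCircle.measure_univ, Real.pi_pos]
  exact (ENNReal.toReal_pos this (measure_ne_top _ _)).ne'

namespace FeynmanDiagram

variable {Λ : Type} (Γ : FeynmanDiagram Λ) {G : T4 → ℝ}

theorem assign_of_some {x : Λ → T4} {z : Γ.Internal → T4} {v : Γ.V} {l : Λ}
    (h : Γ.label v = some l) : Γ.assign x z v = x l := by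
  unfold assign
  split <;> simp_all

theorem assign_of_none {x : Λ → T4} {z : Γ.Internal → T4} {v : Γ.V}
    (h : Γ.label v = none) : Γ.assign x z v = z ⟨v, h⟩ := by
  unfold assign
  split <;> simp_all

/-- The integral of the kernel over all internal variables. -/
noncomputable def fullIntegral (G : T4 → ℝ) (x : Λ → T4) : ℝ :=
  ∫ z : Γ.Internal → T4, Γ.kernel G (Γ.assign x z)

theorem measurable_kernel (hG : Measurable G) : Measurable (Γ.kernel G) := by
  unfold kernel
  refine Finset.measurable_prod _ fun e _ => hG.comp ?_
  exact (measurable_pi_apply _).sub (measurable_pi_apply _)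

theorem abs_kernel_le {C : ℝ} (hC : ∀ x, |G x| ≤ C) (x : Γ.V → T4) :
    |Γ.kernel G x| ≤ C ^ Fintype.card Γ.E := by
  unfold kernel
  rw [Finset.abs_prod, ← Finset.card_univ, ← Finset.prod_const]
  exact Finset.prod_le_prod (fun i _ => abs_nonneg _) fun e _ => hC _

theorem measurable_assign :
    Measurable fun p : (Λ → T4) × (Γ.Internal → T4) => Γ.assign p.1 p.2 := by
  refine measurable_pi_lambda _ fun v => ?_
  rcases h : Γ.label v with _ | l
  · simp_rw [Γ.assign_of_none h]
    fun_prop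
  · simp_rw [Γ.assign_of_some h]
    fun_prop

theorem measurable_fullIntegral (hG : Measurable G) : Measurable (Γ.fullIntegral G) := by
  have h : StronglyMeasurable fun p : (Λ → T4) × (Γ.Internal → T4) =>
      Γ.kernel G (Γ.assign p.1 p.2) :=
    ((Γ.measurable_kernel hG).comp Γ.measurable_assign).stronglyMeasurable
  exact h.integral_prod_right.measurable

theorem exists_abs_fullIntegral_le (hb : ∃ C, ∀ x, |G x| ≤ C) :
    ∃ C, ∀ x, |Γ.fullIntegral G x| ≤ C := by
  obtain ⟨C, hC⟩ := hb
  refine ⟨C ^ Fintype.card Γ.E * (volume : Measure (Γ.Internal → T4)).real univ, fun x => ?_⟩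
  rw [← Real.norm_eq_abs, fullIntegral]
  refine norm_integral_le_of_norm_le_const (Filter.Eventually.of_forall fun z => ?_)
  rw [Real.norm_eq_abs]
  exact Γ.abs_kernel_le hC _

theorem kernel_add_const (x : Γ.V → T4) (a : T4) :
    Γ.kernel G (fun v => x v + a) = Γ.kernel G x := by
  simp [kernel]

theorem connectedValuation_of_leaf {v₀ v : Γ.V} (hv : Γ.label v ≠ none) (x : Λ → T4) :
    Γ.connectedValuation G v₀ x = Γ.fullIntegral G x :=
  if_pos ⟨v, hv⟩

/-- By translation invariance, the integral over the other variables does not depend on where `v₀`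
is placed; integrating over its position too only adds the volume of the torus. -/
theorem connectedValuation_of_leafless (hG : Measurable G) (hb : ∃ C, ∀ x, |G x| ≤ C)
    (h : ∀ v, Γ.label v = none) (v₀ : Γ.V) (x : Λ → T4) :
    Γ.connectedValuation G v₀ x = torusVolume⁻¹ * Γ.fullIntegral G x := by
  classical
  rw [connectedValuation, if_neg (by simpa using h)]
  let e : Unit ⊕ (Σ _ : Unit, {v : Γ.V // v ≠ v₀}) ≃ Γ.Internal :=
    { toFun := Sum.elim (fun _ => ⟨v₀, h v₀⟩) fun s => ⟨s.2.1, h s.2.1⟩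
      invFun := fun v => if hv : v.1 = v₀ then Sum.inl () else Sum.inr ⟨(), v.1, hv⟩
      left_inv := by
        rintro (_ | ⟨_, v, hv⟩)
        · simp
        · simp [hv]
      right_inv := by
        rintro ⟨v, hv⟩
        by_cases h1 : v = v₀
        · simp [h1]
        · simp [h1] }
  have hg := integral_glue e
    (fun _ (a : Unit → T4) w => Γ.kernel G fun v => if hv : v = v₀ then a () else w ⟨v, hv⟩)
    (fun _ => by
      refine (Γ.measurable_kernel hG).comp (measurable_pi_lambda _ fun v => ?_)
      by_cases hv : v = v₀
      · simp only [hv, dite_true]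
        fun_prop
      · simp only [hv, dite_false]
        fun_prop)
    (fun _ => by
      obtain ⟨C, hC⟩ := hb
      exact ⟨_, fun z w => Γ.abs_kernel_le hC _⟩)
  have e1 : Γ.fullIntegral G x = ∫ w : Γ.Internal → T4, ∏ _i : Unit,
      Γ.kernel G (fun v => if hv : v = v₀ then w (e (Sum.inl ())) else
        w (e (Sum.inr ⟨(), v, hv⟩))) := by
    unfold fullIntegral
    congr 1
    funext w
    rw [Finset.univ_unique, Finset.prod_singleton]
    congr 1
    funext v
    rw [Γ.assign_of_none (h v)]
    by_cases hv : v = v₀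
    · subst hv; simp [e]
    · simp [e, hv]
  rw [e1, hg]
  simp only [Finset.univ_unique, Finset.prod_singleton]
  have e2 : ∀ a : Unit → T4, (∫ w : {v : Γ.V // v ≠ v₀} → T4,
      Γ.kernel G fun v => if hv : v = v₀ then a () else w ⟨v, hv⟩) =
      ∫ w : {v : Γ.V // v ≠ v₀} → T4,
        Γ.kernel G fun v => if hv : v = v₀ then 0 else w ⟨v, hv⟩ := by
    intro a
    have : (volume : Measure ({v : Γ.V // v ≠ v₀} → T4)).IsAddLeftInvariant :=
      Measure.pi.isAddLeftInvariant _
    -- Shift the remaining variables by the position of `v₀`; the kernel sees only differences.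
    rw [← integral_add_left_eq_self (μ := (volume : Measure ({v : Γ.V // v ≠ v₀} → T4)))
      (fun w => Γ.kernel G fun v => if hv : v = v₀ then a () else w ⟨v, hv⟩) (fun _ => a ())]
    congr 1
    funext w
    refine Eq.trans ?_ (Γ.kernel_add_const _ (a ()))
    congr 1
    funext v
    split_ifs
    · simp
    · exact add_comm _ _
  refine (Eq.trans (congrArg (torusVolume⁻¹ * ·)
    (integral_congr_ae (Filter.Eventually.of_forall e2))) ?_).symm
  have e3 : (volume : Measure (Unit → T4)).real univ = torusVolume := by
    rw [torusVolume, Measure.real, Measure.real, volume_pi, Measure.pi_univ]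
    simp
  simp only [integral_const]
  rw [e3, smul_eq_mul, inv_mul_cancel_left₀ torusVolume_ne_zero]

/-- Edges stay inside components, so Fubini applies with no shared variable. -/
theorem prod_fullIntegral_component (hG : Measurable G) (hb : ∃ C, ∀ x, |G x| ≤ C)
    (x : Λ → T4) : ∏ c, (Γ.component c).fullIntegral G x = Γ.fullIntegral G x := by
  classical
  let e : Empty ⊕ (Σ c, (Γ.component c).Internal) ≃ Γ.Internal :=
    { toFun := Sum.elim Empty.elim fun s => ⟨s.2.1.1, s.2.2⟩
      invFun := fun v => Sum.inr ⟨Quot.mk _ v.1, ⟨v.1, rfl⟩, v.2⟩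
      left_inv := by
        rintro (h | ⟨c, ⟨v, rfl⟩, hv⟩)
        · exact h.elim
        · rfl
      right_inv := fun v => rfl }
  have hg := integral_glue e
    (fun c (_ : Empty → T4) w => (Γ.component c).kernel G ((Γ.component c).assign x w))
    (fun c => ((Γ.component c).measurable_kernel hG).comp
      ((Γ.component c).measurable_assign.comp
        (Measurable.prodMk measurable_const measurable_snd)))
    (fun c => by
      obtain ⟨C, hC⟩ := hb
      exact ⟨_, fun z w => (Γ.component c).abs_kernel_le hC _⟩)
  have e1 : ∀ w : Γ.Internal → T4, Γ.kernel G (Γ.assign x w) =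
      ∏ c, (Γ.component c).kernel G ((Γ.component c).assign x
        fun v => w (e (Sum.inr ⟨c, v⟩))) := by
    intro w
    unfold kernel
    rw [← (Equiv.sigmaFiberEquiv fun e : Γ.E => (Quot.mk Γ.Adj (Γ.src e))).prod_comp,
      Fintype.prod_sigma]
    refine Finset.prod_congr rfl fun c _ => ?_
    have hv : ∀ v : (Γ.component c).V, (Γ.component c).assign x
        (fun v => w (e (Sum.inr ⟨c, v⟩))) v = Γ.assign x w v.1 := by
      intro v
      rcases h : Γ.label v.1 with _ | l
      · rw [Γ.assign_of_none h, (Γ.component c).assign_of_none h]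
        rfl
      · rw [Γ.assign_of_some h, (Γ.component c).assign_of_some h]
    simp_rw [hv]
    rfl
  unfold fullIntegral
  simp_rw [e1]
  have e2 : (volume : Measure (Empty → T4)).real univ = 1 := by
    rw [Measure.real, volume_pi, Measure.pi_univ]
    simp
  rw [hg, integral_const, e2, one_smul]

/-- The factor collects one inverse volume for each component without leaves. It serves to deduce
measurability and boundedness of valuations. -/
theorem exists_valuation_eq (hG : Measurable G) (hb : ∃ C, ∀ x, |G x| ≤ C) :
    ∃ a : ℝ, ∀ x, Γ.valuation G x = a * Γ.fullIntegral G x := by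
  classical
  refine ⟨∏ c, if ∃ v, (Γ.component c).label v ≠ none then 1 else torusVolume⁻¹, fun x => ?_⟩
  rw [← Γ.prod_fullIntegral_component hG hb, ← Finset.prod_mul_distrib]
  refine Finset.prod_congr rfl fun c _ => ?_
  split_ifs with h
  · obtain ⟨v, hv⟩ := h
    exact ((Γ.component c).connectedValuation_of_leaf hv x).trans (one_mul _).symm
  · exact (Γ.component c).connectedValuation_of_leafless hG hb (by simpa using h) _ x

/-- Every vertex is connected to a leaf. -/
def LeafConnected : Prop := ∀ v, ∃ l, Relation.EqvGen Γ.Adj v l ∧ Γ.label l ≠ none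

variable {Γ}

/-- Every component contains a leaf, so no inverse volume appears. -/
theorem LeafConnected.valuation_eq (h : Γ.LeafConnected) (hG : Measurable G)
    (hb : ∃ C, ∀ x, |G x| ≤ C) (x : Λ → T4) : Γ.valuation G x = Γ.fullIntegral G x := by
  rw [← Γ.prod_fullIntegral_component hG hb]
  refine Finset.prod_congr rfl fun c _ => ?_
  induction c using Quot.ind with | mk v =>
  obtain ⟨l, hl, hl'⟩ := h v
  exact (Γ.component _).connectedValuation_of_leaf
    (v := ⟨l, (Quot.eqvGen_sound hl).symm⟩) hl' x

theorem Connected.valuation_eq (h : Γ.Connected) (h0 : ∀ v, Γ.label v = none)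
    (hG : Measurable G) (hb : ∃ C, ∀ x, |G x| ≤ C) (x : Λ → T4) :
    Γ.valuation G x = torusVolume⁻¹ * Γ.fullIntegral G x := by
  classical
  obtain ⟨v⟩ := h.1
  let u : Unique Γ.Component :=
    { default := Quot.mk _ v
      uniq := by
        rintro ⟨w⟩
        exact Quot.eqvGen_sound (h.2 w v) }
  rw [← Γ.prod_fullIntegral_component hG hb, valuation, Fintype.prod_subsingleton _ default,
    Fintype.prod_subsingleton _ default]
  exact (Γ.component _).connectedValuation_of_leafless hG hb (fun v => h0 v.1) _ x

/-- Diagrams without leaves which are isomorphic as graphs have the same full integral. -/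
theorem fullIntegral_eq_of_equiv {Λ' : Type} {Γ' : FeynmanDiagram Λ'} (fV : Γ.V ≃ Γ'.V)
    (fE : Γ.E ≃ Γ'.E) (hs : ∀ e, Γ'.src (fE e) = fV (Γ.src e))
    (ht : ∀ e, Γ'.tgt (fE e) = fV (Γ.tgt e)) (h0 : ∀ v, Γ.label v = none)
    (h0' : ∀ v, Γ'.label v = none) (x : Λ → T4) (x' : Λ' → T4) :
    Γ.fullIntegral G x = Γ'.fullIntegral G x' := by
  let f : Γ.Internal ≃ Γ'.Internal :=
    { toFun := fun v => ⟨fV v.1, h0' _⟩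
      invFun := fun v => ⟨fV.symm v.1, h0 _⟩
      left_inv := fun v => by simp
      right_inv := fun v => by simp }
  have hmp := (volume_measurePreserving_piCongrLeft (fun _ : Γ'.Internal => T4) f).symm
  unfold fullIntegral
  rw [← hmp.integral_comp']
  congr 1
  funext z
  unfold kernel
  rw [← fE.prod_comp]
  refine Finset.prod_congr rfl fun e _ => ?_
  rw [Γ.assign_of_none (h0 _), Γ.assign_of_none (h0 _), Γ'.assign_of_none (h0' _),
    Γ'.assign_of_none (h0' _), hs, ht]
  rfl

/-- An edge that is removed has its ends identified; every other edge survives. -/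
theorem eqvGen_contract (S : Set Γ.Subdiagram) {v w : Γ.V} (h : Relation.EqvGen Γ.Adj v w) :
    Relation.EqvGen (Γ.contract S).Adj (Quot.mk _ v) (Quot.mk _ w) := by
  induction h with
  | rel v w h =>
    obtain ⟨e, rfl, rfl⟩ := h
    by_cases he : ∃ γ ∈ S, e ∈ γ.edges
    · obtain ⟨γ, hγ, heγ⟩ := he
      have : (Quot.mk _ (Γ.src e) : (Γ.contract S).V) = Quot.mk _ (Γ.tgt e) :=
        Quot.sound ⟨γ, hγ, γ.src_mem e heγ, γ.tgt_mem e heγ⟩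
      rw [this]
      exact Relation.EqvGen.refl _
    · push Not at he
      exact Relation.EqvGen.rel _ _ ⟨⟨e, he⟩, rfl, rfl⟩
  | refl v => exact Relation.EqvGen.refl _
  | symm v w _ ih => exact ih.symm
  | trans u v w _ _ ih₁ ih₂ => exact ih₁.trans _ _ _ ih₂

theorem Connected.contract (h : Γ.Connected) (S : Set Γ.Subdiagram) :
    (Γ.contract S).Connected := by
  refine ⟨h.1.map (Quot.mk _), ?_⟩
  rintro ⟨v⟩ ⟨w⟩
  exact eqvGen_contract S (h.2 v w)

theorem LeafConnected.contract (h : Γ.LeafConnected) (S : Set Γ.Subdiagram) :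
    (Γ.contract S).LeafConnected := by
  rintro ⟨v⟩
  obtain ⟨l, hl, hl'⟩ := h v
  exact ⟨Quot.mk _ l, eqvGen_contract S hl, hl'⟩

open Classical in
theorem renormalisedValuation_eq (Γ : FeynmanDiagram Λ) (x : Λ → T4) :
    Γ.renormalisedValuation G x = ∑ F : Finset Γ.Subdiagram with IsForest F,
      (-1) ^ F.card * ((∏ γ ∈ F,
        (γ.toDiagram.contract (γ.restrict '' children F γ)).valuation G x) *
          (Γ.contract (roots F)).valuation G x) := by
  simp [renormalisedValuation, renormalise, extract, map_sum, map_mul, map_prod]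

theorem measurable_valuation (Γ : FeynmanDiagram Λ) (hG : Measurable G)
    (hb : ∃ C, ∀ x, |G x| ≤ C) : Measurable (Γ.valuation G) := by
  obtain ⟨a, ha⟩ := Γ.exists_valuation_eq hG hb
  rw [show Γ.valuation G = fun x => a * Γ.fullIntegral G x from funext ha]
  exact (Γ.measurable_fullIntegral hG).const_mul a

theorem exists_abs_valuation_le (Γ : FeynmanDiagram Λ) (hG : Measurable G)
    (hb : ∃ C, ∀ x, |G x| ≤ C) : ∃ C, ∀ x, |Γ.valuation G x| ≤ C := by
  obtain ⟨a, ha⟩ := Γ.exists_valuation_eq hG hb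
  obtain ⟨C, hC⟩ := Γ.exists_abs_fullIntegral_le hb
  refine ⟨|a| * C, fun x => ?_⟩
  rw [ha, abs_mul]
  exact mul_le_mul_of_nonneg_left (hC x) (abs_nonneg a)

theorem measurable_renormalisedValuation (Γ : FeynmanDiagram Λ) (hG : Measurable G)
    (hb : ∃ C, ∀ x, |G x| ≤ C) : Measurable (Γ.renormalisedValuation G) := by
  rw [show Γ.renormalisedValuation G = _ from funext fun x => renormalisedValuation_eq Γ x]
  refine Finset.measurable_sum _ fun F _ => Measurable.const_mul (Measurable.mul ?_ ?_) _
  · exact Finset.measurable_prod _ fun γ _ => measurable_valuation _ hG hb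
  · exact measurable_valuation _ hG hb

theorem exists_abs_renormalisedValuation_le (Γ : FeynmanDiagram Λ) (hG : Measurable G)
    (hb : ∃ C, ∀ x, |G x| ≤ C) : ∃ C, ∀ x, |Γ.renormalisedValuation G x| ≤ C := by
  classical
  choose C hC using fun Γ : FeynmanDiagram Λ => exists_abs_valuation_le Γ hG hb
  refine ⟨∑ F : Finset Γ.Subdiagram with IsForest F, ((∏ γ ∈ F,
        C (γ.toDiagram.contract (γ.restrict '' children F γ))) *
          C (Γ.contract (roots F))), fun x => ?_⟩
  rw [renormalisedValuation_eq]
  refine (Finset.abs_sum_le_sum_abs _ _).trans ?_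
  refine Finset.sum_le_sum fun F _ => ?_
  rw [abs_mul, abs_pow, abs_neg, abs_one, one_pow, one_mul, abs_mul, Finset.abs_prod]
  refine mul_le_mul (Finset.prod_le_prod (fun _ _ => abs_nonneg _) fun γ _ => hC _ x) (hC _ x)
    (abs_nonneg _) (Finset.prod_nonneg fun γ _ => (abs_nonneg _).trans (hC _ x))

end FeynmanDiagram

namespace FeynmanDiagram

/-! ### Gluing diagrams along leaves -/

/-- The diagram `Γ` is obtained from the diagrams `Δ i` by turning their leaves with labels in
`U i` into internal vertices, indexed by `O`, and by identifying those leaves that have the same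
image in `O`. The leaves with labels in `Λ'` remain leaves. -/
structure Gluing {Λ Λ' K O : Type} {U : K → Type} (Γ : FeynmanDiagram Λ)
    (Δ : ∀ i, FeynmanDiagram (Λ' ⊕ U i)) (lab : K → Λ' → Λ) (slot : ∀ i, U i → O) where
  vert : ∀ i, (Δ i).V → Γ.V
  edge : (Σ i, (Δ i).E) ≃ Γ.E
  node : O → Γ.V
  retract : Γ.V → Option (O ⊕ Σ i, (Δ i).V)
  src_edge : ∀ i e, Γ.src (edge ⟨i, e⟩) = vert i ((Δ i).src e)
  tgt_edge : ∀ i e, Γ.tgt (edge ⟨i, e⟩) = vert i ((Δ i).tgt e)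
  vert_slot : ∀ i v u, (Δ i).label v = some (Sum.inr u) → vert i v = node (slot i u)
  label_leaf : ∀ i v l, (Δ i).label v = some (Sum.inl l) → Γ.label (vert i v) = some (lab i l)
  label_internal : ∀ i v, (Δ i).label v = none → Γ.label (vert i v) = none
  label_node : ∀ o, Γ.label (node o) = none
  retract_node : ∀ o, retract (node o) = some (Sum.inl o)
  retract_vert : ∀ i v, (Δ i).label v = none → retract (vert i v) = some (Sum.inr ⟨i, v⟩)
  exists_of_internal : ∀ v, Γ.label v = none →
    (∃ o, v = node o) ∨ ∃ i w, (Δ i).label w = none ∧ v = vert i w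

namespace Gluing

variable {Λ Λ' K O : Type} {U : K → Type} {Γ : FeynmanDiagram Λ}
  {Δ : ∀ i, FeynmanDiagram (Λ' ⊕ U i)} {lab : K → Λ' → Λ} {slot : ∀ i, U i → O}
  (g : Gluing Γ Δ lab slot)

/-- The field `retract` is a left inverse of `node` and of `vert` on internal vertices. It turns
injectivity for vertices of a quotient diagram into the construction of a map out of the quotient.
-/
theorem sigma_eq_of_vert_eq {i j : K} {v : (Δ i).V} {w : (Δ j).V}
    (hv : (Δ i).label v = none) (h : g.vert i v = g.vert j w) :
    (⟨i, v⟩ : Σ i, (Δ i).V) = ⟨j, w⟩ := by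
  have h1 := g.label_internal i v hv
  have h2 := g.retract_vert i v hv
  rcases hw : (Δ j).label w with _ | l | u
  · have h3 := g.retract_vert j w hw
    rw [← h, h2] at h3
    simpa using h3
  · rw [h, g.label_leaf j w l hw] at h1
    simp at h1
  · rw [h, g.vert_slot j w u hw, g.retract_node] at h2
    simp at h2

theorem eq_of_vert_eq {i : K} {v w : (Δ i).V} (hv : (Δ i).label v = none)
    (h : g.vert i v = g.vert i w) : v = w := by
  simpa using g.sigma_eq_of_vert_eq hv h

theorem edge_injective (i : K) : Function.Injective fun e => g.edge ⟨i, e⟩ := fun e e' h => by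
  simpa using g.edge.injective h

/-- The integration variables of `Γ` split into the glued vertices and the private internal vertices
of the pieces, the splitting that `integral_glue` requires. -/
theorem internal_bijective : Function.Bijective
    (Sum.elim (fun o => (⟨g.node o, g.label_node o⟩ : Γ.Internal))
      fun s : (Σ i, (Δ i).Internal) => ⟨g.vert s.1 s.2.1, g.label_internal _ _ s.2.2⟩) := by
  constructor
  · rintro (o | ⟨i, v, hv⟩) (o' | ⟨j, w, hw⟩) h
    · have h1 := g.retract_node o
      rw [show g.node o = g.node o' from congrArg Subtype.val h, g.retract_node] at h1
      simpa using h1.symm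
    · have h1 := g.retract_node o
      rw [show g.node o = g.vert j w from congrArg Subtype.val h, g.retract_vert j w hw] at h1
      simp at h1
    · have h1 := g.retract_node o'
      rw [← show g.vert i v = g.node o' from congrArg Subtype.val h, g.retract_vert i v hv] at h1
      simp at h1
    · have h1 := g.sigma_eq_of_vert_eq hv (congrArg Subtype.val h)
      cases h1
      rfl
  · rintro ⟨v, hv⟩
    rcases g.exists_of_internal v hv with ⟨o, rfl⟩ | ⟨i, w, hw, rfl⟩
    · exact ⟨Sum.inl o, rfl⟩
    · exact ⟨Sum.inr ⟨i, w, hw⟩, rfl⟩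

/-- The full integral of a glued diagram. -/
theorem fullIntegral_eq (g : Gluing Γ Δ lab slot) [Fintype K] [Fintype O] {G : T4 → ℝ} (hG : Measurable G)
    (hb : ∃ C, ∀ x, |G x| ≤ C) (x : Λ → T4) :
    Γ.fullIntegral G x = ∫ z : O → T4, ∏ i, (Δ i).fullIntegral G
      (Sum.elim (fun l => x (lab i l)) fun u => z (slot i u)) := by
  let e : O ⊕ (Σ i, (Δ i).Internal) ≃ Γ.Internal := Equiv.ofBijective _ g.internal_bijective
  have hg := integral_glue e (fun i (z : O → T4) w => (Δ i).kernel G ((Δ i).assign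
      (Sum.elim (fun l => x (lab i l)) fun u => z (slot i u)) w)) ?_ ?_
  · unfold fullIntegral
    rw [← hg]
    congr 1
    funext w
    have hv : ∀ i (v : (Δ i).V), Γ.assign x w (g.vert i v) = (Δ i).assign
        (Sum.elim (fun l => x (lab i l)) fun u => w (e (Sum.inl (slot i u))))
        (fun j => w (e (Sum.inr ⟨i, j⟩))) v := by
      intro i v
      rcases h : (Δ i).label v with _ | l | u
      · rw [(Δ i).assign_of_none h, Γ.assign_of_none (g.label_internal i v h)]
        rfl
      · rw [(Δ i).assign_of_some h, Γ.assign_of_some (g.label_leaf i v l h)]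
        rfl
      · have h1 := g.vert_slot i v u h
        rw [(Δ i).assign_of_some h, h1, Γ.assign_of_none (g.label_node _)]
        rfl
    unfold kernel
    rw [← g.edge.prod_comp, Fintype.prod_sigma]
    refine Finset.prod_congr rfl fun i _ => Finset.prod_congr rfl fun e _ => ?_
    rw [g.src_edge, g.tgt_edge, hv, hv]
  · intro i
    refine ((Δ i).measurable_kernel hG).comp ((Δ i).measurable_assign.comp
      (Measurable.prodMk (measurable_pi_lambda _ fun l => ?_) measurable_snd))
    rcases l with l | u
    · exact measurable_const
    · exact (measurable_pi_apply _).comp measurable_fst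
  · intro i
    obtain ⟨C, hC⟩ := hb
    exact ⟨_, fun z w => (Δ i).abs_kernel_le hC _⟩

/-- The image of a subdiagram of `Δ i` in `Γ`. -/
def push (i : K) (δ : (Δ i).Subdiagram) : Γ.Subdiagram where
  verts := g.vert i '' δ.verts
  edges := (fun e => g.edge ⟨i, e⟩) '' δ.edges
  internal := by
    rintro _ ⟨v, hv, rfl⟩
    exact g.label_internal i v (δ.internal v hv)
  src_mem := by
    rintro _ ⟨e, he, rfl⟩
    exact ⟨_, δ.src_mem e he, (g.src_edge i e).symm⟩
  tgt_mem := by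
    rintro _ ⟨e, he, rfl⟩
    exact ⟨_, δ.tgt_mem e he, (g.tgt_edge i e).symm⟩

theorem vert_mem_push_iff {i : K} {v : (Δ i).V} (hv : (Δ i).label v = none)
    (δ : (Δ i).Subdiagram) : g.vert i v ∈ (g.push i δ).verts ↔ v ∈ δ.verts := by
  constructor
  · rintro ⟨w, hw, h⟩
    rwa [g.eq_of_vert_eq hv h.symm]
  · exact fun h => ⟨v, h, rfl⟩

theorem edge_mem_push_iff {i : K} {e : (Δ i).E} (δ : (Δ i).Subdiagram) :
    g.edge ⟨i, e⟩ ∈ (g.push i δ).edges ↔ e ∈ δ.edges := by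
  constructor
  · rintro ⟨e', he', h⟩
    rwa [← g.edge_injective i h]
  · exact fun h => ⟨e, h, rfl⟩

theorem index_eq_of_edge_mem_push {i j : K} {e : (Δ i).E} {δ : (Δ j).Subdiagram}
    (h : g.edge ⟨i, e⟩ ∈ (g.push j δ).edges) : i = j := by
  obtain ⟨e', -, h⟩ := h
  exact (congrArg Sigma.fst (g.edge.injective h)).symm

theorem push_le_push_iff {i : K} {δ δ' : (Δ i).Subdiagram} :
    g.push i δ ≤ g.push i δ' ↔ δ ≤ δ' := by
  constructor
  · rintro ⟨h1, h2⟩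
    exact ⟨fun v hv => (g.vert_mem_push_iff (δ.internal v hv) δ').1 (h1 ⟨v, hv, rfl⟩),
      fun e he => (g.edge_mem_push_iff δ').1 (h2 ⟨e, he, rfl⟩)⟩
  · rintro ⟨h1, h2⟩
    exact ⟨image_mono h1, image_mono h2⟩

theorem index_eq_of_not_disjoint {i j : K} {δ : (Δ i).Subdiagram} {δ' : (Δ j).Subdiagram}
    (h : ¬ Disjoint (g.push i δ).verts (g.push j δ').verts) : i = j := by
  rw [Set.not_disjoint_iff] at h
  obtain ⟨_, ⟨v, hv, rfl⟩, ⟨w, hw, h⟩⟩ := h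
  exact congrArg Sigma.fst (g.sigma_eq_of_vert_eq (δ.internal v hv) h.symm)

theorem index_eq_of_push_le {i j : K} {δ : (Δ i).Subdiagram} {δ' : (Δ j).Subdiagram}
    (hδ : δ.verts.Nonempty) (h : g.push i δ ≤ g.push j δ') : i = j := by
  refine g.index_eq_of_not_disjoint (δ := δ) (δ' := δ') ?_
  obtain ⟨v, hv⟩ := hδ
  exact Set.not_disjoint_iff.2 ⟨_, ⟨v, hv, rfl⟩, h.1 ⟨v, hv, rfl⟩⟩

/-- Nonemptiness matters: the empty subdiagrams of all pieces have the same image. Divergent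
subdiagrams are connected, hence nonempty. -/
theorem sigma_eq_of_push_eq {i j : K} {δ : (Δ i).Subdiagram} {δ' : (Δ j).Subdiagram}
    (hδ : δ.verts.Nonempty) (h : g.push i δ = g.push j δ') :
    (⟨i, δ⟩ : Σ i, (Δ i).Subdiagram) = ⟨j, δ'⟩ := by
  obtain rfl := g.index_eq_of_push_le hδ h.le
  rw [le_antisymm (g.push_le_push_iff.1 h.le) (g.push_le_push_iff.1 h.ge)]

theorem disjoint_push_iff {i : K} {δ δ' : (Δ i).Subdiagram} :
    Disjoint (g.push i δ).verts (g.push i δ').verts ↔ Disjoint δ.verts δ'.verts := by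
  simp only [Set.disjoint_left]
  constructor
  · intro h v hv hv'
    exact h ⟨v, hv, rfl⟩ ⟨v, hv', rfl⟩
  · rintro h _ ⟨v, hv, rfl⟩ hv'
    exact h hv ((g.vert_mem_push_iff (δ.internal v hv) δ').1 hv')

theorem injOn_vert {i : K} (δ : (Δ i).Subdiagram) : InjOn (g.vert i) δ.verts :=
  fun _ hv _ _ h => g.eq_of_vert_eq (δ.internal _ hv) h

/-- The vertices of a subdiagram and of its image. -/
noncomputable def pushVerts {i : K} (δ : (Δ i).Subdiagram) :
    δ.toDiagram.V ≃ (g.push i δ).toDiagram.V :=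
  Equiv.Set.imageOfInjOn (g.vert i) δ.verts (g.injOn_vert δ)

/-- The edges of a subdiagram and of its image. -/
noncomputable def pushEdges {i : K} (δ : (Δ i).Subdiagram) :
    δ.toDiagram.E ≃ (g.push i δ).toDiagram.E :=
  Equiv.Set.imageOfInjOn (fun e => g.edge ⟨i, e⟩) δ.edges (g.edge_injective i).injOn

theorem src_pushEdges {i : K} (δ : (Δ i).Subdiagram) (e : δ.toDiagram.E) :
    (g.push i δ).toDiagram.src (g.pushEdges δ e) = g.pushVerts δ (δ.toDiagram.src e) :=
  Subtype.ext (g.src_edge i e.1)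

theorem tgt_pushEdges {i : K} (δ : (Δ i).Subdiagram) (e : δ.toDiagram.E) :
    (g.push i δ).toDiagram.tgt (g.pushEdges δ e) = g.pushVerts δ (δ.toDiagram.tgt e) :=
  Subtype.ext (g.tgt_edge i e.1)

end Gluing

theorem connected_iff_of_equiv {Λ Λ' : Type} {Γ : FeynmanDiagram Λ} {Γ' : FeynmanDiagram Λ'}
    (fV : Γ.V ≃ Γ'.V) (fE : Γ.E ≃ Γ'.E) (hs : ∀ e, Γ'.src (fE e) = fV (Γ.src e))
    (ht : ∀ e, Γ'.tgt (fE e) = fV (Γ.tgt e)) : Γ.Connected ↔ Γ'.Connected := by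
  have hadj : ∀ v w, Γ.Adj v w ↔ Γ'.Adj (fV v) (fV w) := by
    intro v w
    constructor
    · rintro ⟨e, rfl, rfl⟩
      exact ⟨fE e, hs e, ht e⟩
    · rintro ⟨e', h1, h2⟩
      obtain ⟨e, rfl⟩ := fE.surjective e'
      exact ⟨e, fV.injective ((hs e).symm.trans h1), fV.injective ((ht e).symm.trans h2)⟩
  constructor
  · rintro ⟨h1, h2⟩
    refine ⟨h1.map fV, fun v w => ?_⟩
    have := h2 (fV.symm v) (fV.symm w)
    have h3 : ∀ a b, Relation.EqvGen Γ.Adj a b → Relation.EqvGen Γ'.Adj (fV a) (fV b) := by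
      intro a b h
      induction h with
      | rel a b h => exact .rel _ _ ((hadj a b).1 h)
      | refl a => exact .refl _
      | symm a b _ ih => exact ih.symm
      | trans a b c _ _ ih₁ ih₂ => exact ih₁.trans _ _ _ ih₂
    simpa using h3 _ _ this
  · rintro ⟨h1, h2⟩
    refine ⟨h1.map fV.symm, fun v w => ?_⟩
    have h3 : ∀ a b, Relation.EqvGen Γ'.Adj a b →
        Relation.EqvGen Γ.Adj (fV.symm a) (fV.symm b) := by
      intro a b h
      induction h with
      | rel a b h => exact .rel _ _ ((hadj _ _).2 (by simpa using h))
      | refl a => exact .refl _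
      | symm a b _ ih => exact ih.symm
      | trans a b c _ _ ih₁ ih₂ => exact ih₁.trans _ _ _ ih₂
    simpa using h3 _ _ (h2 (fV v) (fV w))

theorem Subdiagram.Divergent.nonempty {Λ : Type} {Γ : FeynmanDiagram Λ} {γ : Γ.Subdiagram}
    (h : γ.Divergent) : γ.verts.Nonempty :=
  let ⟨v⟩ := h.1.1
  ⟨v.1, v.2⟩

/-! ### Divergence and contraction under gluing -/

namespace Gluing

variable {Λ Λ' K O : Type} {U : K → Type} {Γ : FeynmanDiagram Λ}
  {Δ : ∀ i, FeynmanDiagram (Λ' ⊕ U i)} {lab : K → Λ' → Λ} {slot : ∀ i, U i → O}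
  (g : Gluing Γ Δ lab slot)

/-- Vertices, edges and adjacency are carried over bijectively. For fullness, an edge of `Γ`
parallel to an edge of the image ends at internal vertices of the piece `i`, hence comes from that
piece. -/
theorem push_divergent_iff {i : K} {δ : (Δ i).Subdiagram} :
    (g.push i δ).Divergent ↔ δ.Divergent := by
  unfold Subdiagram.Divergent
  refine and_congr (connected_iff_of_equiv (g.pushVerts δ) (g.pushEdges δ) (g.src_pushEdges δ)
    (g.tgt_pushEdges δ)).symm (and_congr ⟨?_, ?_⟩ ?_)
  · intro h e he e' h1 h2
    refine (g.edge_mem_push_iff δ).1 (h (g.edge ⟨i, e⟩) ⟨e, he, rfl⟩ _ ?_ ?_)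
    · rw [g.src_edge, g.src_edge, h1]
    · rw [g.tgt_edge, g.tgt_edge, h2]
  · rintro h _ ⟨e, he, rfl⟩ e'' h1 h2
    obtain ⟨⟨j, e'⟩, rfl⟩ := g.edge.surjective e''
    simp only [g.src_edge, g.tgt_edge] at h1 h2
    have h3 := g.sigma_eq_of_vert_eq (δ.internal _ (δ.src_mem e he)) h1.symm
    have h4 := g.sigma_eq_of_vert_eq (δ.internal _ (δ.tgt_mem e he)) h2.symm
    obtain rfl : i = j := congrArg Sigma.fst h3
    refine (g.edge_mem_push_iff δ).2 (h e he e' ?_ ?_)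
    · simpa using h3.symm
    · simpa using h4.symm
  · have h1 : (g.push i δ).verts.ncard = δ.verts.ncard := (g.injOn_vert δ).ncard_image
    have h2 : (g.push i δ).edges.ncard = δ.edges.ncard :=
      ncard_image_of_injective _ (g.edge_injective i)
    rw [Subdiagram.deg, Subdiagram.deg, h1, h2]

/-- Contraction of subdiagrams is compatible with gluing. -/
noncomputable def contract (S : ∀ i, Set (Δ i).Subdiagram) :
    Gluing (Γ.contract {γ | ∃ i, ∃ δ ∈ S i, g.push i δ = γ}) (fun i => (Δ i).contract (S i))
      lab slot where
  vert i := Quot.map (g.vert i) (by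
    rintro v w ⟨δ, hδ, hv, hw⟩
    exact ⟨g.push i δ, ⟨i, δ, hδ, rfl⟩, ⟨v, hv, rfl⟩, ⟨w, hw, rfl⟩⟩)
  edge := Equiv.ofBijective
    (fun s => (⟨g.edge ⟨s.1, s.2.1⟩, by
        rintro _ ⟨j, δ, hδ, rfl⟩ h
        obtain ⟨i, e, he⟩ := s
        obtain rfl := g.index_eq_of_edge_mem_push h
        exact he δ hδ ((g.edge_mem_push_iff δ).1 h)⟩ :
          (Γ.contract {γ | ∃ i, ∃ δ ∈ S i, g.push i δ = γ}).E)) (by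
      constructor
      · rintro ⟨i, e, he⟩ ⟨j, e', he'⟩ h
        have h1 := g.edge.injective (congrArg Subtype.val h)
        cases h1
        rfl
      · rintro ⟨e, he⟩
        obtain ⟨⟨i, e⟩, rfl⟩ := g.edge.surjective e
        exact ⟨⟨i, e, fun δ hδ h => he _ ⟨i, δ, hδ, rfl⟩ ((g.edge_mem_push_iff δ).2 h)⟩, rfl⟩)
  node o := Quot.mk _ (g.node o)
  retract := Quot.lift (fun v => (g.retract v).map
      (Sum.map id fun s => (⟨s.1, Quot.mk _ s.2⟩ : Σ i, ((Δ i).contract (S i)).V))) (by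
    rintro _ _ ⟨_, ⟨i, δ, hδ, rfl⟩, ⟨v, hv, rfl⟩, ⟨w, hw, rfl⟩⟩
    rw [g.retract_vert i v (δ.internal v hv), g.retract_vert i w (δ.internal w hw)]
    simp only [Option.map_some, Sum.map_inr]
    rw [show (Quot.mk _ v : ((Δ i).contract (S i)).V) = Quot.mk _ w from
      Quot.sound ⟨δ, hδ, hv, hw⟩])
  src_edge i e := congrArg (Quot.mk _) (g.src_edge i e.1)
  tgt_edge i e := congrArg (Quot.mk _) (g.tgt_edge i e.1)
  vert_slot i := by
    rintro ⟨v⟩ u h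
    exact congrArg (Quot.mk _) (g.vert_slot i v u h)
  label_leaf i := by
    rintro ⟨v⟩ l h
    exact g.label_leaf i v l h
  label_internal i := by
    rintro ⟨v⟩ h
    exact g.label_internal i v h
  label_node o := g.label_node o
  retract_node o := by
    change (g.retract (g.node o)).map _ = _
    rw [g.retract_node]
    rfl
  retract_vert i := by
    rintro ⟨v⟩ h
    change (g.retract (g.vert i v)).map _ = _
    rw [g.retract_vert i v h]
    rfl
  exists_of_internal := by
    rintro ⟨v⟩ h
    rcases g.exists_of_internal v h with ⟨o, rfl⟩ | ⟨i, w, hw, rfl⟩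
    · exact Or.inl ⟨o, rfl⟩
    · exact Or.inr ⟨i, Quot.mk _ w, hw, rfl⟩

/-- Contractions inside a subdiagram and inside its image have the same full integral. -/
theorem fullIntegral_push_contract {i : K} (δ : (Δ i).Subdiagram) (C : Set (Δ i).Subdiagram)
    {G : T4 → ℝ} (x : Λ → T4) (x' : Λ' ⊕ U i → T4) :
    (δ.toDiagram.contract (δ.restrict '' C)).fullIntegral G x' =
      ((g.push i δ).toDiagram.contract ((g.push i δ).restrict '' (g.push i '' C))).fullIntegral
        G x := by
  have hV : ∀ v w : δ.toDiagram.V,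
      (∃ γ ∈ δ.restrict '' C, v ∈ γ.verts ∧ w ∈ γ.verts) ↔
      ∃ γ ∈ (g.push i δ).restrict '' (g.push i '' C),
        g.pushVerts δ v ∈ γ.verts ∧ g.pushVerts δ w ∈ γ.verts := by
    rintro ⟨v, hv⟩ ⟨w, hw⟩
    constructor
    · rintro ⟨_, ⟨ρ, hρ, rfl⟩, h1, h2⟩
      exact ⟨_, ⟨_, ⟨ρ, hρ, rfl⟩, rfl⟩, ⟨v, h1, rfl⟩, ⟨w, h2, rfl⟩⟩
    · rintro ⟨_, ⟨_, ⟨ρ, hρ, rfl⟩, rfl⟩, h1, h2⟩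
      exact ⟨_, ⟨ρ, hρ, rfl⟩, (g.vert_mem_push_iff (δ.internal v hv) ρ).1 h1,
        (g.vert_mem_push_iff (δ.internal w hw) ρ).1 h2⟩
  have hE : ∀ e : δ.toDiagram.E, (∀ γ ∈ δ.restrict '' C, e ∉ γ.edges) ↔
      ∀ γ ∈ (g.push i δ).restrict '' (g.push i '' C), g.pushEdges δ e ∉ γ.edges := by
    rintro ⟨e, he⟩
    constructor
    · rintro h _ ⟨_, ⟨ρ, hρ, rfl⟩, rfl⟩ h1
      exact h _ ⟨ρ, hρ, rfl⟩ ((g.edge_mem_push_iff ρ).1 h1)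
    · rintro h _ ⟨ρ, hρ, rfl⟩ h1
      exact h _ ⟨_, ⟨ρ, hρ, rfl⟩, rfl⟩ ((g.edge_mem_push_iff ρ).2 h1)
  refine fullIntegral_eq_of_equiv (Quot.congr (g.pushVerts δ) hV)
    ((g.pushEdges δ).subtypeEquiv hE) ?_ ?_ ?_ ?_ x' x
  · exact fun e => congrArg (Quot.mk _) (g.src_pushEdges δ e.1)
  · exact fun e => congrArg (Quot.mk _) (g.tgt_pushEdges δ e.1)
  · rintro ⟨v⟩
    rfl
  · rintro ⟨v⟩
    rfl

end Gluing

end FeynmanDiagram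

namespace FeynmanDiagram

namespace Gluing

/-! ### Forests of a glued diagram -/

variable {Λ Λ' K O : Type} {U : K → Type} {Γ : FeynmanDiagram Λ}
  {Δ : ∀ i, FeynmanDiagram (Λ' ⊕ U i)} {lab : K → Λ' → Λ} {slot : ∀ i, U i → O}
  (g : Gluing Γ Δ lab slot)

theorem push_lt_push_iff {i : K} {δ δ' : (Δ i).Subdiagram} :
    g.push i δ < g.push i δ' ↔ δ < δ' := by
  simp only [lt_iff_le_not_ge, g.push_le_push_iff]

variable [Fintype K]

open Classical in
/-- The union of the images of finite sets of subdiagrams of the `Δ i`. -/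
noncomputable def pushForest (F : ∀ i, Finset (Δ i).Subdiagram) : Finset Γ.Subdiagram :=
  (Finset.univ.sigma F).image fun s => g.push s.1 s.2

theorem mem_pushForest {F : ∀ i, Finset (Δ i).Subdiagram} {γ : Γ.Subdiagram} :
    γ ∈ g.pushForest F ↔ ∃ i, ∃ δ ∈ F i, g.push i δ = γ := by
  simp [pushForest]

variable {F : ∀ i, Finset (Δ i).Subdiagram}

theorem push_mem_pushForest_iff {i : K} {δ : (Δ i).Subdiagram} (hδ : δ.verts.Nonempty) :
    g.push i δ ∈ g.pushForest F ↔ δ ∈ F i := by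
  rw [mem_pushForest]
  constructor
  · rintro ⟨j, δ', h, h'⟩
    have := g.sigma_eq_of_push_eq hδ h'.symm
    cases this
    exact h
  · exact fun h => ⟨i, δ, h, rfl⟩

/-- Images from different pieces are vertex-disjoint, so they impose no condition on each other. -/
theorem isForest_pushForest_iff : IsForest (g.pushForest F) ↔ ∀ i, IsForest (F i) := by
  constructor
  · rintro ⟨h1, h2⟩ i
    refine ⟨fun δ hδ => g.push_divergent_iff.1 (h1 _ (g.mem_pushForest.2 ⟨i, δ, hδ, rfl⟩)),
      fun δ hδ δ' hδ' => ?_⟩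
    have := h2 _ (g.mem_pushForest.2 ⟨i, δ, hδ, rfl⟩) _ (g.mem_pushForest.2 ⟨i, δ', hδ', rfl⟩)
    simpa only [g.push_le_push_iff, g.disjoint_push_iff] using this
  · intro h
    refine ⟨fun γ hγ => ?_, fun γ₁ hγ₁ γ₂ hγ₂ => ?_⟩
    · obtain ⟨i, δ, hδ, rfl⟩ := g.mem_pushForest.1 hγ
      exact g.push_divergent_iff.2 ((h i).1 δ hδ)
    · obtain ⟨i, δ, hδ, rfl⟩ := g.mem_pushForest.1 hγ₁
      obtain ⟨j, δ', hδ', rfl⟩ := g.mem_pushForest.1 hγ₂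
      by_cases hd : Disjoint (g.push i δ).verts (g.push j δ').verts
      · exact Or.inr (Or.inr hd)
      · obtain rfl := g.index_eq_of_not_disjoint hd
        simpa only [g.push_le_push_iff, g.disjoint_push_iff] using (h i).2 δ hδ δ' hδ'

theorem roots_pushForest (hF : ∀ i, ∀ δ ∈ F i, δ.verts.Nonempty) :
    roots (g.pushForest F) = {γ | ∃ i, ∃ δ ∈ roots (F i), g.push i δ = γ} := by
  ext γ
  constructor
  · rintro ⟨h1, h2⟩
    obtain ⟨i, δ, hδ, rfl⟩ := g.mem_pushForest.1 h1
    refine ⟨i, δ, ⟨hδ, fun δ' hδ' h => ?_⟩, rfl⟩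
    exact g.push_le_push_iff.1
      (h2 (g.mem_pushForest.2 ⟨i, δ', hδ', rfl⟩) (g.push_le_push_iff.2 h))
  · rintro ⟨i, δ, ⟨h1, h2⟩, rfl⟩
    refine ⟨g.mem_pushForest.2 ⟨i, δ, h1, rfl⟩, fun γ' hγ' h => ?_⟩
    obtain ⟨j, δ', hδ', rfl⟩ := g.mem_pushForest.1 hγ'
    obtain rfl := g.index_eq_of_push_le (hF i δ h1) h
    exact g.push_le_push_iff.2 (h2 hδ' (g.push_le_push_iff.1 h))

theorem children_pushForest (hF : ∀ i, ∀ δ ∈ F i, δ.verts.Nonempty) {i : K}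
    (δ : (Δ i).Subdiagram) :
    children (g.pushForest F) (g.push i δ) = g.push i '' children (F i) δ := by
  ext γ
  constructor
  · rintro ⟨⟨h1, h3⟩, h2⟩
    obtain ⟨j, δ', hδ', rfl⟩ := g.mem_pushForest.1 h1
    obtain rfl := g.index_eq_of_push_le (hF j δ' hδ') h3.le
    refine ⟨δ', ⟨⟨hδ', g.push_lt_push_iff.1 h3⟩, fun δ'' hδ'' h => ?_⟩, rfl⟩
    exact g.push_le_push_iff.1 (h2 ⟨g.mem_pushForest.2 ⟨_, δ'', hδ''.1, rfl⟩,
      g.push_lt_push_iff.2 hδ''.2⟩ (g.push_le_push_iff.2 h))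
  · rintro ⟨δ', ⟨⟨h1, h3⟩, h2⟩, rfl⟩
    refine ⟨⟨g.mem_pushForest.2 ⟨i, δ', h1, rfl⟩, g.push_lt_push_iff.2 h3⟩, ?_⟩
    rintro γ'' ⟨h4, h5⟩ h
    obtain ⟨j, δ'', hδ'', rfl⟩ := g.mem_pushForest.1 h4
    obtain rfl := g.index_eq_of_push_le (hF j δ'' hδ'') h5.le
    exact g.push_le_push_iff.2 (h2 ⟨hδ'', g.push_lt_push_iff.1 h5⟩ (g.push_le_push_iff.1 h))

theorem injOn_push (hF : ∀ i, ∀ δ ∈ F i, δ.verts.Nonempty) :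
    InjOn (fun s : Σ i, (Δ i).Subdiagram => g.push s.1 s.2)
      (Finset.univ.sigma F : Finset (Σ i, (Δ i).Subdiagram)) := by
  rintro ⟨i, δ⟩ h ⟨j, δ'⟩ - h'
  exact g.sigma_eq_of_push_eq (hF i δ (by simpa using h)) h'

theorem card_pushForest (hF : ∀ i, ∀ δ ∈ F i, δ.verts.Nonempty) :
    (g.pushForest F).card = ∑ i, (F i).card := by
  classical
  rw [pushForest, Finset.card_image_of_injOn (g.injOn_push hF), Finset.card_sigma]

theorem prod_pushForest (hF : ∀ i, ∀ δ ∈ F i, δ.verts.Nonempty) (f : Γ.Subdiagram → ℝ) :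
    ∏ γ ∈ g.pushForest F, f γ = ∏ i, ∏ δ ∈ F i, f (g.push i δ) := by
  classical
  rw [pushForest, Finset.prod_image (g.injOn_push hF), Finset.prod_sigma]

-- Under `hloc` a forest is recovered from its preimages in the pieces; nonemptiness of divergent
-- subdiagrams makes these preimages unique.
open Classical in
theorem sum_isForest_eq (hloc : ∀ γ : Γ.Subdiagram, γ.Divergent → ∃ i δ, g.push i δ = γ)
    (f : Finset Γ.Subdiagram → ℝ) :
    ∑ H : Finset Γ.Subdiagram with IsForest H, f H =
      ∑ F ∈ Fintype.piFinset fun i =>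
        (Finset.univ.filter IsForest : Finset (Finset (Δ i).Subdiagram)),
        f (g.pushForest F) := by
  symm
  refine Finset.sum_bij (fun F _ => g.pushForest F) ?_ ?_ ?_ fun _ _ => rfl
  · intro F hF
    simp only [Fintype.mem_piFinset, Finset.mem_filter, Finset.mem_univ, true_and] at hF ⊢
    exact g.isForest_pushForest_iff.2 hF
  · intro F hF F' hF' h
    simp only [Fintype.mem_piFinset, Finset.mem_filter, Finset.mem_univ, true_and] at hF hF'
    funext i
    ext δ
    constructor
    · intro hδ
      have hn := ((hF i).1 δ hδ).nonempty
      rw [← g.push_mem_pushForest_iff hn, ← h, g.push_mem_pushForest_iff hn]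
      exact hδ
    · intro hδ
      have hn := ((hF' i).1 δ hδ).nonempty
      rw [← g.push_mem_pushForest_iff hn, h, g.push_mem_pushForest_iff hn]
      exact hδ
  · intro H hH
    simp only [Finset.mem_filter, Finset.mem_univ, true_and] at hH
    have h : g.pushForest (fun i => Finset.univ.filter fun δ => g.push i δ ∈ H) = H := by
      ext γ
      rw [mem_pushForest]
      constructor
      · rintro ⟨i, δ, hδ, rfl⟩
        simpa using hδ
      · intro hγ
        obtain ⟨i, δ, rfl⟩ := hloc γ (hH.1 γ hγ)
        exact ⟨i, δ, by simpa using hγ, rfl⟩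
    refine ⟨_, ?_, h⟩
    simp only [Fintype.mem_piFinset, Finset.mem_filter, Finset.mem_univ, true_and]
    rw [← h] at hH
    exact g.isForest_pushForest_iff.1 hH

/-- If every divergent subdiagram of a glued diagram comes from one of its pieces, then the
renormalised valuation is obtained from those of the pieces. -/
theorem renormalisedValuation_eq [Fintype O]
    (hloc : ∀ γ : Γ.Subdiagram, γ.Divergent → ∃ i δ, g.push i δ = γ)
    (hΓ : Γ.LeafConnected) (hΔ : ∀ i, (Δ i).LeafConnected)
    {G : T4 → ℝ} (hG : Measurable G) (hb : ∃ C, ∀ x, |G x| ≤ C) (x : Λ → T4) :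
    Γ.renormalisedValuation G x = ∫ z : O → T4, ∏ i, (Δ i).renormalisedValuation G
      (Sum.elim (fun l => x (lab i l)) fun u => z (slot i u)) := by
  classical
  simp only [FeynmanDiagram.renormalisedValuation_eq, Finset.prod_univ_sum]
  rw [g.sum_isForest_eq hloc, integral_finsetSum]
  · refine Finset.sum_congr rfl fun F hF => ?_
    simp only [Fintype.mem_piFinset, Finset.mem_filter, Finset.mem_univ, true_and] at hF
    have hn : ∀ i, ∀ δ ∈ F i, δ.verts.Nonempty := fun i δ hδ => ((hF i).1 δ hδ).nonempty
    -- Extracted diagrams have no leaves, so their values do not depend on the variables and can be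
    -- taken out of the integral over `z`.
    have hval : ∀ i, ∀ δ ∈ F i, ∀ x' : Λ' ⊕ U i → T4,
        (δ.toDiagram.contract (δ.restrict '' children (F i) δ)).valuation G x' =
        ((g.push i δ).toDiagram.contract ((g.push i δ).restrict ''
          children (g.pushForest F) (g.push i δ))).valuation G x := by
      intro i δ hδ x'
      have h1 := (hF i).1 δ hδ
      rw [(h1.1.contract _).valuation_eq (by rintro ⟨v⟩; rfl) hG hb,
        ((g.push_divergent_iff.2 h1).1.contract _).valuation_eq (by rintro ⟨v⟩; rfl) hG hb,
        g.children_pushForest hn, g.fullIntegral_push_contract δ _ x x']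
    -- Contraction keeps every vertex connected to a leaf, so these valuations are full integrals,
    -- which glue by Fubini.
    have hroot : (Γ.contract (roots (g.pushForest F))).valuation G x = ∫ z : O → T4,
        ∏ i, ((Δ i).contract (roots (F i))).valuation G
          (Sum.elim (fun l => x (lab i l)) fun u => z (slot i u)) := by
      rw [(hΓ.contract _).valuation_eq hG hb, g.roots_pushForest hn,
        (g.contract fun i => roots (F i)).fullIntegral_eq hG hb]
      simp_rw [((hΔ _).contract _).valuation_eq hG hb]
    rw [g.card_pushForest hn, g.prod_pushForest hn, hroot, ← mul_assoc, ← integral_const_mul]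
    congr 1
    funext z
    rw [Finset.prod_mul_distrib, Finset.prod_mul_distrib, Finset.prod_pow_eq_pow_sum, ← mul_assoc]
    congr 2
    exact Finset.prod_congr rfl fun i _ => Finset.prod_congr rfl fun δ hδ =>
      (hval i δ hδ _).symm
  · intro F _
    choose C hC using fun (i : K) (Γ' : FeynmanDiagram (Λ' ⊕ U i)) =>
      exists_abs_valuation_le Γ' hG hb
    have hm : ∀ i, Measurable fun z : O → T4 =>
        (Sum.elim (fun l => x (lab i l)) fun u => z (slot i u) : Λ' ⊕ U i → T4) := by
      intro i
      refine measurable_pi_lambda _ fun l => ?_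
      rcases l with l | u
      · exact measurable_const
      · exact measurable_pi_apply _
    refine Integrable.of_bound (C := ∏ i, ((∏ δ ∈ F i,
      C i (δ.toDiagram.contract (δ.restrict '' children (F i) δ))) *
          C i ((Δ i).contract (roots (F i))))) ?_ (Filter.Eventually.of_forall fun z => ?_)
    · refine (Finset.measurable_prod _ fun i _ => Measurable.const_mul (Measurable.mul ?_ ?_)
        _).aestronglyMeasurable
      · exact Finset.measurable_prod _ fun δ _ => (measurable_valuation _ hG hb).comp (hm i)
      · exact (measurable_valuation _ hG hb).comp (hm i)
    · rw [Real.norm_eq_abs, Finset.abs_prod]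
      refine Finset.prod_le_prod (fun i _ => abs_nonneg _) fun i _ => ?_
      rw [abs_mul, abs_pow, abs_neg, abs_one, one_pow, one_mul, abs_mul, Finset.abs_prod]
      exact mul_le_mul (Finset.prod_le_prod (fun _ _ => abs_nonneg _) fun γ _ => hC _ _ _)
        (hC _ _ _) (abs_nonneg _) (Finset.prod_nonneg fun γ _ => (abs_nonneg _).trans (hC _ _ fun _ => 0))

end Gluing

end FeynmanDiagram

/-! ### Complete pairings of a disjoint union -/

section Join

variable {K : Type} {S : K → Type} (κ : ∀ i, Pairing (S i))

/-- Unpaired elements of the pieces, as elements of the disjoint union. -/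
def unpairedIncl (p : Σ i, (κ i).Unpaired) : Σ i, S i := ⟨p.1, p.2.1⟩

theorem unpairedIncl_injective : Function.Injective (unpairedIncl κ) := by
  rintro ⟨i, u, hu⟩ ⟨j, v, hv⟩ h
  cases h
  rfl

variable (σ : ExternalPairing fun i => (κ i).Unpaired)

open Classical in
/-- The involution given by `κ i` on the paired elements of the piece `i`, and by `σ` on the
unpaired elements of all pieces. -/
noncomputable def joinFun (p : Σ i, S i) : Σ i, S i :=
  if h : (κ p.1).1 p.2 = p.2 then unpairedIncl κ (σ.1.1 ⟨p.1, p.2, h⟩) else ⟨p.1, (κ p.1).1 p.2⟩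

theorem joinFun_unpairedIncl (p : Σ i, (κ i).Unpaired) :
    joinFun κ σ (unpairedIncl κ p) = unpairedIncl κ (σ.1.1 p) :=
  dif_pos p.2.2

theorem joinFun_of_paired {i : K} {s : S i} (h : (κ i).1 s ≠ s) :
    joinFun κ σ ⟨i, s⟩ = ⟨i, (κ i).1 s⟩ :=
  dif_neg h

/-- An external pair changes the piece and an internal pair does not, so the internal pairings can
be read off the joined one. -/
theorem joinFun_fst_eq_iff {i : K} {s : S i} :
    (joinFun κ σ ⟨i, s⟩).1 = i ↔ (κ i).1 s ≠ s := by
  by_cases h : (κ i).1 s = s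
  · have := joinFun_unpairedIncl κ σ ⟨i, s, h⟩
    rw [show unpairedIncl κ ⟨i, s, h⟩ = ⟨i, s⟩ from rfl] at this
    simp only [this, h, ne_eq, not_true_eq_false, iff_false]
    exact σ.2 ⟨i, s, h⟩
  · simp [joinFun_of_paired κ σ h, h]

/-- The complete pairing made of internal pairings and of an external pairing. -/
noncomputable def join : CompletePairing (Σ i, S i) :=
  ⟨joinFun κ σ, by
    rintro ⟨i, s⟩
    by_cases h : (κ i).1 s = s
    · rw [show (⟨i, s⟩ : Σ i, S i) = unpairedIncl κ ⟨i, s, h⟩ from rfl, joinFun_unpairedIncl,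
        joinFun_unpairedIncl, σ.1.2.1]
    · rw [joinFun_of_paired κ σ h, joinFun_of_paired κ σ, (κ i).2]
      rw [(κ i).2]
      exact Ne.symm h, by
    rintro ⟨i, s⟩
    by_cases h : (κ i).1 s = s
    · rw [show (⟨i, s⟩ : Σ i, S i) = unpairedIncl κ ⟨i, s, h⟩ from rfl, joinFun_unpairedIncl]
      exact fun h' => σ.1.2.2 _ (unpairedIncl_injective κ h')
    · rw [joinFun_of_paired κ σ h]
      simpa using h⟩

theorem join_unpaired {i : K} (u : (κ i).Unpaired) :
    (join κ σ).1 ⟨i, u.1⟩ = ⟨(σ.1.1 ⟨i, u⟩).1, (σ.1.1 ⟨i, u⟩).2.1⟩ :=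
  joinFun_unpairedIncl κ σ ⟨i, u⟩

theorem join_of_paired {i : K} {s : S i} (h : (κ i).1 s ≠ s) :
    (join κ σ).1 ⟨i, s⟩ = ⟨i, (κ i).1 s⟩ :=
  joinFun_of_paired κ σ h

/-- Conversely, the pairs of a complete pairing with both ends in one piece form the internal
pairings, and the remaining pairs form the external one. -/
theorem join_bijective : Function.Bijective
    fun p : (Σ κ : ∀ i, Pairing (S i), ExternalPairing fun i => (κ i).Unpaired) =>
      join p.1 p.2 := by
  constructor
  · rintro ⟨κ, σ⟩ ⟨κ', σ'⟩ h
    have h1 : joinFun κ σ = joinFun κ' σ' := congrArg Subtype.val h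
    have h2 : κ = κ' := by
      funext i
      refine Subtype.ext (funext fun s => ?_)
      by_cases hs : (κ i).1 s = s
      · have h3 := (joinFun_fst_eq_iff κ σ (i := i) (s := s)).not.2 (not_not.2 hs)
        rw [h1, joinFun_fst_eq_iff κ' σ', not_not] at h3
        rw [hs, h3]
      · have h3 := (joinFun_fst_eq_iff κ σ (i := i) (s := s)).2 hs
        rw [h1, joinFun_fst_eq_iff κ' σ'] at h3
        have h4 := congrFun h1 ⟨i, s⟩
        rw [joinFun_of_paired κ σ hs, joinFun_of_paired κ' σ' h3] at h4
        simpa using h4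
    subst h2
    have h3 : σ = σ' := by
      refine Subtype.ext (Subtype.ext (funext fun p => unpairedIncl_injective κ ?_))
      rw [← joinFun_unpairedIncl, ← joinFun_unpairedIncl, h1]
    rw [h3]
  · rintro ⟨τ, hτ, hτ'⟩
    classical
    -- Follow `τ` while the partner stays in the piece `i`, and fix `s` otherwise; the fixed points
    -- are then the ends of external pairs.
    let f : ∀ i, S i → S i := fun i s =>
      if h : ∃ s', τ ⟨i, s⟩ = ⟨i, s'⟩ then h.choose else s
    have f1 : ∀ i s, (τ ⟨i, s⟩).1 = i → τ ⟨i, s⟩ = ⟨i, f i s⟩ := by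
      intro i s h
      have h' : ∃ s', τ ⟨i, s⟩ = ⟨i, s'⟩ := by
        rcases hp : τ ⟨i, s⟩ with ⟨j, s'⟩
        rw [hp] at h
        obtain rfl : j = i := h
        exact ⟨s', rfl⟩
      simp only [f, dif_pos h']
      exact h'.choose_spec
    have f2 : ∀ i s, (τ ⟨i, s⟩).1 ≠ i → f i s = s := by
      intro i s h
      refine dif_neg ?_
      rintro ⟨s', h'⟩
      rw [h'] at h
      exact h rfl
    have f3 : ∀ i s, f i s = s ↔ (τ ⟨i, s⟩).1 ≠ i := by
      intro i s
      refine ⟨fun h h' => hτ' ⟨i, s⟩ ?_, f2 i s⟩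
      rw [f1 i s h', h]
    let κ : ∀ i, Pairing (S i) := fun i => ⟨f i, by
      intro s
      by_cases h : (τ ⟨i, s⟩).1 = i
      · have h1 := f1 i s h
        have h2 : τ ⟨i, f i s⟩ = ⟨i, s⟩ := by rw [← h1, hτ]
        have h3 := f1 i (f i s) (by rw [h2])
        rw [h2] at h3
        simpa using h3.symm
      · rw [f2 i s h, f2 i s h]⟩
    have hσ : ∀ p : Σ i, (κ i).Unpaired, f (τ (unpairedIncl κ p)).1 (τ (unpairedIncl κ p)).2 =
        (τ (unpairedIncl κ p)).2 := by
      rintro ⟨i, s, hs⟩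
      have h1 := (f3 i s).1 hs
      rw [f3]
      change (τ (τ ⟨i, s⟩)).1 ≠ (τ ⟨i, s⟩).1
      rw [hτ]
      exact h1.symm
    let s : (Σ i, (κ i).Unpaired) → Σ i, (κ i).Unpaired := fun p =>
      ⟨(τ (unpairedIncl κ p)).1, (τ (unpairedIncl κ p)).2, hσ p⟩
    have hs : ∀ p, unpairedIncl κ (s p) = τ (unpairedIncl κ p) := fun p => rfl
    let σ : ExternalPairing fun i => (κ i).Unpaired := ⟨⟨s, fun p => by
        apply unpairedIncl_injective κ
        rw [hs, hs, hτ], fun p h => hτ' _ (by rw [← hs, h])⟩,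
      fun p => (f3 p.1 p.2.1).1 p.2.2⟩
    refine ⟨⟨κ, σ⟩, Subtype.ext (funext fun p => ?_)⟩
    obtain ⟨i, t⟩ := p
    change joinFun κ σ ⟨i, t⟩ = τ ⟨i, t⟩
    by_cases ht : (κ i).1 t = t
    · exact joinFun_unpairedIncl κ σ ⟨i, t, ht⟩
    · rw [joinFun_of_paired κ σ ht]
      refine (f1 i t ?_).symm
      by_contra h
      exact ht (f2 i t h)

end Join

/-! ### Vertices of trees -/

theorem vertexCases_zero {α : Type} {n : ℕ} (b t : α) (f : Fin n → α) :
    vertexCases b t f 0 = b := by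
  rw [vertexCases, ← Fin.castSucc_zero, Fin.lastCases_castSucc, Fin.cases_zero]

theorem vertexCases_last {α : Type} {n : ℕ} (b t : α) (f : Fin n → α) :
    vertexCases b t f (Fin.last (n + 1)) = t := by
  rw [vertexCases, Fin.lastCases_last]

theorem eq_zero_or_eq_last_or_eq_innerVertex {n : ℕ} (v : Fin (n + 2)) :
    v = 0 ∨ v = Fin.last (n + 1) ∨ ∃ j, v = innerVertex j := by
  induction v using Fin.lastCases with
  | last => exact Or.inr (Or.inl rfl)
  | cast w =>
    induction w using Fin.cases with
    | zero => exact Or.inl rfl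
    | succ j => exact Or.inr (Or.inr ⟨j, rfl⟩)

theorem label_internalDiagram_zero (n : ℕ) (κ : Pairing (Fin n)) :
    (internalDiagram n κ).label (Quot.mk _ 0) = some (Sum.inl Leaf.bottom) :=
  vertexCases_zero (some (Sum.inl Leaf.bottom)) (some (Sum.inl Leaf.top)) _

theorem label_internalDiagram_last (n : ℕ) (κ : Pairing (Fin n)) :
    (internalDiagram n κ).label (Quot.mk _ (Fin.last (n + 1))) = some (Sum.inl Leaf.top) :=
  vertexCases_last (some (Sum.inl Leaf.bottom)) (some (Sum.inl Leaf.top)) _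

theorem label_internalDiagram_of_unpaired {n : ℕ} (κ : Pairing (Fin n)) {j : Fin n}
    (h : κ.1 j = j) :
    (internalDiagram n κ).label (Quot.mk _ (innerVertex j)) = some (Sum.inr ⟨j, h⟩) :=
  (vertexCases_innerVertex (some (Sum.inl Leaf.bottom)) (some (Sum.inl Leaf.top)) _ j).trans
    (dif_pos h)

theorem label_internalDiagram_of_paired {n : ℕ} (κ : Pairing (Fin n)) {j : Fin n}
    (h : κ.1 j ≠ j) : (internalDiagram n κ).label (Quot.mk _ (innerVertex j)) = none :=
  (vertexCases_innerVertex (some (Sum.inl Leaf.bottom)) (some (Sum.inl Leaf.top)) _ j).trans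
    (dif_neg h)

theorem leafConnected_internalDiagram (n : ℕ) (κ : Pairing (Fin n)) :
    (internalDiagram n κ).LeafConnected := by
  have h : ∀ v : Fin (n + 2), Relation.EqvGen (internalDiagram n κ).Adj (Quot.mk _ v)
      (Quot.mk _ 0) := by
    intro v
    induction v using Fin.induction with
    | zero => exact .refl _
    | succ e ih => exact (Relation.EqvGen.rel _ _ ⟨e, rfl, rfl⟩).symm.trans _ _ _ ih
  rintro ⟨v⟩
  refine ⟨_, h v, ?_⟩
  rw [label_internalDiagram_zero]
  simp

section Paired

variable {k : ℕ} {n : Fin k → ℕ}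

variable (τ : CompletePairing (Σ i, Fin (n i)))

theorem label_mk_zero (i : Fin k) :
    (pairedDiagram n τ).label (Quot.mk _ ⟨i, 0⟩) = some (i, Leaf.bottom) :=
  vertexCases_zero (some (i, Leaf.bottom)) (some (i, Leaf.top)) _

theorem label_mk_last (i : Fin k) :
    (pairedDiagram n τ).label (Quot.mk _ ⟨i, Fin.last _⟩) = some (i, Leaf.top) :=
  vertexCases_last (some (i, Leaf.bottom)) (some (i, Leaf.top)) _

theorem leafConnected_pairedDiagram :
    (pairedDiagram n τ).LeafConnected := by
  have h : ∀ i (v : Fin (n i + 2)), Relation.EqvGen (pairedDiagram n τ).Adj (Quot.mk _ ⟨i, v⟩)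
      (Quot.mk _ ⟨i, 0⟩) := by
    intro i v
    induction v using Fin.induction with
    | zero => exact .refl _
    | succ e ih => exact (Relation.EqvGen.rel _ _ ⟨⟨i, e⟩, rfl, rfl⟩).symm.trans _ _ _ ih
  rintro ⟨i, v⟩
  refine ⟨_, h i v, ?_⟩
  rw [label_mk_zero]
  simp

/-! ### Divergent subdiagrams of paired diagrams -/

/-- The vertex of a paired diagram that corresponds to a noise. -/
def noiseVertex (p : Σ i, Fin (n i)) : (pairedDiagram n τ).V := Quot.mk _ ⟨p.1, innerVertex p.2⟩

theorem noiseVertex_apply (p : Σ i, Fin (n i)) : noiseVertex τ (τ.1 p) = noiseVertex τ p :=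
  (Quot.sound ⟨p, rfl, rfl⟩).symm

theorem eq_or_eq_of_noiseVertex_eq {p q : Σ i, Fin (n i)}
    (h : noiseVertex τ p = noiseVertex τ q) : p = q ∨ p = τ.1 q := by
  -- Sending a noise vertex to its pair is compatible with the identifications, and it separates
  -- vertices of distinct pairs.
  let f : (pairedDiagram n τ).V → Option τ.Pairs := Quot.lift
    (fun v => vertexCases none none (fun j => some (Quot.mk _ ⟨v.1, j⟩)) v.2) (by
      rintro v w ⟨p, rfl, rfl⟩
      simp only [vertexCases_innerVertex]
      exact congrArg some (Quot.sound rfl))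
  have hf : ∀ p, f (noiseVertex τ p) = some (Quot.mk _ p) := by
    rintro ⟨i, j⟩
    exact vertexCases_innerVertex _ _ _ j
  have h1 := congrArg f h
  rw [hf, hf] at h1
  exact (τ.mk_eq_mk_iff _ _).1 (Option.some_injective _ h1).symm

theorem label_noiseVertex (p : Σ i, Fin (n i)) :
    (pairedDiagram n τ).label (noiseVertex τ p) = none :=
  vertexCases_innerVertex (some (p.1, Leaf.bottom)) (some (p.1, Leaf.top)) _ p.2

/-- The ends of such an edge are internal, which excludes the edges at the two leaves. As the `j`-th
noise sits at vertex `j + 1`, the edge `j.succ` leads from it to the next noise. -/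
theorem edge_of_mem {γ : (pairedDiagram n τ).Subdiagram} {i : Fin k} {e : Fin (n i + 1)}
    (he : (⟨i, e⟩ : Σ i, Fin (n i + 1)) ∈ γ.edges) :
    ∃ j j' : Fin (n i), e = j.succ ∧ j < j' ∧ noiseVertex τ ⟨i, j⟩ ∈ γ.verts ∧
      noiseVertex τ ⟨i, j'⟩ ∈ γ.verts := by
  have hs : (Quot.mk _ ⟨i, e.castSucc⟩ : (pairedDiagram n τ).V) ∈ γ.verts := γ.src_mem _ he
  have ht : (Quot.mk _ ⟨i, e.succ⟩ : (pairedDiagram n τ).V) ∈ γ.verts := γ.tgt_mem _ he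
  induction e using Fin.cases with
  | zero =>
    have := γ.internal _ hs
    rw [Fin.castSucc_zero, label_mk_zero] at this
    simp at this
  | succ j =>
    rcases eq_zero_or_eq_last_or_eq_innerVertex j.succ.succ with h | h | ⟨j', h⟩
    · exact (Fin.succ_ne_zero _ h).elim
    · have := γ.internal _ ht
      rw [h, label_mk_last] at this
      simp at this
    · refine ⟨j, j', rfl, ?_, hs, ?_⟩
      · have h1 := congrArg Fin.val h
        simp [innerVertex] at h1
        exact Fin.lt_def.2 (by omega)
      · rw [h] at ht
        exact ht

theorem ncard_noiseVertex_preimage_le (s : Set (pairedDiagram n τ).V) :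
    {p | noiseVertex τ p ∈ s}.ncard ≤ 2 * s.ncard := by
  classical
  rw [Set.ncard_eq_toFinset_card', Set.ncard_eq_toFinset_card']
  refine (Finset.card_le_mul_card_image (f := noiseVertex τ) _ 2 fun v hv => ?_).trans
    (Nat.mul_le_mul_left 2 (Finset.card_le_card fun v hv => ?_))
  · obtain ⟨p, -, rfl⟩ := Finset.mem_image.1 hv
    refine (Finset.card_le_card (t := {p, τ.1 p}) fun q hq => ?_).trans Finset.card_le_two
    have := eq_or_eq_of_noiseVertex_eq τ (Finset.mem_filter.1 hq).2
    simpa using this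
  · obtain ⟨p, hp, rfl⟩ := Finset.mem_image.1 hv
    simpa using hp

theorem exists_max_noise (s : Set (pairedDiagram n τ).V) {p : Σ i, Fin (n i)}
    (hp : noiseVertex τ p ∈ s) : ∃ j : Fin (n p.1), noiseVertex τ ⟨p.1, j⟩ ∈ s ∧
      ∀ j', noiseVertex τ ⟨p.1, j'⟩ ∈ s → j' ≤ j := by
  classical
  obtain ⟨j, hj, hj'⟩ := Finset.exists_max_image
    (Finset.univ.filter fun j : Fin (n p.1) => noiseVertex τ ⟨p.1, j⟩ ∈ s) id
    ⟨p.2, by simpa using hp⟩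
  exact ⟨j, by simpa using hj, fun j' h => hj' j' (by simpa using h)⟩

/-- The noises of a divergent subdiagram all belong to the same tree. -/
theorem fst_eq_of_divergent {γ : (pairedDiagram n τ).Subdiagram} (hγ : γ.Divergent)
    {p q : Σ i, Fin (n i)} (hp : noiseVertex τ p ∈ γ.verts) (hq : noiseVertex τ q ∈ γ.verts) :
    p.1 = q.1 := by
  by_contra hpq
  obtain ⟨a, ha, ha'⟩ := exists_max_noise τ γ.verts hp
  obtain ⟨b, hb, hb'⟩ := exists_max_noise τ γ.verts hq
  -- `A` consists of the noises of `γ`, and `B` of the last one in each of two trees. An edge of `γ`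
  -- starts at a noise followed by a later one of the same tree, hence at an element of `A \ B`.
  set A : Set (Σ i, Fin (n i)) := {p | noiseVertex τ p ∈ γ.verts}
  set B : Set (Σ i, Fin (n i)) := {⟨p.1, a⟩, ⟨q.1, b⟩}
  have hB : B.ncard = 2 := Set.ncard_pair fun h => hpq (Sigma.mk.inj h).1
  have hBA : B ⊆ A := by
    rintro _ (rfl | rfl)
    · exact ha
    · exact hb
  have hE : γ.edges ⊆ (fun r : Σ i, Fin (n i) => (⟨r.1, r.2.succ⟩ : Σ i, Fin (n i + 1))) ''
      (A \ B) := by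
    rintro ⟨i, e⟩ he
    obtain ⟨j, j', rfl, hj, h1, h2⟩ := edge_of_mem τ he
    refine ⟨⟨i, j⟩, ⟨h1, ?_⟩, rfl⟩
    rintro (h | h)
    · cases h
      exact absurd (ha' j' h2) (not_le.2 hj)
    · cases h
      exact absurd (hb' j' h2) (not_le.2 hj)
  have h1 : γ.edges.ncard ≤ (A \ B).ncard :=
    (Set.ncard_le_ncard hE (Set.toFinite _)).trans (Set.ncard_image_le (Set.toFinite _))
  have h2 : (A \ B).ncard + B.ncard = A.ncard := Set.ncard_sdiff_add_ncard_of_subset hBA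
  have h3 : A.ncard ≤ 2 * γ.verts.ncard := ncard_noiseVertex_preimage_le τ γ.verts
  -- Here `|E| ≤ |A| - 2 ≤ 2|V| - 2`, which makes the degree nonnegative.
  have h4 := hγ.2.2
  rw [FeynmanDiagram.Subdiagram.deg] at h4
  omega

end Paired

/-- With glued vertices and other pieces excluded, only internal vertices of `Δ i` remain, and the
source of an edge tells which piece the edge belongs to. -/
theorem FeynmanDiagram.Gluing.exists_push_eq {Λ Λ' K O : Type} {U : K → Type}
    {Γ : FeynmanDiagram Λ} {Δ : ∀ i, FeynmanDiagram (Λ' ⊕ U i)} {lab : K → Λ' → Λ}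
    {slot : ∀ i, U i → O} (g : Gluing Γ Δ lab slot) (γ : Γ.Subdiagram) {i : K}
    (h1 : ∀ o, g.node o ∉ γ.verts) (h2 : ∀ j v, g.vert j v ∈ γ.verts → j = i) :
    ∃ δ, g.push i δ = γ := by
  have h3 : ∀ v, g.vert i v ∈ γ.verts → (Δ i).label v = none := by
    intro v hv
    rcases h : (Δ i).label v with _ | l | u
    · rfl
    · have := γ.internal _ hv
      rw [g.label_leaf i v l h] at this
      simp at this
    · rw [g.vert_slot i v u h] at hv
      exact (h1 _ hv).elim
  refine ⟨⟨{v | g.vert i v ∈ γ.verts}, {e | g.edge ⟨i, e⟩ ∈ γ.edges}, h3, ?_, ?_⟩, ?_⟩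
  · intro e he
    have := γ.src_mem _ he
    rwa [g.src_edge] at this
  · intro e he
    have := γ.tgt_mem _ he
    rwa [g.tgt_edge] at this
  · apply Subdiagram.ext
    · ext v
      constructor
      · rintro ⟨w, hw, rfl⟩
        exact hw
      · intro hv
        rcases g.exists_of_internal v (γ.internal v hv) with ⟨o, rfl⟩ | ⟨j, w, -, rfl⟩
        · exact (h1 o hv).elim
        · obtain rfl := h2 j w hv
          exact ⟨w, hv, rfl⟩
    · ext e
      constructor
      · rintro ⟨e, he, rfl⟩
        exact he
      · intro he
        obtain ⟨⟨j, e⟩, rfl⟩ := g.edge.surjective e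
        have := γ.src_mem _ he
        rw [g.src_edge] at this
        obtain rfl := h2 j _ this
        exact ⟨e, he, rfl⟩

/-! ### Paired diagrams as gluings of internally paired trees -/

section Paired

variable {k : ℕ} {n : Fin k → ℕ} (κ : ∀ i, Pairing (Fin (n i)))
  (σ : ExternalPairing fun i => (κ i).Unpaired)

open Classical in
/-- The paired diagram of a complete pairing is glued from the diagrams of the trees with internal
pairings. -/
noncomputable def pairedGluing : (pairedDiagram n (join κ σ)).Gluing
    (fun i => internalDiagram (n i) (κ i)) (fun i l => (i, l)) σ.slot where
  vert i := Quot.lift (fun v => Quot.mk _ ⟨i, v⟩) (by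
    rintro v w ⟨j, rfl, rfl⟩
    by_cases h : (κ i).1 j = j
    · rw [h]
    · refine Quot.sound ⟨⟨i, j⟩, rfl, ?_⟩
      rw [join_of_paired κ σ h])
  edge := Equiv.refl _
  node := Quot.lift (fun p => noiseVertex (join κ σ) ⟨p.1, p.2.1⟩) (by
    rintro ⟨i, u⟩ _ rfl
    rw [← noiseVertex_apply, join_unpaired])
  -- This respects the identifications: the ends of an external pair share a slot, and those of an
  -- internal pair are one vertex of the tree's diagram.
  retract := Quot.lift (fun v => vertexCases none none (fun j =>
      if h : (κ v.1).1 j = j then some (Sum.inl (σ.slot v.1 ⟨j, h⟩))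
      else some (Sum.inr ⟨v.1, Quot.mk _ (innerVertex j)⟩)) v.2) (by
    rintro v w ⟨⟨i, j⟩, rfl, rfl⟩
    simp only [vertexCases_innerVertex]
    by_cases h : (κ i).1 j = j
    · have h1 := join_unpaired κ σ ⟨j, h⟩
      have h2 : (κ ((join κ σ).1 ⟨i, j⟩).1).1 ((join κ σ).1 ⟨i, j⟩).2 =
          ((join κ σ).1 ⟨i, j⟩).2 := by
        rw [h1]
        exact (σ.1.1 ⟨i, ⟨j, h⟩⟩).2.2
      rw [dif_pos h, dif_pos h2]
      refine congrArg some (congrArg Sum.inl (Quot.sound ?_))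
      apply unpairedIncl_injective κ
      exact h1
    · have h' : (κ i).1 ((κ i).1 j) ≠ (κ i).1 j := fun h' => h ((κ i).2.injective h')
      rw [dif_neg h]
      have h1 := join_of_paired κ σ h
      have h2 : ¬ (κ ((join κ σ).1 ⟨i, j⟩).1).1 ((join κ σ).1 ⟨i, j⟩).2 =
          ((join κ σ).1 ⟨i, j⟩).2 := by
        rw [h1]
        exact h'
      rw [dif_neg h2]
      refine congrArg some (congrArg Sum.inr ?_)
      rw [h1]
      exact congrArg (Sigma.mk i) (Quot.sound ⟨j, rfl, rfl⟩))
  src_edge _ _ := rfl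
  tgt_edge _ _ := rfl
  vert_slot i := by
    rintro ⟨v⟩ u hu
    rcases eq_zero_or_eq_last_or_eq_innerVertex v with rfl | rfl | ⟨j, rfl⟩
    · rw [label_internalDiagram_zero] at hu
      simp at hu
    · rw [label_internalDiagram_last] at hu
      simp at hu
    · by_cases h : (κ i).1 j = j
      · rw [label_internalDiagram_of_unpaired _ h] at hu
        obtain rfl : ⟨j, h⟩ = u := by simpa using hu
        rfl
      · rw [label_internalDiagram_of_paired _ h] at hu
        simp at hu
  label_leaf i := by
    rintro ⟨v⟩ l hl
    rcases eq_zero_or_eq_last_or_eq_innerVertex v with rfl | rfl | ⟨j, rfl⟩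
    · rw [label_internalDiagram_zero] at hl
      obtain rfl : Leaf.bottom = l := by simpa using hl
      exact label_mk_zero _ i
    · rw [label_internalDiagram_last] at hl
      obtain rfl : Leaf.top = l := by simpa using hl
      exact label_mk_last _ i
    · by_cases h : (κ i).1 j = j
      · rw [label_internalDiagram_of_unpaired _ h] at hl
        simp at hl
      · rw [label_internalDiagram_of_paired _ h] at hl
        simp at hl
  label_internal i := by
    rintro ⟨v⟩ hl
    rcases eq_zero_or_eq_last_or_eq_innerVertex v with rfl | rfl | ⟨j, rfl⟩
    · rw [label_internalDiagram_zero] at hl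
      simp at hl
    · rw [label_internalDiagram_last] at hl
      simp at hl
    · exact label_noiseVertex (join κ σ) ⟨i, j⟩
  label_node := by
    rintro ⟨p⟩
    exact label_noiseVertex (join κ σ) _
  retract_node := by
    rintro ⟨i, u⟩
    exact (vertexCases_innerVertex _ _ _ u.1).trans (dif_pos u.2)
  retract_vert i := by
    rintro ⟨v⟩ hl
    rcases eq_zero_or_eq_last_or_eq_innerVertex v with rfl | rfl | ⟨j, rfl⟩
    · rw [label_internalDiagram_zero] at hl
      simp at hl
    · rw [label_internalDiagram_last] at hl
      simp at hl
    · by_cases h : (κ i).1 j = j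
      · rw [label_internalDiagram_of_unpaired _ h] at hl
        simp at hl
      · exact (vertexCases_innerVertex _ _ _ j).trans (dif_neg h)
  exists_of_internal := by
    rintro ⟨i, v⟩ hl
    rcases eq_zero_or_eq_last_or_eq_innerVertex v with rfl | rfl | ⟨j, rfl⟩
    · rw [label_mk_zero] at hl
      simp at hl
    · rw [label_mk_last] at hl
      simp at hl
    · by_cases h : (κ i).1 j = j
      · exact Or.inl ⟨Quot.mk _ ⟨i, j, h⟩, rfl⟩
      · exact Or.inr ⟨i, Quot.mk _ (innerVertex j), label_internalDiagram_of_paired _ h, rfl⟩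

/-- A glued vertex carries two noises of different trees, so the power count keeps it out of `γ`;
all other vertices of `γ` lie in one tree by the same count. -/
theorem exists_push_of_divergent {γ : (pairedDiagram n (join κ σ)).Subdiagram}
    (hγ : γ.Divergent) : ∃ i δ, (pairedGluing κ σ).push i δ = γ := by
  have h1 : ∀ o, (pairedGluing κ σ).node o ∉ γ.verts := by
    rintro ⟨p⟩ hp
    have h2 : noiseVertex (join κ σ) ⟨p.1, p.2.1⟩ ∈ γ.verts := hp
    have h3 : noiseVertex (join κ σ) ((join κ σ).1 ⟨p.1, p.2.1⟩) ∈ γ.verts := by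
      rwa [noiseVertex_apply]
    have h4 := fst_eq_of_divergent _ hγ h3 h2
    rw [join_unpaired] at h4
    exact σ.2 p h4
  have h2 : ∀ i v, (pairedGluing κ σ).vert i v ∈ γ.verts →
      ∃ j, noiseVertex (join κ σ) ⟨i, j⟩ ∈ γ.verts := by
    rintro i ⟨v⟩ hv
    have hl := γ.internal _ hv
    rcases eq_zero_or_eq_last_or_eq_innerVertex v with rfl | rfl | ⟨j, rfl⟩
    · have := (label_mk_zero (join κ σ) i).symm.trans hl
      simp at this
    · have := (label_mk_last (join κ σ) i).symm.trans hl
      simp at this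
    · exact ⟨j, hv⟩
  obtain ⟨v, hv⟩ := hγ.nonempty
  rcases (pairedGluing κ σ).exists_of_internal v (γ.internal v hv) with ⟨o, rfl⟩ | ⟨i, w, -, rfl⟩
  · exact (h1 o hv).elim
  · obtain ⟨j, hj⟩ := h2 i w hv
    refine ⟨i, (pairedGluing κ σ).exists_push_eq γ h1 fun i' w' hw' => ?_⟩
    obtain ⟨j', hj'⟩ := h2 i' w' hw'
    exact fst_eq_of_divergent _ hγ hj' hj

theorem sum_join (f : CompletePairing (Σ i, Fin (n i)) → ℝ) :
    ∑ κ : ∀ i, Pairing (Fin (n i)), ∑ σ : ExternalPairing fun i => (κ i).Unpaired,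
      f (join κ σ) = ∑ τ, f τ := by
  rw [← join_bijective.sum_comp, Fintype.sum_sigma]

/-- The step at which BPHZ renormalisation meets the Gaussian moments: the right side is the term
that the external pairing `σ` contributes to the expectation. -/
theorem renormalisedValuation_join {G : T4 → ℝ} (hG : Measurable G)
    (hb : ∃ C, ∀ x, |G x| ≤ C) (x : Fin k × Leaf → T4) :
    (pairedDiagram n (join κ σ)).renormalisedValuation G x =
      ∫ z : σ.1.Pairs → T4, ∏ i, (internalDiagram (n i) (κ i)).renormalisedValuation G
        (Sum.elim (fun l => x (i, l)) fun u => z (σ.slot i u)) :=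
  (pairedGluing κ σ).renormalisedValuation_eq (fun _ => exists_push_of_divergent κ σ)
    (leafConnected_pairedDiagram _) (fun _ => leafConnected_internalDiagram _ _) hG hb x

end Paired

/-! ### Expectation of a product of renormalised trees -/

section Expectation

variable {Ω : Type*} [MeasurableSpace Ω] {P : Measure Ω} [IsProbabilityMeasure P]

/-- On a finite measure space a bounded kernel lies in every `L^q`, so the moment formula applies to
any number of trees. -/
theorem memLp_top_renormalisedValuation {G : T4 → ℝ} (hG : Measurable G)
    (hb : ∃ C, ∀ x, |G x| ≤ C) (n : ℕ) (κ : Pairing (Fin n)) (x y : T4) :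
    MemLp (fun z : κ.Unpaired → T4 => (internalDiagram n κ).renormalisedValuation G
      (Sum.elim (Leaf.point x y) z)) ⊤ volume := by
  obtain ⟨C, hC⟩ := (internalDiagram n κ).exists_abs_renormalisedValuation_le hG hb
  refine memLp_top_of_bound (Measurable.aestronglyMeasurable ?_) C
    (Filter.Eventually.of_forall fun z => hC _)
  refine ((internalDiagram n κ).measurable_renormalisedValuation hG hb).comp
    (measurable_pi_lambda _ fun l => ?_)
  rcases l with l | u
  · exact measurable_const
  · exact measurable_pi_apply _

theorem integral_prod_renormalisedPairedTree (ξ : WhiteNoise P) {G : T4 → ℝ} (hG : Measurable G)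
    (hb : ∃ C, ∀ x, |G x| ≤ C) {k : ℕ} {n : Fin k → ℕ} (κ : ∀ i, Pairing (Fin (n i)))
    (x y : Fin k → T4) :
    Integrable (fun ω => ∏ i, renormalisedPairedTree ξ G (n i) (κ i) (x i) (y i) ω) P ∧
      ∫ ω, ∏ i, renormalisedPairedTree ξ G (n i) (κ i) (x i) (y i) ω ∂P =
        ∑ σ : ExternalPairing fun i => (κ i).Unpaired,
          (pairedDiagram n (join κ σ)).renormalisedValuation G
            (fun l => Leaf.point (x l.1) (y l.1) l.2) := by
  have h := integral_prod_wienerIntegral ξ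
    fun i => memLp_top_renormalisedValuation hG hb (n i) (κ i) (x i) (y i)
  refine ⟨h.1, h.2.trans (Finset.sum_congr rfl fun σ _ => ?_)⟩
  rw [renormalisedValuation_join κ σ hG hb]

/-- A product of sums over internal pairings is a sum over tuples of them; each tuple produces its
external pairings, and `sum_join` collects both into complete pairings. -/
theorem integral_prod_renormalisedTree (ξ : WhiteNoise P) {G : T4 → ℝ} (hG : Measurable G)
    (hb : ∃ C, ∀ x, |G x| ≤ C) {k : ℕ} (n : Fin k → ℕ) (x y : Fin k → T4) :
    Integrable (fun ω => ∏ i, renormalisedTree ξ G (n i) (x i) (y i) ω) P ∧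
      ∫ ω, ∏ i, renormalisedTree ξ G (n i) (x i) (y i) ω ∂P =
        ∑ κ : CompletePairing (Σ i, Fin (n i)),
          (pairedDiagram n κ).renormalisedValuation G
            (fun l => Leaf.point (x l.1) (y l.1) l.2) := by
  have h := fun κ : ∀ i, Pairing (Fin (n i)) =>
    integral_prod_renormalisedPairedTree ξ hG hb κ x y
  simp only [renormalisedTree, Finset.prod_univ_sum, Fintype.piFinset_univ]
  refine ⟨integrable_finsetSum _ fun κ _ => (h κ).1, ?_⟩
  rw [integral_finsetSum _ fun κ _ => (h κ).1, ← sum_join]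
  exact Finset.sum_congr rfl fun κ _ => (h κ).2

end Expectation

/-! ### The mollified Green's function is bounded and measurable -/

theorem circleRep_coe {a : ℝ} (ha : a ∈ Ico (-Real.pi) Real.pi) : circleRep a = a := by
  rw [circleRep, AddCircle.equivIco_coe_eq (by
    rwa [show -Real.pi + 2 * Real.pi = Real.pi by ring])]

theorem coe_circleRep (a : AddCircle (2 * Real.pi)) : ((circleRep a : ℝ) : AddCircle _) = a :=
  AddCircle.coe_equivIco

/-- The interval of length `2π` around `2πm`. -/
def periodIco (m : ℤ) : Set ℝ := Ico (-Real.pi + 2 * Real.pi * m) (Real.pi + 2 * Real.pi * m)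

theorem measurePreserving_circleRep :
    MeasurePreserving circleRep volume (volume.restrict (Ico (-Real.pi) Real.pi)) := by
  refine ⟨measurable_circleRep, ?_⟩
  have h := AddCircle.measurePreserving_mk (2 * Real.pi) (-Real.pi)
  rw [show -Real.pi + 2 * Real.pi = Real.pi by ring,
    ← Measure.restrict_congr_set Ico_ae_eq_Ioc] at h
  rw [← h.map_eq, Measure.map_map measurable_circleRep h.measurable]
  refine Eq.trans (Measure.map_congr ?_) Measure.map_id
  filter_upwards [ae_restrict_mem measurableSet_Ico] with a ha
  exact circleRep_coe ha

theorem measurePreserving_circleRep_add (m : ℤ) :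
    MeasurePreserving (fun a => circleRep a + 2 * Real.pi * m) volume
      (volume.restrict (periodIco m)) := by
  have h := (measurePreserving_add_right (volume : Measure ℝ)
    (2 * Real.pi * m)).restrict_preimage (s := periodIco m) measurableSet_Ico
  rw [periodIco, preimage_add_const_Ico, add_sub_cancel_right, add_sub_cancel_right] at h
  exact h.comp measurePreserving_circleRep

theorem mem_periodIco_iff {a : ℝ} {m : ℤ} :
    a ∈ periodIco m ↔ ⌊(a + Real.pi) / (2 * Real.pi)⌋ = m := by
  have h := Real.two_pi_pos
  rw [Int.floor_eq_iff, le_div_iff₀ h, div_lt_iff₀ h, periodIco, mem_Ico]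
  constructor
  · rintro ⟨h1, h2⟩
    constructor <;> linarith
  · rintro ⟨h1, h2⟩
    constructor <;> linarith

/-- The cube of side length `2π` around `2πm`. -/
def periodCube (m : Fin 4 → ℤ) : Set (Fin 4 → ℝ) := univ.pi fun i => periodIco (m i)

theorem mem_periodCube_iff {y : Fin 4 → ℝ} {m : Fin 4 → ℤ} :
    y ∈ periodCube m ↔ (fun i => ⌊(y i + Real.pi) / (2 * Real.pi)⌋) = m := by
  simp [periodCube, mem_periodIco_iff, funext_iff]

/-- The representative in `periodCube m` of a point of the torus. -/
noncomputable def torusRep (m : Fin 4 → ℤ) (x : T4) (i : Fin 4) : ℝ :=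
  circleRep (x i) + 2 * Real.pi * m i

theorem measurePreserving_torusRep (m : Fin 4 → ℤ) :
    MeasurePreserving (torusRep m) volume (volume.restrict (periodCube m)) := by
  rw [volume_pi, volume_pi, periodCube, Measure.restrict_pi_pi]
  exact measurePreserving_pi _ _ fun i => measurePreserving_circleRep_add (m i)

theorem lintegral_torusRep (m : Fin 4 → ℤ) {f : (Fin 4 → ℝ) → ENNReal} (hf : Measurable f) :
    ∫⁻ x : T4, f (torusRep m x) = ∫⁻ y in periodCube m, f y :=
  (measurePreserving_torusRep m).lintegral_comp hf

/-- The periodic cubes are disjoint, so their contributions add up to at most the integral over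
`ℝ⁴`. -/
theorem tsum_lintegral_torusRep_le {f : (Fin 4 → ℝ) → ENNReal} (hf : Measurable f) :
    ∑' m, ∫⁻ x : T4, f (torusRep m x) ≤ ∫⁻ y, f y := by
  simp_rw [lintegral_torusRep _ hf]
  rw [← lintegral_iUnion]
  · exact setLIntegral_le_lintegral _ _
  · exact fun m => MeasurableSet.univ_pi fun i => measurableSet_Ico
  · intro m m' h
    refine Set.disjoint_left.2 fun y hy hy' => h ?_
    rw [← mem_periodCube_iff.1 hy, ← mem_periodCube_iff.1 hy']

theorem coe_torusRep (m : Fin 4 → ℤ) (x : T4) (i : Fin 4) :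
    ((torusRep m x i : ℝ) : AddCircle (2 * Real.pi)) = x i := by
  rw [torusRep, AddCircle.coe_add, coe_circleRep,
    show 2 * Real.pi * (m i : ℝ) = m i • (2 * Real.pi) by rw [zsmul_eq_mul, mul_comm],
    AddCircle.coe_zsmul, AddCircle.coe_period, smul_zero, add_zero]

/-- The heat kernel on `ℝ⁴`. -/
noncomputable def gaussian (t : ℝ) (y : Fin 4 → ℝ) : ℝ :=
  ((4 * Real.pi * t) ^ 2)⁻¹ * Real.exp (-(∑ i, y i ^ 2) / (4 * t))

theorem gaussian_nonneg (t : ℝ) (y : Fin 4 → ℝ) : 0 ≤ gaussian t y := by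
  unfold gaussian
  positivity

theorem measurable_gaussian : Measurable fun p : ℝ × (Fin 4 → ℝ) => gaussian p.1 p.2 := by
  unfold gaussian
  fun_prop

/-- The kernel is a product of four one-dimensional Gaussian densities of variance `2t`. -/
theorem lintegral_gaussian {t : ℝ} (ht : 0 < t) :
    ∫⁻ y, ENNReal.ofReal (gaussian t y) = 1 := by
  have hsqrt : √(2 * Real.pi * (2 * t)) ^ 4 = (2 * Real.pi * (2 * t)) ^ 2 := by
    rw [show √(2 * Real.pi * (2 * t)) ^ 4 = (√(2 * Real.pi * (2 * t)) ^ 2) ^ 2 by ring,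
      Real.sq_sqrt (by positivity)]
  have h : ∀ y, gaussian t y = ∏ i, gaussianPDFReal 0 (2 * t).toNNReal (y i) := by
    intro y
    simp only [gaussianPDFReal_def, Finset.prod_mul_distrib, Finset.prod_const, Finset.card_univ,
      Fintype.card_fin, ← Real.exp_sum, ← Finset.sum_div, sub_zero, Finset.sum_neg_distrib,
      Real.coe_toNNReal (2 * t) (by positivity)]
    rw [gaussian, inv_pow, hsqrt]
    ring_nf
  have hi : Integrable fun y : Fin 4 → ℝ => ∏ i, gaussianPDFReal 0 (2 * t).toNNReal (y i) :=
    Integrable.fintype_prod fun _ => integrable_gaussianPDFReal _ _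
  simp_rw [h]
  rw [← ofReal_integral_eq_lintegral_ofReal hi (Filter.Eventually.of_forall fun y =>
      Finset.prod_nonneg fun i _ => gaussianPDFReal_nonneg _ _ _),
    integral_fintype_prod_volume_eq_prod, Finset.prod_congr rfl fun i _ =>
      integral_gaussianPDFReal_eq_one 0 (v := (2 * t).toNNReal) (by simpa using ht)]
  simp

/-- The heat kernel on the torus, with values in `[0, ∞]`. -/
noncomputable def eheatKernel (t : ℝ) (x : T4) : ENNReal :=
  ∑' m, ENNReal.ofReal (gaussian t (torusRep m x))

/-- No summability is needed: a divergent real sum is `0` by convention, and so is `⊤.toReal`.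
Values in `[0, ∞]` make Tonelli available. -/
theorem heatKernel_eq (t : ℝ) (x : T4) : heatKernel t x = (eheatKernel t x).toReal := by
  rw [eheatKernel, ENNReal.tsum_toReal_eq fun _ => ENNReal.ofReal_ne_top]
  simp_rw [ENNReal.toReal_ofReal (gaussian_nonneg _ _)]
  rfl

theorem measurable_ofReal_gaussian (m : Fin 4 → ℤ) :
    Measurable fun p : ℝ × T4 => ENNReal.ofReal (gaussian p.1 (torusRep m p.2)) :=
  (measurable_gaussian.comp (measurable_fst.prodMk
    ((measurePreserving_torusRep m).measurable.comp measurable_snd))).ennreal_ofReal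

theorem measurable_eheatKernel : Measurable fun p : ℝ × T4 => eheatKernel p.1 p.2 :=
  Measurable.tsum fun m => measurable_ofReal_gaussian m

theorem lintegral_eheatKernel_le {t : ℝ} (ht : 0 < t) : ∫⁻ x, eheatKernel t x ≤ 1 := by
  unfold eheatKernel
  have hm : ∀ m, Measurable fun x => ENNReal.ofReal (gaussian t (torusRep m x)) :=
    fun m => (measurable_ofReal_gaussian m).comp measurable_prodMk_left
  rw [lintegral_tsum fun m => (hm m).aemeasurable]
  refine (tsum_lintegral_torusRep_le (f := fun y => ENNReal.ofReal (gaussian t y)) ?_).trans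
    (lintegral_gaussian ht).le
  exact (measurable_gaussian.comp measurable_prodMk_left).ennreal_ofReal

attribute [irreducible] eheatKernel

theorem measurable_exp_mul_eheatKernel : Measurable fun p : T4 × ℝ =>
    ENNReal.ofReal (Real.exp (-p.2)) * eheatKernel p.2 p.1 := by
  have h1 : Measurable fun p : T4 × ℝ => ENNReal.ofReal (Real.exp (-p.2)) := by fun_prop
  have h2 : Measurable fun p : T4 × ℝ => eheatKernel p.2 p.1 :=
    measurable_eheatKernel.comp (measurable_snd.prodMk measurable_fst)
  exact h1.mul h2

theorem measurable_greenFunction : Measurable greenFunction := by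
  have h : Measurable fun p : T4 × ℝ => Real.exp (-p.2) * heatKernel p.2 p.1 := by
    have h1 := measurable_exp_mul_eheatKernel.ennreal_toReal
    simpa only [ENNReal.toReal_mul, ENNReal.toReal_ofReal (Real.exp_nonneg _),
      ← heatKernel_eq] using h1
  exact (h.stronglyMeasurable.integral_prod_right (ν := volume.restrict (Ioi (0 : ℝ)))).measurable

/-- By Tonelli: the heat kernel has mass at most one at each positive time, and `exp (-t)` is
integrable. The singularity at the origin never has to be estimated. -/
theorem lintegral_greenFunction_lt_top : ∫⁻ x, ‖greenFunction x‖ₑ < ⊤ := by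
  calc ∫⁻ x, ‖greenFunction x‖ₑ
      ≤ ∫⁻ x : T4, ∫⁻ t in Ioi (0 : ℝ), ENNReal.ofReal (Real.exp (-t)) * eheatKernel t x := by
        refine lintegral_mono fun x => (enorm_integral_le_lintegral_enorm _).trans
          (lintegral_mono fun t => ?_)
        rw [enorm_mul, Real.enorm_of_nonneg (Real.exp_nonneg _), heatKernel_eq,
          Real.enorm_of_nonneg ENNReal.toReal_nonneg]
        gcongr
        exact ENNReal.ofReal_toReal_le
    _ = ∫⁻ t in Ioi (0 : ℝ), ∫⁻ x : T4, ENNReal.ofReal (Real.exp (-t)) * eheatKernel t x :=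
        lintegral_lintegral_swap measurable_exp_mul_eheatKernel.aemeasurable
    _ ≤ ∫⁻ t in Ioi (0 : ℝ), ENNReal.ofReal (Real.exp (-t)) := by
        refine setLIntegral_mono' measurableSet_Ioi fun t ht => ?_
        have hm : Measurable (eheatKernel t) := measurable_eheatKernel.comp measurable_prodMk_left
        rw [lintegral_const_mul _ hm]
        exact mul_le_of_le_one_right' (lintegral_eheatKernel_le ht)
    _ < ⊤ := by
        rw [← ofReal_integral_eq_lintegral_ofReal (integrableOn_exp_neg_Ioi 0)
          (Filter.Eventually.of_forall fun t => Real.exp_nonneg _)]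
        exact ENNReal.ofReal_lt_top

theorem measurable_toTorus : Measurable toTorus := by
  refine (continuous_pi fun i => ?_).measurable
  exact (AddCircle.continuous_mk' _).comp (EuclideanSpace.proj (𝕜 := ℝ) i).continuous

theorem lintegral_sub_torus (f : T4 → ENNReal) (x : T4) :
    ∫⁻ w, f (x - w) = ∫⁻ w, f w := by
  have : (volume : Measure (AddCircle (2 * Real.pi))).IsNegInvariant := inferInstance
  have : (volume : Measure T4).IsNegInvariant := Measure.pi.isNegInvariant _
  exact lintegral_sub_left_eq_self f x

/-- The integral of a periodic function over a bounded set. -/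
theorem exists_setLIntegral_toTorus_le (R : ℝ) : ∃ N : ℕ, ∀ f : T4 → ENNReal, Measurable f →
    ∫⁻ y in {y : EuclideanSpace ℝ (Fin 4) | ‖y‖ ≤ R}, f (toTorus y) ≤ N * ∫⁻ w, f w := by
  -- Chosen so that a point with coordinates at most `|R|` in modulus lies in a cube with index in
  -- `[-M, M]⁴`.
  obtain ⟨M, hM⟩ := exists_nat_gt ((|R| + Real.pi) / (2 * Real.pi))
  let s : Finset (Fin 4 → ℤ) := Fintype.piFinset fun _ => Finset.Icc (-(M : ℤ)) M
  refine ⟨s.card, fun f hf => ?_⟩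
  let q : (Fin 4 → ℝ) → T4 := fun y i => (y i : AddCircle (2 * Real.pi))
  have hq : Measurable q := measurable_pi_lambda _ fun i =>
    (AddCircle.continuous_mk' _).measurable.comp (measurable_pi_apply i)
  have hcover : {y : EuclideanSpace ℝ (Fin 4) | ‖y‖ ≤ R} ⊆
      WithLp.ofLp ⁻¹' ⋃ m : s, periodCube m.1 := by
    intro y hy
    rw [mem_preimage, mem_iUnion]
    refine ⟨⟨fun i => ⌊(y i + Real.pi) / (2 * Real.pi)⌋, ?_⟩, mem_periodCube_iff.2 rfl⟩
    refine Fintype.mem_piFinset.2 fun i => Finset.mem_Icc.2 ?_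
    have h1 : |y i| ≤ |R| := (PiLp.norm_apply_le y i).trans (le_trans hy (le_abs_self R))
    have h2 := abs_le.1 h1
    have h3 := Real.two_pi_pos
    have h4 := Real.pi_pos
    rw [div_lt_iff₀ h3] at hM
    constructor
    · rw [Int.le_floor, le_div_iff₀ h3]
      push_cast
      nlinarith
    · refine Int.le_of_lt_add_one (Int.floor_lt.2 ?_)
      rw [div_lt_iff₀ h3]
      push_cast
      nlinarith
  have hmp := PiLp.volume_preserving_ofLp (Fin 4)
  have hms : MeasurableSet (⋃ m : s, periodCube m.1) :=
    MeasurableSet.iUnion fun m => MeasurableSet.univ_pi fun i => measurableSet_Ico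
  calc ∫⁻ y in {y : EuclideanSpace ℝ (Fin 4) | ‖y‖ ≤ R}, f (toTorus y)
      ≤ ∫⁻ y in WithLp.ofLp ⁻¹' ⋃ m : s, periodCube m.1, f (q (WithLp.ofLp y)) :=
        lintegral_mono_set hcover
    _ = ∫⁻ y in ⋃ m : s, periodCube m.1, f (q y) :=
        (hmp.restrict_preimage hms).lintegral_comp (hf.comp hq)
    _ ≤ ∑' m : s, ∫⁻ y in periodCube m.1, f (q y) := lintegral_iUnion_le _ _
    _ = ∑' _ : s, ∫⁻ w, f w := by
        congr 1
        funext m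
        rw [← lintegral_torusRep m.1 (f := fun y => f (q y)) (hf.comp hq)]
        congr 1
        funext w
        exact congrArg f (funext (coe_torusRep m.1 w))
    _ = s.card * ∫⁻ w, f w := by simp [tsum_fintype]

theorem measurable_mollifiedGreen {ρ : EuclideanSpace ℝ (Fin 4) → ℝ} (hρ : Continuous ρ) (ε : ℝ) :
    Measurable (mollifiedGreen ρ ε) := by
  have h : Measurable fun p : T4 × EuclideanSpace ℝ (Fin 4) =>
      (ε ^ 4)⁻¹ * ρ (ε⁻¹ • p.2) * greenFunction (p.1 - toTorus p.2) := by
    refine Measurable.mul ?_ (measurable_greenFunction.comp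
      (measurable_fst.sub (measurable_toTorus.comp measurable_snd)))
    exact (hρ.comp (by fun_prop : Continuous fun p : T4 × EuclideanSpace ℝ (Fin 4) =>
      ε⁻¹ • p.2)).measurable.const_mul _
  exact h.stronglyMeasurable.integral_prod_right.measurable

/-- The bound is the supremum of the rescaled mollifier, times the number of period cubes covering
its support, times the `L¹` norm of the Green's function. -/
theorem exists_abs_mollifiedGreen_le {ρ : EuclideanSpace ℝ (Fin 4) → ℝ} (hρ : Continuous ρ)
    (hc : HasCompactSupport ρ) {ε : ℝ} (hε : 0 < ε) : ∃ C, ∀ x, |mollifiedGreen ρ ε x| ≤ C := by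
  obtain ⟨B, hB⟩ := hc.exists_bound_of_continuous hρ
  obtain ⟨R, hR⟩ := hc.isCompact.isBounded.exists_norm_le
  obtain ⟨N, hN⟩ := exists_setLIntegral_toTorus_le (ε * R)
  set I := ∫⁻ x, ‖greenFunction x‖ₑ with hI
  set b := ENNReal.ofReal ((ε ^ 4)⁻¹ * B)
  have hfin : b * (N * I) ≠ ⊤ := ENNReal.mul_ne_top ENNReal.ofReal_ne_top
    (ENNReal.mul_ne_top (ENNReal.natCast_ne_top N) lintegral_greenFunction_lt_top.ne)
  refine ⟨(b * (N * I)).toReal, fun x => ?_⟩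
  have hx : ‖mollifiedGreen ρ ε x‖ₑ ≤ b * (N * I) := by
    calc ‖mollifiedGreen ρ ε x‖ₑ
        ≤ ∫⁻ y, ‖(ε ^ 4)⁻¹ * ρ (ε⁻¹ • y) * greenFunction (x - toTorus y)‖ₑ :=
          enorm_integral_le_lintegral_enorm _
      _ ≤ ∫⁻ y, {y : EuclideanSpace ℝ (Fin 4) | ‖y‖ ≤ ε * R}.indicator
            (fun y => b * ‖greenFunction (x - toTorus y)‖ₑ) y := by
          refine lintegral_mono fun y => ?_
          by_cases hy : ‖y‖ ≤ ε * R
          · rw [indicator_of_mem (show y ∈ {y | ‖y‖ ≤ ε * R} from hy), enorm_mul]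
            gcongr
            rw [Real.enorm_eq_ofReal_abs, abs_mul, abs_of_pos (by positivity : 0 < (ε ^ 4)⁻¹)]
            refine ENNReal.ofReal_le_ofReal ?_
            gcongr
            exact hB _
          · have : ρ (ε⁻¹ • y) = 0 := by
              by_contra h
              refine hy ?_
              have h1 := hR _ (subset_tsupport ρ h)
              rw [norm_smul, Real.norm_eq_abs, abs_of_pos (by positivity), inv_mul_le_iff₀ hε] at h1
              exact h1
            simp [this]
      _ = b * ∫⁻ y in {y : EuclideanSpace ℝ (Fin 4) | ‖y‖ ≤ ε * R},
            ‖greenFunction (x - toTorus y)‖ₑ := by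
          rw [lintegral_indicator (measurableSet_le measurable_norm measurable_const),
            lintegral_const_mul]
          exact (measurable_greenFunction.comp (measurable_toTorus.const_sub x)).enorm
      _ ≤ b * (N * I) := by
          gcongr
          refine (hN (fun w => ‖greenFunction (x - w)‖ₑ)
            (measurable_greenFunction.comp (measurable_id.const_sub x)).enorm).trans_eq ?_
          rw [lintegral_sub_torus fun w => ‖greenFunction w‖ₑ]
  have := ENNReal.toReal_mono hfin hx
  rwa [toReal_enorm, Real.norm_eq_abs] at this

end AndersonBPHZ

open AndersonBPHZ MeasureTheory in
theorem proposition2 {Ω : Type*} [MeasurableSpace Ω] (P : Measure Ω) [IsProbabilityMeasure P]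
    (ξ : WhiteNoise P)
    (ρ : EuclideanSpace ℝ (Fin 4) → ℝ) (hρ : IsMollifier ρ)
    (ε : ℝ) (hε : ε ∈ Set.Ioo (0 : ℝ) 1)
    (k : ℕ) (n : Fin k → ℕ) (hn : ∀ i, 1 ≤ n i) (x y : Fin k → T4) :
    Integrable (fun ω => ∏ i, renormalisedTree ξ (mollifiedGreen ρ ε) (n i) (x i) (y i) ω) P ∧
      ∫ ω, ∏ i, renormalisedTree ξ (mollifiedGreen ρ ε) (n i) (x i) (y i) ω ∂P =
        ∑ κ : CompletePairing (Σ i, Fin (n i)),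
          (pairedDiagram n κ).renormalisedValuation (mollifiedGreen ρ ε)
            (fun l => Leaf.point (x l.1) (y l.1) l.2) := by
  exact integral_prod_renormalisedTree ξ (measurable_mollifiedGreen hρ.smooth.continuous ε)
    (exists_abs_mollifiedGreen_le hρ.smooth.continuous hρ.compact hε.1) n x y
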